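/- Let $B\ge 1$ be real, and let $F$ be the class of all complex-valued multiplicative arithmetic functions $f$ (so $f(1)=1$ and $f(mn)=f(m)f(n)$ whenever $(m,n)=1$) with $|f(n)|\le B$ for all $n\ge 1$. Write $e(\alpha)=\exp(2\pi i\alpha)$ and, for a positive integer $N$ and real $\alpha$, $$S(\alpha)=\sum_{n=1}^{N} f(n)\,e(n\alpha).$$ Put $$z=8\sqrt{2\prod_{p>2}\left(1+\frac{1}{p^3-p^2-2p}\right)}\quad(\text{product over odd primes}),$$ $$a_1=1.59\,B^2,\quad a_2=\frac{\pi^2}{6}B^2z,\quad a_3=a_5=0.96\,B^2z,\quad a_4=B^2z,\quad a_6=1.32\,B^2z,$$ and, for real $E,R,q$, $$b_1(B,E)=B+9.82B^2+8.12(a_1+a_4)E+18.9a_3+3.46a_1+4.06a_4,\qquad b_2(B,E)=a_2\,\frac{\sqrt2\,E+1}{\log 2},$$ $$b_3(B,E,R,q)=B^2\,\frac{7.63}{\sqrt E}\,\frac{\log(4ER)}{(\log(ER))^{3/2}}\left(1+\frac{\log(64/E)+1}{\log q}\right)+1.48\,a_5+\frac{1.48\,a_6}{\sqrt{\log(ER)}}+\frac{a_5}{\log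 2}\,\frac{\log(2R)}{(\log(ER))^{3/2}}+\frac{a_6}{\log 2}\,\frac{1}{(\log(ER))^{3/2}}.$$ Then for all integers $N,q$ with $4\le q\le N$, all real $E\ge 4$, all integers $a$ with $(a,q)=1$, and all $f\in F$, $$\left|S\!\left(\frac aq\right)\right|\le b_1(B,E)\,\frac{N}{\log N}+b_2(B,E)\,\frac{N}{\varphi(q)^{1/2}}+b_3\!\left(B,E,\frac Nq,q\right)\sqrt{Nq}\,\left(\log\frac{EN}{q}\right)^{3/2},$$ where $\varphi$ is Euler's totient function. -/

import Mathlib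

namespace MontgomeryVaughan

noncomputable section

/-- The class `F` with parameter `B`: complex-valued multiplicative functions with
`|f(n)| ≤ B` for all `n`. -/
def BoundedMultiplicative (B : ℝ) (f : ArithmeticFunction ℂ) : Prop :=
  f.IsMultiplicative ∧ ∀ n : ℕ, ‖f n‖ ≤ B

/-- `e(α) = exp(2πiα)`. -/
def e (α : ℝ) : ℂ := Complex.exp (2 * Real.pi * Complex.I * α)

/-- `S(α) = ∑_{n=1}^N f(n) e(nα)`. -/
def S (f : ArithmeticFunction ℂ) (N : ℕ) (α : ℝ) : ℂ :=
  ∑ n ∈ Finset.Icc 1 N, f n * e (n * α)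

/-- The factor `1 + 1/(p³ - p² - 2p)`, used for primes `p > 2`. -/
def eulerFactor (p : ℕ) : ℝ := 1 + 1 / ((p : ℝ) ^ 3 - (p : ℝ) ^ 2 - 2 * (p : ℝ))

/-- The infinite product of these factors over the odd primes converges (unconditionally). -/
theorem multipliable_eulerFactor :
    Multipliable (fun p : {p : ℕ // p.Prime ∧ 2 < p} => eulerFactor p) := by
  unfold eulerFactor
  apply Real.multipliable_one_add_of_summable
  have hs : Summable (fun n : ℕ => 9 * (1 / (n : ℝ) ^ 2)) :=
    ((Real.summable_one_div_nat_pow (p := 2)).2 (by norm_num)).mul_left 9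
  have hs' : Summable (fun p : {p : ℕ // p.Prime ∧ 2 < p} => 9 * (1 / ((p : ℕ) : ℝ) ^ 2)) :=
    hs.comp_injective Subtype.val_injective
  refine Summable.of_nonneg_of_le ?_ ?_ hs'
  · rintro ⟨p, _, hp⟩
    have h3 : (3 : ℝ) ≤ p := by exact_mod_cast hp
    have : (0 : ℝ) < (p : ℝ) ^ 3 - (p : ℝ) ^ 2 - 2 * p := by
      have : (p : ℝ) ^ 3 - (p : ℝ) ^ 2 - 2 * p = p * ((p - 2) * (p + 1)) := by ring
      rw [this]
      have : (0 : ℝ) < (p : ℝ) - 2 := by linarith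
      positivity
    positivity
  · rintro ⟨p, _, hp⟩
    have h3 : (3 : ℝ) ≤ p := by exact_mod_cast hp
    have key : (p : ℝ) ^ 2 ≤ 9 * ((p : ℝ) ^ 3 - (p : ℝ) ^ 2 - 2 * p) := by
      nlinarith [mul_nonneg (sub_nonneg.2 h3) (sub_nonneg.2 h3), sq_nonneg (p : ℝ)]
    have hp2 : (0 : ℝ) < (p : ℝ) ^ 2 := by positivity
    have hd : (0 : ℝ) < (p : ℝ) ^ 3 - (p : ℝ) ^ 2 - 2 * p := by linarith
    show 1 / ((p : ℝ) ^ 3 - (p : ℝ) ^ 2 - 2 * p) ≤ 9 * (1 / (p : ℝ) ^ 2)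
    rw [mul_one_div, div_le_div_iff₀ hd hp2]
    linarith

/-- `z = 8 √(2 ∏_{p>2} (1 + 1/(p³ - p² - 2p)))`, the product being over primes. -/
def z : ℝ := 8 * Real.sqrt (2 * ∏' p : {p : ℕ // p.Prime ∧ 2 < p}, eulerFactor p)

def a₁ (B : ℝ) : ℝ := B ^ 2 * 1.59
def a₂ (B : ℝ) : ℝ := B ^ 2 * z * (Real.pi ^ 2 / 6)
def a₃ (B : ℝ) : ℝ := B ^ 2 * z * 0.96
def a₄ (B : ℝ) : ℝ := B ^ 2 * z
def a₅ (B : ℝ) : ℝ := B ^ 2 * z * 0.96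
def a₆ (B : ℝ) : ℝ := B ^ 2 * 1.32 * z

def b₁ (B E : ℝ) : ℝ :=
  B + 9.82 * B ^ 2 + 8.12 * (a₁ B + a₄ B) * E + 18.9 * a₃ B + 3.46 * a₁ B + 4.06 * a₄ B

def b₂ (B E : ℝ) : ℝ := a₂ B * ((Real.sqrt 2 * E + 1) / Real.log 2)

def b₃ (B E R q : ℝ) : ℝ :=
  B ^ 2 * (7.63 / Real.sqrt E) * (Real.log (4 * E * R) / Real.log (E * R) ^ (3 / 2 : ℝ))
      * (1 + (Real.log (64 / E) + 1) / Real.log q)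
    + a₅ B * 1.48
    + 1.48 * (a₆ B / Real.sqrt (Real.log (E * R)))
    + a₅ B / Real.log 2 * (Real.log (2 * R) / Real.log (E * R) ^ (3 / 2 : ℝ))
    + a₆ B / Real.log 2 * (1 / Real.log (E * R) ^ (3 / 2 : ℝ))

end

end MontgomeryVaughan

namespace MontgomeryVaughan

/-!
Since `∑ log (N / n)` over `n ≤ N` is `O(N)`, it suffices to bound `∑ f(n) (log n) e(nα)`. Write
`log n` as the sum of `log p` over the prime powers `p ^ k` dividing `n`; by multiplicativity the
terms with `k ≥ 2` and those with `p` dividing `n / p` contribute only `O(N)`, and a ramp of width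
`q` smooths the cutoff at `N`. What remains is a bilinear sum over primes `p` and integers `m` with
`m p ≤ N`. Very small and very large primes are treated trivially with Chebyshev's bound. For `p`
in a dyadic block, the Cauchy–Schwarz inequality in `m` removes `f(m)` and leaves, for every pair
of primes, a sum over `m` of products of ramps times `cos (2π m (p - p') α)`, which second
differences bound by a Fejér-type kernel at `h α` with `h = p - p'`. A sieve bounds the number of
prime pairs with difference `h` by a constant times `(σ(h) / h) P / (log P)²`, and for `α = a / q`
the spacing of the points `h a / q` modulo one controls the sum of the kernel over `h`.
-/

open Finset

/-! ### Sums of periodic functions -/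

section Periodic

lemma sum_range_mul_of_periodic {R : Type*} [CommSemiring R] {a b : ℕ} (ha : 0 < a) (hb : 0 < b)
    (hab : a.Coprime b) {F G : ℕ → R} (hF : Function.Periodic F a) (hG : Function.Periodic G b) :
    ∑ n ∈ range (a * b), F n * G n = (∑ n ∈ range a, F n) * ∑ n ∈ range b, G n := by
  have hmaps : Set.MapsTo (fun n => (n % a, n % b)) (range (a * b)) (range a ×ˢ range b) :=
    fun n _ => by simp [Nat.mod_lt _ ha, Nat.mod_lt _ hb]
  have hinj : Set.InjOn (fun n => (n % a, n % b)) (range (a * b)) := fun m hm n hn h =>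
    ((Nat.modEq_and_modEq_iff_modEq_mul hab).1 (Prod.ext_iff.1 h)).eq_of_lt_of_lt
      (by simpa using hm) (by simpa using hn)
  rw [sum_mul_sum, ← sum_product']
  refine sum_nbij _ (fun n hn => by exact_mod_cast hmaps hn) hinj ?_ fun n _ => ?_
  · exact_mod_cast surjOn_of_injOn_of_card_le _ (by exact_mod_cast hmaps) hinj (by simp)
  · simp only [hF.map_mod_nat, hG.map_mod_nat]

lemma periodic_prod {ι R : Type*} [CommMonoid R] {S : Finset ι} {m : ι → ℕ} {c : ι → ℕ → R}
    (hc : ∀ i ∈ S, Function.Periodic (c i) (m i)) :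
    Function.Periodic (fun n => ∏ i ∈ S, c i n) (∏ i ∈ S, m i) := fun n =>
  prod_congr rfl fun i hi => by
    obtain ⟨k, hk⟩ := dvd_prod_of_mem m hi
    simpa [hk, mul_comm] using (hc i hi).nat_mul k n

lemma sum_range_prod_of_periodic {ι R : Type*} [CommSemiring R] {S : Finset ι} {m : ι → ℕ}
    {c : ι → ℕ → R} (hm : ∀ i ∈ S, 0 < m i) (hcop : (S : Set ι).Pairwise (Nat.Coprime.onFun m))
    (hc : ∀ i ∈ S, Function.Periodic (c i) (m i)) :
    ∑ n ∈ range (∏ i ∈ S, m i), ∏ i ∈ S, c i n = ∏ i ∈ S, ∑ n ∈ range (m i), c i n := by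
  classical
  induction S using Finset.induction_on with
  | empty => simp
  | insert i S hi ih =>
    simp only [forall_mem_insert] at hm hc
    rw [coe_insert, Set.pairwise_insert_of_notMem (by simpa using hi)] at hcop
    simp only [prod_insert hi]
    rw [← ih hm.2 hcop.1 hc.2]
    exact sum_range_mul_of_periodic hm.1 (prod_pos hm.2)
      (Nat.Coprime.prod_right fun j hj => (hcop.2 j hj).1) hc.1 (periodic_prod hc.2)

lemma sum_range_add_of_periodic {M : Type*} [AddCommMonoid M] {L : ℕ} {F : ℕ → M}
    (hF : Function.Periodic F L) (x : ℕ) :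
    ∑ n ∈ range L, F (x + n) = ∑ n ∈ range L, F n := by
  have h := sum_Ico_eq_sum_range F x (x + L)
  rw [Nat.add_sub_cancel_left] at h
  rw [← h, ← Nat.image_Ico_mod x L, sum_image (Nat.mod_injOn_Ico x L)]
  exact sum_congr rfl fun n _ => (hF.map_mod_nat n).symm

lemma sum_range_le_of_periodic {L : ℕ} (hL : 0 < L) {F : ℕ → ℝ} (hF : Function.Periodic F L)
    {A μ : ℝ} (hA : ∀ n, F n ≤ A) (hA0 : 0 ≤ A) (hμ : 0 ≤ μ)
    (hmean : ∑ n ∈ range L, F n = L * μ) (H x : ℕ) :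
    ∑ n ∈ range H, F (x + n) ≤ H * μ + A * L := by
  induction H using Nat.strong_induction_on generalizing x with
  | _ H ih =>
    rcases lt_or_ge H L with h | h
    · calc ∑ n ∈ range H, F (x + n) ≤ H * A := by
            simpa using sum_le_card_nsmul (range H) _ A fun n _ => hA (x + n)
        _ ≤ L * A := by gcongr
        _ ≤ H * μ + A * L := by rw [mul_comm]; exact le_add_of_nonneg_left (by positivity)
    · obtain ⟨k, rfl⟩ := Nat.exists_eq_add_of_le h
      have hk := ih k (by lia) (x + L)
      rw [sum_range_add, sum_range_add_of_periodic hF, hmean]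
      simp only [add_assoc] at hk ⊢
      push_cast
      linarith

end Periodic

/-! ### An upper bound sieve -/

section Sieve

variable (Ω : ℕ → ℕ → Prop) [∀ p, DecidablePred (Ω p)]

/-- The number `ρ(p)` of residue classes modulo `p` that a sieve excludes. The sieve is given by
the predicates `Ω p`, periodic modulo `p`, which hold on the excluded classes. -/
def excludedCount (p : ℕ) : ℕ := #{n ∈ range p | Ω p n}

/-- The odds `ρ(p) / (p - ρ(p))` that an integer lies in an excluded class modulo `p`. -/
noncomputable def excludedOdds (p : ℕ) : ℝ := excludedCount Ω p / (p - excludedCount Ω p)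

/-- The mean-zero function modulo `p` which is `-1` on the excluded classes and constant on the
other ones. -/
noncomputable def sieveWeight (p n : ℕ) : ℝ := if Ω p n then -1 else excludedOdds Ω p

/-- The product of the mean-zero functions `sieveWeight` over the primes dividing `d`. -/
noncomputable def sieveProd (d n : ℕ) : ℝ := ∏ p ∈ d.primeFactors, sieveWeight Ω p n

/-- The mean square `∏_{p ∣ d} ρ(p) / (p - ρ(p))` of `sieveProd Ω d`. -/
noncomputable def sieveDensity (d : ℕ) : ℝ := ∏ p ∈ d.primeFactors, excludedOdds Ω p

/-- The sum `∑_{d ≤ Q} μ²(d) ∏_{p ∣ d} ρ(p) / (p - ρ(p))` of Montgomery's large sieve. -/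
noncomputable def sieveSum (Q : ℕ) : ℝ := ∑ d ∈ Icc 1 Q with Squarefree d, sieveDensity Ω d

variable {Ω}

lemma sum_comp_sieveWeight (p : ℕ) (g : ℝ → ℝ) :
    ∑ n ∈ range p, g (sieveWeight Ω p n) =
      excludedCount Ω p * g (-1) + (p - excludedCount Ω p) * g (excludedOdds Ω p) := by
  have hcard := card_filter_add_card_filter_not (s := range p) (Ω p)
  rw [card_range, ← excludedCount] at hcard
  have hcompl : (#{n ∈ range p | ¬ Ω p n} : ℝ) = p - excludedCount Ω p :=
    eq_sub_of_add_eq' (by exact_mod_cast hcard)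
  simp only [sieveWeight, apply_ite g, sum_ite, sum_const, nsmul_eq_mul, hcompl, excludedCount]

lemma sub_mul_excludedOdds {p : ℕ} (hρ : excludedCount Ω p < p) :
    (p - excludedCount Ω p) * excludedOdds Ω p = excludedCount Ω p :=
  mul_div_cancel₀ _ (sub_ne_zero.2 (by exact_mod_cast hρ.ne'))

lemma sum_sieveWeight {p : ℕ} (hρ : excludedCount Ω p < p) :
    ∑ n ∈ range p, sieveWeight Ω p n = 0 := by
  rw [sum_comp_sieveWeight p fun t => t, sub_mul_excludedOdds hρ]
  ring

lemma sum_sieveWeight_sq {p : ℕ} (hρ : excludedCount Ω p < p) :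
    ∑ n ∈ range p, sieveWeight Ω p n ^ 2 = p * excludedOdds Ω p := by
  rw [sum_comp_sieveWeight p fun t => t ^ 2]
  linear_combination (excludedOdds Ω p - 1) * sub_mul_excludedOdds hρ

lemma periodic_sieveWeight {p : ℕ} (hΩ : Function.Periodic (Ω p) p) :
    Function.Periodic (sieveWeight Ω p) p := fun n => by
  simp only [sieveWeight, hΩ n]

lemma excludedOdds_nonneg {p : ℕ} (hρ : excludedCount Ω p < p) : 0 ≤ excludedOdds Ω p :=
  div_nonneg (Nat.cast_nonneg _) (sub_nonneg.2 (by exact_mod_cast hρ.le))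

lemma sieveDensity_nonneg (hρ : ∀ p, p.Prime → excludedCount Ω p < p) (d : ℕ) :
    0 ≤ sieveDensity Ω d :=
  prod_nonneg fun p hp => excludedOdds_nonneg (hρ p (Nat.prime_of_mem_primeFactors hp))

lemma one_le_sieveSum (hρ : ∀ p, p.Prime → excludedCount Ω p < p) {Q : ℕ} (hQ : 1 ≤ Q) :
    1 ≤ sieveSum Ω Q := by
  have h : sieveDensity Ω 1 ≤ sieveSum Ω Q :=
    single_le_sum (f := sieveDensity Ω) (fun d _ => sieveDensity_nonneg hρ d) (by simp [hQ])
  simpa [sieveDensity] using h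

lemma pairwise_coprime_of_prime {S : Finset ℕ} (hS : ∀ p ∈ S, p.Prime) :
    (S : Set ℕ).Pairwise (Nat.Coprime.onFun fun p => p) := fun p hp r hr hpr =>
  (Nat.coprime_primes (hS p hp) (hS r hr)).2 hpr

/-- The factor at `p` of `sieveProd Ω d₁ * sieveProd Ω d₂`. -/
noncomputable def sieveFactor (Ω : ℕ → ℕ → Prop) [∀ p, DecidablePred (Ω p)] (d₁ d₂ p n : ℕ) : ℝ :=
  (if p ∈ d₁.primeFactors then sieveWeight Ω p n else 1) *
    if p ∈ d₂.primeFactors then sieveWeight Ω p n else 1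

lemma periodic_sieveFactor {p : ℕ} (hΩ : Function.Periodic (Ω p) p) (d₁ d₂ : ℕ) :
    Function.Periodic (sieveFactor Ω d₁ d₂ p) p := fun n => by
  simp only [sieveFactor, periodic_sieveWeight hΩ n]

lemma sieveProd_mul_sieveProd (d₁ d₂ n : ℕ) :
    sieveProd Ω d₁ n * sieveProd Ω d₂ n =
      ∏ p ∈ d₁.primeFactors ∪ d₂.primeFactors, sieveFactor Ω d₁ d₂ p n := by
  simp only [sieveFactor, prod_mul_distrib, prod_ite_mem]
  rw [inter_eq_right.2 subset_union_left, inter_eq_right.2 subset_union_right, sieveProd, sieveProd]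

lemma prod_sum_sieveFactor (hρ : ∀ p, p.Prime → excludedCount Ω p < p) {d₁ d₂ : ℕ}
    (h₁ : Squarefree d₁) (h₂ : Squarefree d₂) :
    ∏ p ∈ d₁.primeFactors ∪ d₂.primeFactors, ∑ n ∈ range p, sieveFactor Ω d₁ d₂ p n =
      (∏ p ∈ d₁.primeFactors ∪ d₂.primeFactors, p : ℕ) *
        if d₁ = d₂ then sieveDensity Ω d₁ else 0 := by
  split_ifs with hd
  · subst hd
    rw [union_self, sieveDensity, Nat.cast_prod, ← prod_mul_distrib]
    refine prod_congr rfl fun p hp => ?_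
    rw [← sum_sieveWeight_sq (hρ p (Nat.prime_of_mem_primeFactors hp))]
    exact sum_congr rfl fun n _ => by simp only [sieveFactor, if_pos hp, sq]
  · have hne : d₁.primeFactors ≠ d₂.primeFactors := fun h => hd <| by
      rw [← Nat.prod_primeFactors_of_squarefree h₁, h, Nat.prod_primeFactors_of_squarefree h₂]
    obtain ⟨p, hp⟩ := symmDiff_nonempty.2 hne
    have hunion : p ∈ d₁.primeFactors ∪ d₂.primeFactors := symmDiff_subset_union hp
    have hprime : p.Prime := by
      rcases mem_union.1 hunion with h | h <;> exact Nat.prime_of_mem_primeFactors h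
    rw [mul_zero]
    refine prod_eq_zero hunion ?_
    rw [← sum_sieveWeight (hρ p hprime)]
    rcases mem_symmDiff.1 hp with ⟨hin, hout⟩ | ⟨hin, hout⟩ <;>
      simp only [sieveFactor, if_pos hin, if_neg hout, one_mul, mul_one]

lemma prod_primeFactors_union_le {d₁ d₂ : ℕ} (h₁ : d₁ ≠ 0) (h₂ : d₂ ≠ 0) :
    ∏ p ∈ d₁.primeFactors ∪ d₂.primeFactors, p ≤ d₁ * d₂ := by
  rw [← Nat.primeFactors_mul h₁ h₂]
  exact Nat.le_of_dvd (Nat.pos_of_ne_zero (mul_ne_zero h₁ h₂)) (Nat.prod_primeFactors_dvd _)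

lemma sum_sieveProd_mul_le (hΩ : ∀ p, Function.Periodic (Ω p) p)
    (hρ : ∀ p, p.Prime → excludedCount Ω p < p) {C : ℝ} (hC : ∀ d n, |sieveProd Ω d n| ≤ C)
    {d₁ d₂ : ℕ} (h₁ : Squarefree d₁) (h₂ : Squarefree d₂) (H x : ℕ) :
    ∑ n ∈ range H, sieveProd Ω d₁ (x + n) * sieveProd Ω d₂ (x + n) ≤
      H * (if d₁ = d₂ then sieveDensity Ω d₁ else 0) + C ^ 2 * (d₁ * d₂ : ℕ) := by
  set S := d₁.primeFactors ∪ d₂.primeFactors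
  have hS : ∀ p ∈ S, p.Prime := fun p hp =>
    (mem_union.1 hp).elim Nat.prime_of_mem_primeFactors Nat.prime_of_mem_primeFactors
  have hper : ∀ p ∈ S, Function.Periodic (sieveFactor Ω d₁ d₂ p) p := fun p _ =>
    periodic_sieveFactor (hΩ p) d₁ d₂
  have hmean := sum_range_prod_of_periodic (fun p hp => (hS p hp).pos)
    (pairwise_coprime_of_prime hS) hper
  rw [prod_sum_sieveFactor hρ h₁ h₂] at hmean
  have hbound : ∀ n, ∏ p ∈ S, sieveFactor Ω d₁ d₂ p n ≤ C ^ 2 := fun n => by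
    rw [← sieveProd_mul_sieveProd, sq]
    refine (le_abs_self _).trans ((abs_mul _ _).trans_le ?_)
    exact mul_le_mul (hC _ _) (hC _ _) (abs_nonneg _) ((abs_nonneg _).trans (hC d₁ n))
  have hdens : (0 : ℝ) ≤ if d₁ = d₂ then sieveDensity Ω d₁ else 0 := by
    split_ifs
    exacts [sieveDensity_nonneg hρ _, le_rfl]
  simp only [sieveProd_mul_sieveProd]
  refine (sum_range_le_of_periodic (prod_pos fun p hp => (hS p hp).pos) (periodic_prod hper)
    hbound (sq_nonneg C) hdens hmean H x).trans ?_
  gcongr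
  exact prod_primeFactors_union_le h₁.ne_zero h₂.ne_zero

lemma sum_sq_sum_sieveProd_le (hΩ : ∀ p, Function.Periodic (Ω p) p)
    (hρ : ∀ p, p.Prime → excludedCount Ω p < p) {C : ℝ} (hC : ∀ d n, |sieveProd Ω d n| ≤ C)
    (Q H x : ℕ) :
    ∑ n ∈ range H, (∑ d ∈ Icc 1 Q with Squarefree d, sieveProd Ω d (x + n)) ^ 2 ≤
      H * sieveSum Ω Q + C ^ 2 * (Q : ℝ) ^ 4 := by
  set D := {d ∈ Icc 1 Q | Squarefree d}
  have hle : ∀ d ∈ D, d ≤ Q := fun d hd => (mem_Icc.1 (mem_filter.1 hd).1).2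
  have hcard : (#D : ℝ) ≤ Q := by exact_mod_cast (card_filter_le _ _).trans (Nat.card_Icc 1 Q).le
  calc ∑ n ∈ range H, (∑ d ∈ D, sieveProd Ω d (x + n)) ^ 2
      = ∑ d₁ ∈ D, ∑ d₂ ∈ D, ∑ n ∈ range H, sieveProd Ω d₁ (x + n) * sieveProd Ω d₂ (x + n) := by
        simp_rw [sq, sum_mul_sum]
        rw [sum_comm]
        exact sum_congr rfl fun _ _ => sum_comm
    _ ≤ ∑ d₁ ∈ D, ∑ d₂ ∈ D,
          (H * (if d₁ = d₂ then sieveDensity Ω d₁ else 0) + C ^ 2 * (Q : ℝ) ^ 2) := by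
        refine sum_le_sum fun d₁ h₁ => sum_le_sum fun d₂ h₂ =>
          (sum_sieveProd_mul_le hΩ hρ hC (mem_filter.1 h₁).2 (mem_filter.1 h₂).2 H x).trans ?_
        gcongr
        exact_mod_cast (Nat.mul_le_mul (hle d₁ h₁) (hle d₂ h₂)).trans_eq (sq Q).symm
    _ = H * sieveSum Ω Q + C ^ 2 * (#D : ℝ) ^ 2 * (Q : ℝ) ^ 2 := by
        simp_rw [sum_add_distrib, ← mul_sum, sum_ite_eq]
        rw [sum_congr rfl fun d hd => if_pos hd]
        simp only [sum_const, nsmul_eq_mul, sieveSum, D]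
        ring
    _ ≤ H * sieveSum Ω Q + C ^ 2 * (Q : ℝ) ^ 2 * (Q : ℝ) ^ 2 := by gcongr
    _ = _ := by ring

theorem card_sifted_le (hΩ : ∀ p, Function.Periodic (Ω p) p)
    (hρ : ∀ p, p.Prime → excludedCount Ω p < p) {C : ℝ} (hC : ∀ d n, |sieveProd Ω d n| ≤ C)
    {Q : ℕ} (hQ : 1 ≤ Q) (H x : ℕ) {Z : Finset ℕ} (hZ : Z ⊆ range H)
    (hsift : ∀ n ∈ Z, ∀ p : ℕ, p.Prime → p ≤ Q → ¬ Ω p (x + n)) :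
    (#Z : ℝ) ≤ H / sieveSum Ω Q + C ^ 2 * (Q : ℝ) ^ 4 := by
  set J := sieveSum Ω Q
  have hJ1 : 1 ≤ J := one_le_sieveSum hρ hQ
  have hval : ∀ n ∈ Z, ∑ d ∈ Icc 1 Q with Squarefree d, sieveProd Ω d (x + n) = J :=
    fun n hn => sum_congr rfl fun d hd => prod_congr rfl fun p hp => by
      have hpQ := (Nat.le_of_mem_primeFactors hp).trans (mem_Icc.1 (mem_filter.1 hd).1).2
      rw [sieveWeight, if_neg (hsift n hn p (Nat.prime_of_mem_primeFactors hp) hpQ)]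
  have hmain : (#Z : ℝ) * J ^ 2 ≤ H * J + C ^ 2 * (Q : ℝ) ^ 4 := by
    rw [← nsmul_eq_mul, ← sum_const, sum_congr rfl fun n hn => by rw [← hval n hn]]
    exact (sum_le_sum_of_subset_of_nonneg hZ fun _ _ _ => sq_nonneg _).trans
      (sum_sq_sum_sieveProd_le hΩ hρ hC Q H x)
  calc (#Z : ℝ) ≤ (H * J + C ^ 2 * (Q : ℝ) ^ 4) / J ^ 2 := (le_div_iff₀ (by positivity)).2 hmain
    _ = H / J + C ^ 2 * (Q : ℝ) ^ 4 / J ^ 2 := by field_simp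
    _ ≤ H / J + C ^ 2 * (Q : ℝ) ^ 4 := by
        gcongr
        exact div_le_self (by positivity) (one_le_pow₀ hJ1)

end Sieve

/-! ### A lower bound for the main term of the sieve -/

section SieveHom

variable (Ω : ℕ → ℕ → Prop) [∀ p, DecidablePred (Ω p)]

/-- The completely multiplicative function with value `ρ(p) / p` at each prime `p`. -/
noncomputable def sieveHom : ℕ →* ℝ where
  toFun n := if n = 0 then 0 else n.factorization.prod fun p k => (excludedCount Ω p / p : ℝ) ^ k
  map_one' := by simp
  map_mul' m n := by
    rcases eq_or_ne m 0 with rfl | hm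
    · simp
    rcases eq_or_ne n 0 with rfl | hn
    · simp
    rw [if_neg (mul_ne_zero hm hn), if_neg hm, if_neg hn, Nat.factorization_mul hm hn,
      Finsupp.prod_add_index' (by simp) (by intros; rw [pow_add])]

variable {Ω}

lemma sieveHom_apply {n : ℕ} (hn : n ≠ 0) :
    sieveHom Ω n = n.factorization.prod fun p k => (excludedCount Ω p / p : ℝ) ^ k :=
  if_neg hn

lemma sieveHom_prime {p : ℕ} (hp : p.Prime) : sieveHom Ω p = excludedCount Ω p / p := by
  rw [sieveHom_apply hp.ne_zero, hp.factorization]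
  simp

lemma sieveHom_nonneg (n : ℕ) : 0 ≤ sieveHom Ω n := by
  rcases eq_or_ne n 0 with rfl | hn
  · simp [sieveHom]
  · rw [sieveHom_apply hn]
    exact prod_nonneg fun p _ => by positivity

lemma norm_sieveHom_prime_lt_one {p : ℕ} (hp : p.Prime) (hρ : excludedCount Ω p < p) :
    ‖sieveHom Ω p‖ < 1 := by
  rw [Real.norm_of_nonneg (sieveHom_nonneg p), sieveHom_prime hp,
    div_lt_one (by exact_mod_cast hp.pos)]
  exact_mod_cast hρ

lemma sieveDensity_eq_sieveHom_mul_prod (hρ : ∀ p, p.Prime → excludedCount Ω p < p) {d : ℕ}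
    (hd : Squarefree d) :
    sieveDensity Ω d = sieveHom Ω d * ∏ p ∈ d.primeFactors, (1 - sieveHom Ω p)⁻¹ := by
  conv_rhs => rw [← Nat.prod_primeFactors_of_squarefree hd, map_prod,
    Nat.prod_primeFactors_of_squarefree hd, ← prod_mul_distrib]
  refine prod_congr rfl fun p hp => ?_
  have hprime := Nat.prime_of_mem_primeFactors hp
  have hp0 : (p : ℝ) ≠ 0 := by exact_mod_cast hprime.ne_zero
  have hsub : (p : ℝ) - excludedCount Ω p ≠ 0 := sub_ne_zero.2 (by exact_mod_cast (hρ p hprime).ne')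
  rw [sieveHom_prime hprime, excludedOdds]
  field_simp

open UniqueFactorizationMonoid in
/-- The geometric series behind `ρ / (p - ρ) = ∑_{k ≥ 1} (ρ / p) ^ k`, multiplied over `p ∣ d`. -/
lemma sum_sieveHom_le_sieveDensity (hρ : ∀ p, p.Prime → excludedCount Ω p < p) {d : ℕ}
    (hd : Squarefree d) {X : Finset ℕ} (hX0 : ∀ n ∈ X, n ≠ 0) (hX : ∀ n ∈ X, radical n = d) :
    ∑ n ∈ X, sieveHom Ω n ≤ sieveDensity Ω d := by
  have hdvd : ∀ n ∈ X, d ∣ n := fun n hn => hX n hn ▸ radical_dvd_self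
  have hmem : ∀ n ∈ X, n / d ∈ Nat.factoredNumbers d.primeFactors := fun n hn => by
    have hquot : n / d ∣ n := Nat.div_dvd_of_dvd (hdvd n hn)
    refine Nat.mem_factoredNumbers_of_primeFactors_subset
      (ne_zero_of_dvd_ne_zero (hX0 n hn) hquot) ?_
    rw [← hX n hn, Nat.primeFactors_radical, hX n hn]
    exact Nat.primeFactors_mono hquot (hX0 n hn)
  have hinj : Set.InjOn (fun n : X => (⟨n / d, hmem n n.2⟩ : Nat.factoredNumbers d.primeFactors))
      (univ : Finset X) := fun n _ m _ h =>
    Subtype.ext ((Nat.div_left_inj (hdvd n n.2) (hdvd m m.2)).1 (congrArg Subtype.val h))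
  have hEuler := (EulerProduct.summable_and_hasSum_factoredNumbers_prod_filter_prime_geometric
    (fun hp => norm_sieveHom_prime_lt_one hp (hρ _ hp)) d.primeFactors).2
  rw [filter_true_of_mem fun p hp => Nat.prime_of_mem_primeFactors hp] at hEuler
  have hquots : ∑ n ∈ X, sieveHom Ω (n / d) ≤ ∏ p ∈ d.primeFactors, (1 - sieveHom Ω p)⁻¹ := by
    classical
    have h := sum_le_hasSum ((univ : Finset X).image fun n => ⟨n / d, hmem n n.2⟩)
      (fun m _ => sieveHom_nonneg m.1) hEuler
    rwa [sum_image hinj, sum_coe_sort X fun n => sieveHom Ω (n / d)] at h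
  calc ∑ n ∈ X, sieveHom Ω n = sieveHom Ω d * ∑ n ∈ X, sieveHom Ω (n / d) := by
        rw [mul_sum]
        exact sum_congr rfl fun n hn => by rw [← map_mul, Nat.mul_div_cancel' (hdvd n hn)]
    _ ≤ sieveDensity Ω d := by
        rw [sieveDensity_eq_sieveHom_mul_prod hρ hd]
        exact mul_le_mul_of_nonneg_left hquots (sieveHom_nonneg d)

open UniqueFactorizationMonoid in
lemma sum_sieveHom_le_sieveSum (hρ : ∀ p, p.Prime → excludedCount Ω p < p) (Q : ℕ) :
    ∑ n ∈ Icc 1 Q, sieveHom Ω n ≤ sieveSum Ω Q := by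
  have h0 : ∀ n ∈ Icc 1 Q, n ≠ 0 := fun n hn => by have := mem_Icc.1 hn; lia
  have hmaps : ∀ n ∈ Icc 1 Q, radical n ∈ {d ∈ Icc 1 Q | Squarefree d} := fun n hn =>
    mem_filter.2 ⟨mem_Icc.2 ⟨Nat.radical_pos n,
      (Nat.radical_le_self_iff.2 (h0 n hn)).trans (mem_Icc.1 hn).2⟩, squarefree_radical⟩
  rw [← sum_fiberwise_of_maps_to hmaps]
  exact sum_le_sum fun d hd => sum_sieveHom_le_sieveDensity hρ (mem_filter.1 hd).2
    (fun n hn => h0 n (mem_filter.1 hn).1) fun n hn => (mem_filter.1 hn).2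

end SieveHom

/-! ### Prime pairs with a given difference -/

/-- The sieve for prime pairs `n, n + h`: modulo `p` the classes of `0` and `-h` are excluded. -/
def PairExcluded (h p n : ℕ) : Prop := p ∣ n ∨ p ∣ n + h

instance (h p : ℕ) : DecidablePred (PairExcluded h p) := fun _ =>
  inferInstanceAs (Decidable (_ ∨ _))

lemma periodic_pairExcluded (h p : ℕ) : Function.Periodic (PairExcluded h p) p := fun n => by
  simp only [PairExcluded, add_right_comm n p h, Nat.dvd_add_self_right]

lemma excludedCount_pairExcluded_of_dvd {h p : ℕ} (hp : 0 < p) (hd : p ∣ h) :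
    excludedCount (PairExcluded h) p = 1 := by
  rw [excludedCount, card_eq_one]
  refine ⟨0, Finset.ext fun n => ?_⟩
  simp only [mem_filter, mem_range, mem_singleton, PairExcluded, Nat.dvd_add_left hd, or_self]
  exact ⟨fun hn => Nat.eq_zero_of_dvd_of_lt hn.2 hn.1, fun hn => by simp [hn, hp]⟩

lemma excludedCount_pairExcluded_of_not_dvd {h p : ℕ} (hp : 0 < p) (hd : ¬ p ∣ h) :
    excludedCount (PairExcluded h) p = 2 := by
  have hpos : 0 < h % p := Nat.pos_of_ne_zero fun h0 => hd (Nat.dvd_of_mod_eq_zero h0)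
  have hlt : h % p < p := Nat.mod_lt _ hp
  rw [excludedCount, card_eq_two]
  refine ⟨0, p - h % p, by lia, Finset.ext fun n => ?_⟩
  have hmod : p ∣ n + h ↔ p ∣ n + h % p := by
    rw [Nat.dvd_iff_mod_eq_zero, Nat.dvd_iff_mod_eq_zero, Nat.add_mod_mod]
  rw [mem_filter, mem_range, PairExcluded, hmod, mem_insert, mem_singleton]
  constructor
  · rintro ⟨hn, h0 | h0⟩
    · exact Or.inl (Nat.eq_zero_of_dvd_of_lt h0 hn)
    · have := Nat.eq_of_dvd_of_lt_two_mul (by lia) h0 (by lia)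
      lia
  · rintro (rfl | rfl)
    · exact ⟨hp, Or.inl (dvd_zero p)⟩
    · exact ⟨by lia, Or.inr (by rw [Nat.sub_add_cancel hlt.le])⟩

lemma excludedCount_pairExcluded_le_two {h p : ℕ} (hp : 0 < p) :
    excludedCount (PairExcluded h) p ≤ 2 := by
  by_cases hd : p ∣ h
  · rw [excludedCount_pairExcluded_of_dvd hp hd]; norm_num
  · rw [excludedCount_pairExcluded_of_not_dvd hp hd]

lemma excludedCount_pairExcluded_lt {h p : ℕ} (hh : Even h) (hp : p.Prime) :
    excludedCount (PairExcluded h) p < p := by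
  rcases hp.two_le.eq_or_lt with rfl | h2
  · rw [excludedCount_pairExcluded_of_dvd two_pos hh.two_dvd]; norm_num
  · exact (excludedCount_pairExcluded_le_two hp.pos).trans_lt h2

lemma excludedOdds_pairExcluded_le {h p : ℕ} (hh : Even h) (hp : p.Prime) :
    excludedOdds (PairExcluded h) p ≤ if p = 3 then 2 else 1 := by
  have hlt : (excludedCount (PairExcluded h) p : ℝ) < p := by
    exact_mod_cast excludedCount_pairExcluded_lt hh hp
  rw [excludedOdds, div_le_iff₀ (sub_pos.2 hlt)]
  rcases eq_or_ne p 2 with rfl | h2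
  · rw [excludedCount_pairExcluded_of_dvd two_pos hh.two_dvd]
    norm_num
  · have hle : (excludedCount (PairExcluded h) p : ℝ) ≤ 2 := by
      exact_mod_cast excludedCount_pairExcluded_le_two hp.pos
    split_ifs with h3
    · subst h3
      push_cast
      linarith
    · have : (4 : ℝ) ≤ p := by exact_mod_cast (by have := hp.two_le; lia : 4 ≤ p)
      linarith

lemma abs_sieveProd_pairExcluded_le {h : ℕ} (hh : Even h) (d n : ℕ) :
    |sieveProd (PairExcluded h) d n| ≤ 2 := by
  have hweight : ∀ p ∈ d.primeFactors,
      |sieveWeight (PairExcluded h) p n| ≤ if p = 3 then 2 else 1 := fun p hp => by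
    have hprime := Nat.prime_of_mem_primeFactors hp
    unfold sieveWeight
    split_ifs with hex h3 h3
    · norm_num
    · norm_num
    all_goals
      rw [abs_of_nonneg (excludedOdds_nonneg (excludedCount_pairExcluded_lt hh hprime))]
      simpa [h3] using excludedOdds_pairExcluded_le hh hprime
  rw [sieveProd, abs_prod]
  refine (prod_le_prod (fun _ _ => abs_nonneg _) hweight).trans ?_
  rw [prod_ite_eq']
  split_ifs <;> norm_num

lemma card_coprime_divisors_prime_mul_le (h : ℕ) {p m : ℕ} (hp : p.Prime) (hm : m ≠ 0) :
    #{b ∈ (p * m).divisors | b.Coprime h} ≤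
      excludedCount (PairExcluded h) p * #{b ∈ m.divisors | b.Coprime h} := by
  by_cases hd : p ∣ h
  · rw [excludedCount_pairExcluded_of_dvd hp.pos hd, one_mul]
    refine card_le_card fun b hb => ?_
    simp only [mem_filter, Nat.mem_divisors] at hb ⊢
    exact ⟨⟨(hb.2.coprime_dvd_right hd).dvd_of_dvd_mul_left hb.1.1, hm⟩, hb.2⟩
  · set D := {b ∈ m.divisors | b.Coprime h}
    have hsub : {b ∈ (p * m).divisors | b.Coprime h} ⊆ D ∪ D.image (p * ·) := fun b hb => by
      simp only [D, mem_filter, Nat.mem_divisors, mem_union, mem_image] at hb ⊢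
      by_cases hpb : p ∣ b
      · obtain ⟨c, rfl⟩ := hpb
        exact Or.inr ⟨c, ⟨⟨Nat.dvd_of_mul_dvd_mul_left hp.pos hb.1.1, hm⟩,
          Nat.Coprime.coprime_mul_left hb.2⟩, rfl⟩
      · exact Or.inl ⟨⟨(hp.coprime_iff_not_dvd.2 hpb).symm.dvd_of_dvd_mul_left hb.1.1, hm⟩, hb.2⟩
    rw [excludedCount_pairExcluded_of_not_dvd hp.pos hd]
    calc _ ≤ #D + #(D.image (p * ·)) := (card_le_card hsub).trans (card_union_le _ _)
      _ ≤ 2 * #D := by rw [two_mul]; exact add_le_add_right card_image_le _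

lemma card_coprime_divisors_le (h : ℕ) {n : ℕ} (hn : n ≠ 0) :
    (#{b ∈ n.divisors | b.Coprime h} : ℝ) ≤ n * sieveHom (PairExcluded h) n := by
  induction n using induction_on_primes with
  | zero => exact absurd rfl hn
  | one => simpa using card_filter_le {1} (Nat.Coprime · h)
  | prime_mul p m hp ih =>
    have hm : m ≠ 0 := right_ne_zero_of_mul hn
    have hp0 : (p : ℝ) ≠ 0 := by exact_mod_cast hp.ne_zero
    calc (#{b ∈ (p * m).divisors | b.Coprime h} : ℝ)
        ≤ excludedCount (PairExcluded h) p * #{b ∈ m.divisors | b.Coprime h} := by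
          exact_mod_cast card_coprime_divisors_prime_mul_le h hp hm
      _ ≤ excludedCount (PairExcluded h) p * (m * sieveHom (PairExcluded h) m) := by
          gcongr
          exact ih hm
      _ = _ := by
          rw [map_mul, sieveHom_prime hp, Nat.cast_mul]
          field_simp

lemma harmonic_mul_coprime_harmonic_le (h r : ℕ) :
    (∑ a ∈ Icc 1 r, (1 : ℝ) / a) * ∑ b ∈ Icc 1 r with b.Coprime h, (1 : ℝ) / b ≤
      ∑ n ∈ Icc 1 (r * r), sieveHom (PairExcluded h) n := by
  set T := Icc 1 r ×ˢ {b ∈ Icc 1 r | b.Coprime h}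
  have hmaps : ∀ x ∈ T, x.1 * x.2 ∈ Icc 1 (r * r) := fun x hx => by
    simp only [T, mem_product, mem_filter, mem_Icc] at hx
    exact mem_Icc.2 ⟨Nat.mul_pos hx.1.1 hx.2.1.1, Nat.mul_le_mul hx.1.2 hx.2.1.2⟩
  rw [sum_mul_sum, ← sum_product', ← sum_fiberwise_of_maps_to hmaps]
  refine sum_le_sum fun n hn => ?_
  have hn0 : n ≠ 0 := by have := mem_Icc.1 hn; lia
  have hcard : #{x ∈ T | x.1 * x.2 = n} ≤ #{b ∈ n.divisors | b.Coprime h} := by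
    refine card_le_card_of_injOn Prod.snd (fun x hx => ?_) fun x hx y hy hxy => ?_
    · simp only [T, coe_filter, mem_product, mem_filter, Set.mem_ofPred_eq,
        Nat.mem_divisors] at hx ⊢
      exact ⟨⟨Dvd.intro_left _ hx.2, hn0⟩, hx.1.2.2⟩
    · simp only [T, coe_filter, mem_product, mem_filter, Set.mem_ofPred_eq, mem_Icc] at hx hy
      have hmul : x.1 * x.2 = y.1 * x.2 := by rw [hx.2, hxy, hy.2]
      exact Prod.ext (Nat.eq_of_mul_eq_mul_right hx.1.2.1.1 hmul) hxy
  calc ∑ x ∈ T with x.1 * x.2 = n, (1 : ℝ) / x.1 * (1 / x.2)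
      = #{x ∈ T | x.1 * x.2 = n} / n := by
        rw [sum_congr rfl fun x hx => by
          rw [one_div_mul_one_div, ← Nat.cast_mul, (mem_filter.1 hx).2], sum_const, nsmul_eq_mul,
          mul_one_div]
    _ ≤ n * sieveHom (PairExcluded h) n / n := by
        gcongr
        exact (Nat.cast_le.2 hcard).trans (card_coprime_divisors_le h hn0)
    _ = sieveHom (PairExcluded h) n := mul_div_cancel_left₀ _ (by exact_mod_cast hn0)

/-- The divisor sum `∑_{e ∣ h} 1 / e`, which bounds the singular series of the prime pair problem
with difference `h`. -/
noncomputable def sigmaInv (h : ℕ) : ℝ := ∑ e ∈ h.divisors, (1 : ℝ) / e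

lemma sigmaInv_nonneg (h : ℕ) : 0 ≤ sigmaInv h := sum_nonneg fun _ _ => by positivity

lemma one_le_sigmaInv {h : ℕ} (h0 : h ≠ 0) : 1 ≤ sigmaInv h := by
  have : (1 : ℝ) / (1 : ℕ) ≤ sigmaInv h :=
    single_le_sum (f := fun e : ℕ => (1 : ℝ) / e) (fun _ _ => by positivity)
      (Nat.one_mem_divisors.2 h0)
  simpa using this

lemma sum_one_div_sq_le_two (n : ℕ) : ∑ k ∈ Icc 1 n, (1 : ℝ) / (k : ℝ) ^ 2 ≤ 2 := by
  have hIoo : Ioo 0 (n + 1) = Icc 1 n := by ext; simp only [mem_Ioo, mem_Icc]; lia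
  simpa [hIoo] using sum_Ioo_inv_sq_le (α := ℝ) 0 (n + 1)

lemma exists_coprime_mul_divisor_mul_sq (h : ℕ) {n : ℕ} (hn : n ≠ 0) :
    ∃ b e k : ℕ, n = b * e * k ^ 2 ∧ b.Coprime h ∧ e ∣ h := by
  induction n using induction_on_primes with
  | zero => exact absurd rfl hn
  | one => exact ⟨1, 1, 1, by simp, Nat.coprime_one_left h, one_dvd h⟩
  | prime_mul p m hp ih =>
    obtain ⟨b, e, k, rfl, hb, he⟩ := ih (right_ne_zero_of_mul hn)
    by_cases hph : p ∣ h
    · by_cases hpe : p ∣ e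
      · obtain ⟨c, rfl⟩ := hpe
        exact ⟨b, c, p * k, by ring, hb, (Dvd.intro_left p rfl).trans he⟩
      · exact ⟨b, p * e, k, by ring, hb,
          (hp.coprime_iff_not_dvd.2 hpe).mul_dvd_of_dvd_of_dvd hph he⟩
    · exact ⟨p * b, e, k, by ring, (hp.coprime_iff_not_dvd.2 hph).mul_left hb, he⟩

lemma Icc_subset_image_coprime_mul_divisor_mul_sq {h : ℕ} (hh : h ≠ 0) (r : ℕ) :
    Icc 1 r ⊆ ({b ∈ Icc 1 r | b.Coprime h} ×ˢ h.divisors ×ˢ Icc 1 r).image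
      fun x => x.1 * x.2.1 * x.2.2 ^ 2 := fun n hn => by
  have hn1 := mem_Icc.1 hn
  obtain ⟨b, e, k, rfl, hb, he⟩ := exists_coprime_mul_divisor_mul_sq h (n := n) (by lia)
  have hpos : 0 < b * e * k ^ 2 := hn1.1
  have hbn : b ≤ b * e * k ^ 2 := Nat.le_of_dvd hpos (Dvd.intro _ (mul_assoc b e _).symm)
  have hkn : k ≤ b * e * k ^ 2 :=
    Nat.le_of_dvd hpos (Dvd.dvd.mul_left (dvd_pow_self k two_ne_zero) _)
  have hb0 : b ≠ 0 := by rintro rfl; simp at hpos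
  have hk0 : k ≠ 0 := by rintro rfl; simp at hpos
  simp only [mem_image, mem_product, mem_filter, mem_Icc, Nat.mem_divisors]
  exact ⟨(b, e, k), ⟨⟨⟨by lia, by lia⟩, hb⟩, ⟨he, hh⟩, by lia, by lia⟩, rfl⟩

lemma harmonic_le_coprime_harmonic {h : ℕ} (hh : h ≠ 0) (r : ℕ) :
    ∑ a ∈ Icc 1 r, (1 : ℝ) / a ≤
      (∑ b ∈ Icc 1 r with b.Coprime h, (1 : ℝ) / b) * (2 * sigmaInv h) := by
  set U := {b ∈ Icc 1 r | b.Coprime h}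
  calc ∑ a ∈ Icc 1 r, (1 : ℝ) / a
      ≤ ∑ x ∈ U ×ˢ h.divisors ×ˢ Icc 1 r, (1 : ℝ) / (x.1 * x.2.1 * x.2.2 ^ 2 : ℕ) :=
        (sum_le_sum_of_subset_of_nonneg (Icc_subset_image_coprime_mul_divisor_mul_sq hh r)
          fun _ _ _ => by positivity).trans
          (sum_image_le_of_nonneg (f := fun n : ℕ => (1 : ℝ) / n) fun _ _ => by positivity)
    _ = (∑ b ∈ U, (1 : ℝ) / b) * (sigmaInv h * ∑ k ∈ Icc 1 r, (1 : ℝ) / (k : ℝ) ^ 2) := by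
        rw [sigmaInv, sum_mul_sum, ← sum_product', sum_mul_sum, ← sum_product']
        refine sum_congr rfl fun x _ => ?_
        push_cast
        rw [one_div_mul_one_div, one_div_mul_one_div, mul_assoc]
    _ ≤ (∑ b ∈ U, (1 : ℝ) / b) * (sigmaInv h * 2) := by
        gcongr
        · exact sigmaInv_nonneg h
        · exact sum_one_div_sq_le_two r
    _ = _ := by rw [mul_comm (sigmaInv h)]

lemma log_le_sum_one_div (r : ℕ) : Real.log r ≤ ∑ a ∈ Icc 1 r, (1 : ℝ) / a := by
  have h := log_add_one_le_harmonic r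
  rw [harmonic_eq_sum_Icc] at h
  push_cast at h
  simp only [one_div]
  rcases Nat.eq_zero_or_pos r with rfl | hr
  · simp
  · exact (Real.log_le_log (by exact_mod_cast hr) (by linarith)).trans h

lemma log_sq_le_sieveSum {h : ℕ} (hh : Even h) (h0 : h ≠ 0) (r : ℕ) :
    Real.log r ^ 2 ≤ 2 * sigmaInv h * sieveSum (PairExcluded h) (r * r) := by
  set A := ∑ a ∈ Icc 1 r, (1 : ℝ) / a
  set C := ∑ b ∈ Icc 1 r with b.Coprime h, (1 : ℝ) / b
  have hAC : A * C ≤ sieveSum (PairExcluded h) (r * r) :=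
    (harmonic_mul_coprime_harmonic_le h r).trans
      (sum_sieveHom_le_sieveSum (fun _ => excludedCount_pairExcluded_lt hh) _)
  have hA : Real.log r ≤ A := log_le_sum_one_div r
  have hlog : 0 ≤ Real.log r := Real.log_natCast_nonneg r
  have hσ := sigmaInv_nonneg h
  calc Real.log r ^ 2 ≤ A ^ 2 := by gcongr
    _ = A * A := sq A
    _ ≤ A * (C * (2 * sigmaInv h)) :=
        mul_le_mul_of_nonneg_left (harmonic_le_coprime_harmonic h0 r) (hlog.trans hA)
    _ = 2 * sigmaInv h * (A * C) := by ring
    _ ≤ _ := by gcongr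

lemma card_prime_pairs_le_sieve {h : ℕ} (hh : Even h) {Q P : ℕ} (hQ : 1 ≤ Q) (hQP : Q ≤ P) :
    (#{p ∈ Ioc P (2 * P) | p.Prime ∧ (p + h).Prime} : ℝ) ≤
      P / sieveSum (PairExcluded h) Q + 4 * (Q : ℝ) ^ 4 := by
  set Z := {n ∈ range P | (P + 1 + n).Prime ∧ (P + 1 + n + h).Prime}
  have hcard : #{p ∈ Ioc P (2 * P) | p.Prime ∧ (p + h).Prime} ≤ #Z := by
    refine card_le_card_of_injOn (fun p => p - (P + 1)) (fun p hp => ?_) fun p hp r hr hpr => ?_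
    · simp only [coe_filter, mem_Ioc, Set.mem_ofPred_eq, Z, mem_range] at hp ⊢
      rw [show P + 1 + (p - (P + 1)) = p by lia]
      exact ⟨by lia, hp.2⟩
    · simp only [coe_filter, mem_Ioc, Set.mem_ofPred_eq] at hp hr hpr
      lia
  have hsift : ∀ n ∈ Z, ∀ p : ℕ, p.Prime → p ≤ Q → ¬ PairExcluded h p (P + 1 + n) := by
    intro n hn p hp hpQ hex
    have hprimes := (mem_filter.1 hn).2
    rcases hex with hd | hd
    · have := (Nat.prime_dvd_prime_iff_eq hp hprimes.1).1 hd
      lia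
    · have := (Nat.prime_dvd_prime_iff_eq hp hprimes.2).1 hd
      lia
  calc (#{p ∈ Ioc P (2 * P) | p.Prime ∧ (p + h).Prime} : ℝ) ≤ #Z := by exact_mod_cast hcard
    _ ≤ P / sieveSum (PairExcluded h) Q + 2 ^ 2 * (Q : ℝ) ^ 4 :=
      card_sifted_le (periodic_pairExcluded h) (fun _ => excludedCount_pairExcluded_lt hh)
        (abs_sieveProd_pairExcluded_le hh) hQ P (P + 1) (filter_subset _ _) hsift
    _ = _ := by norm_num

lemma filter_prime_pairs_eq_empty_of_odd {h P : ℕ} (hh : Odd h) (hP : 2 ≤ P) :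
    {p ∈ Ioc P (2 * P) | p.Prime ∧ (p + h).Prime} = ∅ := by
  rw [filter_eq_empty_iff]
  rintro p hp ⟨hp1, hp2⟩
  have := mem_Ioc.1 hp
  exact Nat.not_even_iff_odd.2 (hp2.odd_of_ne_two (by lia))
    ((hp1.odd_of_ne_two (by lia)).add_odd hh)

lemma add_one_sq_le_four_pow {a : ℕ} (ha : 13 ≤ a) : 102400 * (a + 1) ^ 2 ≤ 4 ^ a := by
  induction a, ha using Nat.le_induction with
  | base => norm_num
  | succ n hn ih => rw [pow_succ 4]; nlinarith

lemma sieve_error_le {j : ℕ} (hj : 130 ≤ j) :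
    4 * (((2 ^ (j / 10 + 1) * 2 ^ (j / 10 + 1) : ℕ) : ℝ)) ^ 4 ≤
      (2 : ℝ) ^ j / Real.log ((2 : ℝ) ^ j) ^ 2 := by
  have : 0 < Real.log 2 := Real.log_pos one_lt_two
  have : (0 : ℝ) < j := by exact_mod_cast (by lia : 0 < j)
  rw [Real.log_pow, le_div_iff₀ (by positivity)]
  set a := j / 10
  have hja : 10 * a ≤ j := Nat.mul_div_le j 10
  have hlog : (j : ℝ) * Real.log 2 ≤ 10 * (a + 1) :=
    calc (j : ℝ) * Real.log 2 ≤ j * 1 := by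
          gcongr
          linarith [Real.log_two_lt_d9]
      _ ≤ 10 * (a + 1) := by rw [mul_one]; exact_mod_cast (by lia : j ≤ 10 * (a + 1))
  have hfour : (102400 : ℝ) * (a + 1) ^ 2 ≤ 4 ^ a := by
    exact_mod_cast add_one_sq_le_four_pow (by lia : 13 ≤ a)
  calc 4 * (((2 ^ (a + 1) * 2 ^ (a + 1) : ℕ) : ℝ)) ^ 4 * (j * Real.log 2) ^ 2
      ≤ 4 * (((2 ^ (a + 1) * 2 ^ (a + 1) : ℕ) : ℝ)) ^ 4 * (10 * (a + 1)) ^ 2 := by gcongr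
    _ = (102400 * ((a : ℝ) + 1) ^ 2) * (2 ^ a) ^ 8 := by push_cast; ring
    _ ≤ 4 ^ a * (2 ^ a) ^ 8 := by gcongr
    _ = 2 ^ (10 * a) := by
        rw [show (4 : ℝ) = 2 ^ 2 by norm_num, ← pow_mul, ← pow_mul, ← pow_add]
        congr 1
        ring
    _ ≤ 2 ^ j := pow_le_pow_right₀ one_le_two hja

/-- The sieve is used at level `r²` with `r ≈ P^(1/10)`, where `P = 2^j`. -/
lemma div_sieveSum_le {j h : ℕ} (hj : j ≠ 0) (hh : Even h) (h0 : h ≠ 0) :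
    (2 : ℝ) ^ j / sieveSum (PairExcluded h) (2 ^ (j / 10 + 1) * 2 ^ (j / 10 + 1)) ≤
      200 * sigmaInv h * ((2 : ℝ) ^ j / Real.log ((2 : ℝ) ^ j) ^ 2) := by
  set r := 2 ^ (j / 10 + 1)
  set J := sieveSum (PairExcluded h) (r * r)
  have hJ : 1 ≤ J := one_le_sieveSum (fun _ => excludedCount_pairExcluded_lt hh)
    (Nat.mul_pos (by positivity) (by positivity))
  have hlog2 : 0 < Real.log 2 := Real.log_pos one_lt_two
  have : (0 : ℝ) < j := by exact_mod_cast Nat.pos_of_ne_zero hj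
  have hlogr : j * Real.log 2 / 10 ≤ Real.log r := by
    have : (j : ℝ) ≤ 10 * ((j / 10 + 1 : ℕ) : ℝ) := by
      exact_mod_cast (by lia : j ≤ 10 * (j / 10 + 1))
    rw [Nat.cast_pow, Nat.cast_two, Real.log_pow]
    nlinarith
  have hsq : (j * Real.log 2 / 10) ^ 2 ≤ 2 * sigmaInv h * J :=
    le_trans (by gcongr) (log_sq_le_sieveSum hh h0 r)
  rw [div_le_iff₀ (by linarith), Real.log_pow]
  calc (2 : ℝ) ^ j = (100 * (j * Real.log 2 / 10) ^ 2) * (2 ^ j / (j * Real.log 2) ^ 2) := by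
        field_simp
        norm_num
    _ ≤ (100 * (2 * sigmaInv h * J)) * (2 ^ j / (j * Real.log 2) ^ 2) := by gcongr
    _ = _ := by ring

theorem card_prime_pairs_le {j : ℕ} (hj : 130 ≤ j) {h : ℕ} (h0 : h ≠ 0) :
    (#{p ∈ Ioc (2 ^ j) (2 * 2 ^ j) | p.Prime ∧ (p + h).Prime} : ℝ) ≤
      201 * sigmaInv h * ((2 : ℝ) ^ j / Real.log ((2 : ℝ) ^ j) ^ 2) := by
  set Y := (2 : ℝ) ^ j / Real.log ((2 : ℝ) ^ j) ^ 2
  have hY : 0 ≤ Y := by positivity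
  have hσ := one_le_sigmaInv h0
  rcases Nat.even_or_odd h with hh | hh
  · have hlevel : 2 ^ (j / 10 + 1) * 2 ^ (j / 10 + 1) ≤ 2 ^ j := by
      rw [← pow_add]
      exact Nat.pow_le_pow_right two_pos (by lia)
    calc (#{p ∈ Ioc (2 ^ j) (2 * 2 ^ j) | p.Prime ∧ (p + h).Prime} : ℝ)
        ≤ 200 * sigmaInv h * Y + Y := by
          refine (card_prime_pairs_le_sieve hh (Nat.mul_pos (by positivity) (by positivity))
            hlevel).trans (add_le_add ?_ (sieve_error_le hj))
          rw [Nat.cast_pow, Nat.cast_two]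
          exact div_sieveSum_le (by lia) hh h0
      _ ≤ 201 * sigmaInv h * Y := by nlinarith
  · rw [filter_prime_pairs_eq_empty_of_odd hh (Nat.le_self_pow (by lia) 2), card_empty,
      Nat.cast_zero]
    positivity

/-! ### Cosine kernels -/

/-- The cosine polynomial `∑ |m| ≤ H, u |m| cos (m x)`, with the two frequencies `±m` merged; it
arises when the square of a sum over primes is expanded. -/
noncomputable def cosKernel (u : ℕ → ℝ) (H : ℕ) (x : ℝ) : ℝ :=
  u 0 + 2 * ∑ m ∈ range H, u (m + 1) * Real.cos ((m + 1 : ℕ) * x)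

lemma cosKernel_succ (u : ℕ → ℝ) (H : ℕ) (x : ℝ) :
    cosKernel u (H + 1) x =
      cosKernel u H x + 2 * (u (H + 1) * Real.cos ((H + 1 : ℕ) * x)) := by
  simp only [cosKernel, sum_range_succ _ H]
  ring

/-- The second difference of `u` at `m`, `m + 1`, `m + 2`; a double summation by parts expresses
`cosKernel` through it. -/
def secondDiff (u : ℕ → ℝ) (m : ℕ) : ℝ := u m - 2 * u (m + 1) + u (m + 2)

lemma sin_mul_cosKernel (u : ℕ → ℝ) (H : ℕ) (x : ℝ) :
    Real.sin (x / 2) * cosKernel u H x =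
      ∑ m ∈ range (H + 1), (u m - u (m + 1)) * Real.sin ((m + 1 / 2) * x) +
        u (H + 1) * Real.sin ((H + 1 / 2) * x) := by
  induction H with
  | zero =>
    simp only [cosKernel, range_zero, sum_empty, zero_add, range_one, sum_singleton, Nat.cast_zero]
    rw [show (1 / 2 : ℝ) * x = x / 2 by ring]
    ring
  | succ H ih =>
    have h_add : Real.sin (((H + 1 : ℕ) + 1 / 2) * x) =
        Real.sin ((H + 1 : ℕ) * x) * Real.cos (x / 2) +
          Real.cos ((H + 1 : ℕ) * x) * Real.sin (x / 2) := by
      rw [← Real.sin_add]; congr 1; ring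
    have h_sub : Real.sin ((H + 1 / 2) * x) =
        Real.sin ((H + 1 : ℕ) * x) * Real.cos (x / 2) -
          Real.cos ((H + 1 : ℕ) * x) * Real.sin (x / 2) := by
      rw [← Real.sin_sub]; congr 1; push_cast; ring
    rw [cosKernel_succ, mul_add, ih, sum_range_succ _ (H + 1), h_add, h_sub]
    ring

lemma sin_sq_mul_cosKernel (u : ℕ → ℝ) (H : ℕ) (x : ℝ) :
    2 * Real.sin (x / 2) ^ 2 * cosKernel u H x =
      (u 0 - u 1) - ∑ m ∈ range H, secondDiff u m * Real.cos ((m + 1 : ℕ) * x) +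
        (u (H + 1) * Real.cos (H * x) - u H * Real.cos ((H + 1 : ℕ) * x)) := by
  have hs : 2 * Real.sin (x / 2) ^ 2 = 1 - Real.cos x := by
    have hcos := Real.cos_two_mul (x / 2)
    rw [mul_div_cancel₀ x two_ne_zero, Real.cos_sq'] at hcos
    linarith
  rw [hs]
  induction H with
  | zero => simp [cosKernel]; ring
  | succ H ih =>
    have h_add : Real.cos ((H + 1 + 1 : ℕ) * x) =
        Real.cos ((H + 1 : ℕ) * x) * Real.cos x - Real.sin ((H + 1 : ℕ) * x) * Real.sin x := by
      rw [← Real.cos_add]; congr 1; push_cast; ring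
    have h_sub : Real.cos (H * x) =
        Real.cos ((H + 1 : ℕ) * x) * Real.cos x + Real.sin ((H + 1 : ℕ) * x) * Real.sin x := by
      rw [← Real.cos_sub]; congr 1; push_cast; ring
    rw [cosKernel_succ, mul_add, ih, sum_range_succ _ H, secondDiff, h_add, h_sub]
    ring

lemma abs_cosKernel_mul_sin_le {u : ℕ → ℝ} (hu : Antitone u) {H : ℕ} (hH : u (H + 1) = 0)
    (x : ℝ) : |cosKernel u H x| * |Real.sin (x / 2)| ≤ u 0 := by
  rw [← abs_mul, mul_comm, sin_mul_cosKernel, hH, zero_mul, add_zero]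
  calc |∑ m ∈ range (H + 1), (u m - u (m + 1)) * Real.sin ((m + 1 / 2) * x)|
      ≤ ∑ m ∈ range (H + 1), |(u m - u (m + 1)) * Real.sin ((m + 1 / 2) * x)| :=
        abs_sum_le_sum_abs _ _
    _ ≤ ∑ m ∈ range (H + 1), (u m - u (m + 1)) := by
        refine sum_le_sum fun m _ => ?_
        have h0 : 0 ≤ u m - u (m + 1) := sub_nonneg.2 (hu (Nat.le_succ m))
        rw [abs_mul, abs_of_nonneg h0]
        exact mul_le_of_le_one_right h0 (Real.abs_sin_le_one _)
    _ = u 0 := by rw [sum_range_sub', hH, sub_zero]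

lemma abs_cosKernel_mul_sin_sq_le {u : ℕ → ℝ} {H : ℕ} (hH : u H = 0) (hH' : u (H + 1) = 0)
    (x : ℝ) : 2 * (|cosKernel u H x| * Real.sin (x / 2) ^ 2) ≤
      |u 0 - u 1| + ∑ m ∈ range H, |secondDiff u m| := by
  have h := sin_sq_mul_cosKernel u H x
  rw [hH, hH', zero_mul, zero_mul, sub_zero, add_zero] at h
  have habs : 2 * (|cosKernel u H x| * Real.sin (x / 2) ^ 2) =
      |2 * Real.sin (x / 2) ^ 2 * cosKernel u H x| := by
    rw [abs_mul, abs_of_nonneg (by positivity : 0 ≤ 2 * Real.sin (x / 2) ^ 2)]; ring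
  rw [habs, h]
  refine (abs_sub _ _).trans (add_le_add le_rfl ((abs_sum_le_sum_abs _ _).trans ?_))
  refine sum_le_sum fun m _ => ?_
  rw [abs_mul]
  exact mul_le_of_le_one_right (abs_nonneg _) (Real.abs_cos_le_one _)

lemma abs_cosKernel_le {u : ℕ → ℝ} {M : ℝ} (hu : ∀ m, |u m| ≤ M) (H : ℕ) (x : ℝ) :
    |cosKernel u H x| ≤ (1 + 2 * H) * M := by
  have hsum : |∑ m ∈ range H, u (m + 1) * Real.cos ((m + 1 : ℕ) * x)| ≤ H * M := by
    refine (abs_sum_le_sum_abs _ _).trans ((sum_le_card_nsmul _ _ M fun m _ => ?_).trans_eq ?_)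
    · rw [abs_mul]
      exact (mul_le_of_le_one_right (abs_nonneg _) (Real.abs_cos_le_one _)).trans (hu _)
    · rw [card_range, nsmul_eq_mul]
  calc |cosKernel u H x|
      ≤ |u 0| + |2 * ∑ m ∈ range H, u (m + 1) * Real.cos ((m + 1 : ℕ) * x)| := abs_add_le _ _
    _ ≤ M + 2 * (H * M) := by
        rw [abs_mul, abs_two]
        gcongr
        exact hu 0
    _ = (1 + 2 * H) * M := by ring

/-! ### Ramps and their second differences -/

/-- The piecewise linear function equal to `1` up to `X - w` and to `0` from `X` on; it smooths the
cut-off `m * p ≤ N`. -/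
noncomputable def ramp (X w x : ℝ) : ℝ := max 0 (min 1 ((X - x) / w))

lemma ramp_nonneg (X w x : ℝ) : 0 ≤ ramp X w x := le_max_left _ _

lemma ramp_le_one (X w x : ℝ) : ramp X w x ≤ 1 := max_le zero_le_one (min_le_left _ _)

lemma ramp_antitone (X : ℝ) {w : ℝ} (hw : 0 < w) : Antitone (ramp X w) := by
  intro x y hxy
  unfold ramp
  gcongr

lemma ramp_eq_zero {X w x : ℝ} (hw : 0 < w) (hx : X ≤ x) : ramp X w x = 0 := by
  unfold ramp
  refine max_eq_left ((min_le_right _ _).trans ?_)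
  exact div_nonpos_of_nonpos_of_nonneg (by linarith) hw.le

lemma ramp_eq_one {X w x : ℝ} (hw : 0 < w) (hx : x ≤ X - w) : ramp X w x = 1 := by
  unfold ramp
  have : 1 ≤ (X - x) / w := by rw [le_div_iff₀ hw]; linarith
  rw [min_eq_left this]
  norm_num

lemma ramp_eq_sub (X : ℝ) {w : ℝ} (hw : 0 < w) (x : ℝ) :
    ramp X w x = (max (X - x) 0 - max (X - w - x) 0) / w := by
  rcases le_total x (X - w) with h | h
  · rw [ramp_eq_one hw h, max_eq_left (by linarith), max_eq_left (by linarith)]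
    field_simp; ring
  rcases le_total X x with h2 | h2
  · rw [ramp_eq_zero hw h2, max_eq_right (by linarith), max_eq_right (by linarith)]
    simp
  · rw [max_eq_left (by linarith : 0 ≤ X - x), max_eq_right (by linarith), sub_zero]
    unfold ramp
    rw [min_eq_right (by rw [div_le_one hw]; linarith),
      max_eq_right (div_nonneg (by linarith) hw.le)]

lemma ramp_sub_le (X : ℝ) {w : ℝ} (hw : 0 < w) {x y : ℝ} (hxy : x ≤ y) :
    ramp X w x - ramp X w y ≤ (y - x) / w := by
  rw [ramp_eq_sub X hw, ramp_eq_sub X hw, ← sub_div]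
  refine div_le_div_of_nonneg_right ?_ hw.le
  have h1 : max (X - x) 0 ≤ max (X - y) 0 + (y - x) := by
    refine max_le ?_ ?_
    · linarith [le_max_left (X - y) 0]
    · linarith [le_max_right (X - y) 0]
  have h2 : max (X - w - y) 0 ≤ max (X - w - x) 0 := by gcongr
  linarith

lemma abs_ramp_mul_sub_le (X : ℝ) {w s : ℝ} (hw : 0 < w) (hs : 0 ≤ s) (m : ℕ) :
    |ramp X w (m * s) - ramp X w ((m + 1 : ℕ) * s)| ≤ s / w := by
  have hle : (m : ℝ) * s ≤ (m + 1 : ℕ) * s := by gcongr; lia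
  rw [abs_of_nonneg (sub_nonneg.2 (ramp_antitone X hw hle))]
  refine (ramp_sub_le X hw hle).trans_eq ?_
  push_cast
  ring

lemma ramp_mul_antitone (X : ℝ) {w s : ℝ} (hw : 0 < w) (hs : 0 ≤ s) :
    Antitone fun m : ℕ => ramp X w (m * s) := fun m n hmn =>
  ramp_antitone X hw (by gcongr)

lemma ramp_mul_mem_Icc (X w s : ℝ) (m : ℕ) : ramp X w (m * s) ∈ Set.Icc (0 : ℝ) 1 :=
  ⟨ramp_nonneg _ _ _, ramp_le_one _ _ _⟩

lemma sum_abs_secondDiff_of_nonneg {u : ℕ → ℝ} (hu : ∀ m, 0 ≤ secondDiff u m) (H : ℕ) :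
    ∑ m ∈ range H, |secondDiff u m| = (u 0 - u 1) - (u H - u (H + 1)) := by
  rw [← sum_range_sub' (fun m => u m - u (m + 1))]
  refine sum_congr rfl fun m _ => ?_
  rw [abs_of_nonneg (hu m), secondDiff]
  ring

lemma sum_abs_secondDiff_max_sub_mul_le (X : ℝ) {s : ℝ} (hs : 0 ≤ s) (H : ℕ) :
    ∑ m ∈ range H, |secondDiff (fun k => max (X - k * s) 0) m| ≤ s := by
  have hconvex : ∀ m, 0 ≤ secondDiff (fun k => max (X - k * s) 0) m := by
    intro m
    have hmid : max (X - (m + 1) * s) 0 ≤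
        (max (X - m * s) 0 + max (X - (m + 2) * s) 0) / 2 := by
      refine max_le ?_ (by positivity)
      linarith [le_max_left (X - m * s) 0, le_max_left (X - (m + 2) * s) 0]
    simp only [secondDiff]
    push_cast
    linarith
  have hlast : max (X - (H + 1 : ℕ) * s) 0 ≤ max (X - H * s) 0 := by
    gcongr
    lia
  have hfirst : max (X - (0 : ℕ) * s) 0 ≤ max (X - (1 : ℕ) * s) 0 + s := by
    refine max_le ?_ (by positivity)
    push_cast
    linarith [le_max_left (X - 1 * s) 0]
  rw [sum_abs_secondDiff_of_nonneg hconvex]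
  linarith

lemma sum_abs_secondDiff_ramp_le (X : ℝ) {w s : ℝ} (hw : 0 < w) (hs : 0 ≤ s) (H : ℕ) :
    ∑ m ∈ range H, |secondDiff (fun k => ramp X w (k * s)) m| ≤ 2 * s / w := by
  rw [le_div_iff₀ hw, sum_mul, two_mul]
  refine le_trans ?_ (add_le_add (sum_abs_secondDiff_max_sub_mul_le X hs H)
    (sum_abs_secondDiff_max_sub_mul_le (X - w) hs H))
  rw [← sum_add_distrib]
  refine sum_le_sum fun m _ => ?_
  refine le_trans (le_of_eq ?_) (abs_sub _ _)
  rw [← abs_of_pos hw, ← abs_mul, abs_of_pos hw]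
  congr 1
  simp only [secondDiff, ramp_eq_sub X hw]
  field_simp
  ring

lemma sum_abs_secondDiff_mul_le {a b : ℕ → ℝ} (ha : ∀ m, |a m| ≤ 1)
    (hb : ∀ m, b m ∈ Set.Icc (0 : ℝ) 1) (hb' : Antitone b) {s : ℝ}
    (hs : ∀ m, |a m - a (m + 1)| ≤ s) (H : ℕ) :
    ∑ m ∈ range H, |secondDiff (fun k => a k * b k) m| ≤
      ∑ m ∈ range H, |secondDiff a m| + ∑ m ∈ range H, |secondDiff b m| + 2 * s := by
  have hs0 : 0 ≤ s := (abs_nonneg _).trans (hs 0)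
  have hdrop : ∀ m, 0 ≤ b m - b (m + 1) := fun m => sub_nonneg.2 (hb' (Nat.le_succ m))
  have htel : ∀ k, ∑ m ∈ range H, s * (b (m + k) - b (m + 1 + k)) ≤ s := by
    intro k
    rw [← mul_sum, sum_range_sub' (fun m => b (m + k))]
    exact mul_le_of_le_one_right hs0 (by linarith [(hb (0 + k)).2, (hb (H + k)).1])
  rw [two_mul]
  refine le_trans ?_ (add_le_add le_rfl (add_le_add (htel 0) (htel 1)))
  rw [← sum_add_distrib, ← sum_add_distrib, ← sum_add_distrib]
  refine sum_le_sum fun m _ => ?_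
  have leibniz : secondDiff (fun k => a k * b k) m =
      secondDiff a m * b (m + 1) + a (m + 1) * secondDiff b m +
      ((a m - a (m + 1)) * (b m - b (m + 1)) +
        (a (m + 1) - a (m + 1 + 1)) * (b (m + 1) - b (m + 1 + 1))) := by
    simp only [secondDiff]
    ring
  rw [leibniz]
  refine (abs_add_le _ _).trans (add_le_add ((abs_add_le _ _).trans (add_le_add ?_ ?_))
    ((abs_add_le _ _).trans (add_le_add ?_ ?_)))
  · rw [abs_mul, abs_of_nonneg (hb _).1]
    exact mul_le_of_le_one_right (abs_nonneg _) (hb _).2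
  · rw [abs_mul]
    exact mul_le_of_le_one_left (abs_nonneg _) (ha _)
  · rw [abs_mul, abs_of_nonneg (hdrop m)]
    exact mul_le_mul_of_nonneg_right (hs m) (hdrop m)
  · rw [abs_mul, abs_of_nonneg (hdrop (m + 1))]
    exact mul_le_mul_of_nonneg_right (hs (m + 1)) (hdrop (m + 1))

/-- The weight of frequency `m` for a pair of slopes `s`, `t`: a product of two ramps. -/
noncomputable def pairWeight (X w s t : ℝ) (m : ℕ) : ℝ := ramp X w (m * s) * ramp X w (m * t)

lemma pairWeight_mem_Icc (X w s t : ℝ) (m : ℕ) : pairWeight X w s t m ∈ Set.Icc (0 : ℝ) 1 :=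
  ⟨mul_nonneg (ramp_nonneg _ _ _) (ramp_nonneg _ _ _),
    mul_le_one₀ (ramp_le_one _ _ _) (ramp_nonneg _ _ _) (ramp_le_one _ _ _)⟩

section PairWeight

variable {X w s t : ℝ}

lemma pairWeight_antitone (hw : 0 < w) (hs : 0 ≤ s) (ht : 0 ≤ t) :
    Antitone (pairWeight X w s t) := fun _ _ hmn =>
  mul_le_mul (ramp_mul_antitone X hw hs hmn) (ramp_mul_antitone X hw ht hmn) (ramp_nonneg _ _ _)
    (ramp_nonneg _ _ _)

lemma pairWeight_eq_zero (hw : 0 < w) {m : ℕ} (hm : X ≤ m * s) : pairWeight X w s t m = 0 := by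
  rw [pairWeight, ramp_eq_zero hw hm, zero_mul]

lemma abs_pairWeight_zero_sub_one_le (hw : 0 < w) (hs : 0 ≤ s) (ht : 0 ≤ t) :
    |pairWeight X w s t 0 - pairWeight X w s t 1| ≤ s / w + t / w := by
  have leibniz : pairWeight X w s t 0 - pairWeight X w s t 1 =
      (ramp X w ((0 : ℕ) * s) - ramp X w ((0 + 1 : ℕ) * s)) * ramp X w ((0 : ℕ) * t) +
      ramp X w ((1 : ℕ) * s) * (ramp X w ((0 : ℕ) * t) - ramp X w ((0 + 1 : ℕ) * t)) := by
    simp only [pairWeight]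
    ring
  rw [leibniz]
  refine (abs_add_le _ _).trans (add_le_add ?_ ?_)
  · rw [abs_mul, abs_of_nonneg (ramp_nonneg _ _ _)]
    exact (mul_le_of_le_one_right (abs_nonneg _) (ramp_le_one _ _ _)).trans
      (abs_ramp_mul_sub_le X hw hs 0)
  · rw [abs_mul, abs_of_nonneg (ramp_nonneg _ _ _)]
    exact (mul_le_of_le_one_left (abs_nonneg _) (ramp_le_one _ _ _)).trans
      (abs_ramp_mul_sub_le X hw ht 0)

lemma sum_abs_secondDiff_pairWeight_le (hw : 0 < w) (hs : 0 ≤ s) (ht : 0 ≤ t) (H : ℕ) :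
    ∑ m ∈ range H, |secondDiff (pairWeight X w s t) m| ≤
      2 * s / w + 2 * t / w + 2 * (s / w) :=
  (sum_abs_secondDiff_mul_le
    (fun m => (abs_of_nonneg (ramp_nonneg _ _ _)).trans_le (ramp_le_one X w (m * s)))
    (ramp_mul_mem_Icc X w t) (ramp_mul_antitone X hw ht) (abs_ramp_mul_sub_le X hw hs) H).trans
    (by gcongr <;> exact sum_abs_secondDiff_ramp_le X hw ‹_› H)

lemma abs_cosKernel_pairWeight_le (H : ℕ) (x : ℝ) :
    |cosKernel (pairWeight X w s t) H x| ≤ 1 + 2 * H := by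
  have hbound : ∀ m, |pairWeight X w s t m| ≤ 1 := fun m =>
    (abs_of_nonneg (pairWeight_mem_Icc X w s t m).1).trans_le (pairWeight_mem_Icc X w s t m).2
  exact (abs_cosKernel_le hbound H x).trans_eq (mul_one _)

lemma abs_cosKernel_pairWeight_mul_sin_le (hw : 0 < w) (hs : 0 ≤ s) (ht : 0 ≤ t) {H : ℕ}
    (hH : X ≤ H * s) (x : ℝ) :
    |cosKernel (pairWeight X w s t) H x| * |Real.sin (x / 2)| ≤ 1 := by
  have hH' : X ≤ (H + 1 : ℕ) * s := hH.trans (by gcongr; lia)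
  exact (abs_cosKernel_mul_sin_le (pairWeight_antitone hw hs ht) (pairWeight_eq_zero hw hH')
    x).trans (pairWeight_mem_Icc X w s t 0).2

lemma abs_cosKernel_pairWeight_mul_sin_sq_le (hw : 0 < w) (hs : 0 ≤ s) (ht : 0 ≤ t) {H : ℕ}
    (hH : X ≤ H * s) (x : ℝ) :
    |cosKernel (pairWeight X w s t) H x| * Real.sin (x / 2) ^ 2 ≤ (5 * s + 3 * t) / (2 * w) := by
  have hH' : X ≤ (H + 1 : ℕ) * s := hH.trans (by gcongr; lia)
  have hkernel := abs_cosKernel_mul_sin_sq_le (pairWeight_eq_zero (t := t) hw hH)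
    (pairWeight_eq_zero hw hH') x
  have hfirst := abs_pairWeight_zero_sub_one_le (X := X) hw hs ht
  have hsecond := sum_abs_secondDiff_pairWeight_le (X := X) hw hs ht H
  calc |cosKernel (pairWeight X w s t) H x| * Real.sin (x / 2) ^ 2
      ≤ (s / w + t / w + (2 * s / w + 2 * t / w + 2 * (s / w))) / 2 := by linarith
    _ = (5 * s + 3 * t) / (2 * w) := by
        field_simp
        ring

end PairWeight

/-! ### Expansion of the square of a bilinear form -/

lemma e_add (α β : ℝ) : e (α + β) = e α * e β := by
  unfold e
  rw [← Complex.exp_add]; congr 1; push_cast; ring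

lemma conj_e (α : ℝ) : (starRingEnd ℂ) (e α) = e (-α) := by
  unfold e
  rw [← Complex.exp_conj]
  congr 1
  simp only [map_mul, Complex.conj_ofReal, Complex.conj_I, map_ofNat]
  push_cast; ring

lemma norm_e (α : ℝ) : ‖e α‖ = 1 := by
  unfold e
  rw [show 2 * (Real.pi : ℂ) * Complex.I * α = ((2 * Real.pi * α : ℝ) : ℂ) * Complex.I by
    push_cast; ring]
  exact Complex.norm_exp_ofReal_mul_I _

lemma e_zero : e 0 = 1 := by simp [e]

lemma e_add_e_neg (α : ℝ) : e α + e (-α) = (2 * Real.cos (2 * Real.pi * α) : ℝ) := by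
  unfold e
  push_cast
  rw [Complex.two_cos]
  congr 1 <;> congr 1 <;> ring

lemma norm_sq_sum_e (Ps : Finset ℕ) (c : ℕ → ℂ) (w : ℕ → ℝ) (t : ℝ) :
    ((‖∑ p ∈ Ps, c p * w p * e (t * p)‖ ^ 2 : ℝ) : ℂ) =
      ∑ p ∈ Ps, ∑ p' ∈ Ps, c p * (starRingEnd ℂ) (c p') *
        ((w p * w p' : ℝ) * e (t * ((p : ℝ) - p'))) := by
  rw [Complex.ofReal_pow, ← Complex.mul_conj', map_sum, sum_mul_sum]
  refine sum_congr rfl fun p _ => sum_congr rfl fun p' _ => ?_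
  rw [map_mul, map_mul, Complex.conj_ofReal, conj_e, mul_sub, sub_eq_add_neg, e_add]
  push_cast; ring

lemma cosKernel_eq_sum_e (u : ℕ → ℝ) (H : ℕ) (α : ℝ) :
    ((cosKernel u H (2 * Real.pi * α) : ℝ) : ℂ) =
      u 0 * e ((0 : ℕ) * α) +
        ∑ m ∈ Icc 1 H, ((u m : ℂ) * e (m * α) + u m * e (-(m : ℝ) * α)) := by
  have hshift : ∑ m ∈ Icc 1 H, ((u m : ℂ) * e (m * α) + u m * e (-(m : ℝ) * α)) =
      ∑ m ∈ range H, ((u (m + 1) : ℂ) * e ((m + 1 : ℕ) * α) +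
        u (m + 1) * e (-((m + 1 : ℕ) : ℝ) * α)) := by
    rw [range_eq_Ico,
      sum_Ico_add' (fun m : ℕ => (u m : ℂ) * e (m * α) + u m * e (-(m : ℝ) * α)) 0 H 1]
    rfl
  rw [hshift, cosKernel]
  push_cast
  rw [zero_mul, e_zero, mul_one, mul_sum]
  congr 1
  refine sum_congr rfl fun m _ => ?_
  rw [← mul_add, neg_mul, e_add_e_neg]
  push_cast
  rw [show (2 * (Real.pi : ℂ) * ((m + 1) * α)) = ((m : ℂ) + 1) * (2 * Real.pi * α) by ring]
  ring

lemma sum_norm_sq_symm_eq_sum_cosKernel (Ps : Finset ℕ) (c : ℕ → ℂ) (w : ℕ → ℕ → ℝ) (H : ℕ)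
    (θ : ℝ) :
    ((‖∑ p ∈ Ps, c p * w 0 p * e ((0 : ℕ) * θ * p)‖ ^ 2 +
        ∑ m ∈ Icc 1 H, (‖∑ p ∈ Ps, c p * w m p * e (m * θ * p)‖ ^ 2 +
          ‖∑ p ∈ Ps, c p * w m p * e (-(m : ℝ) * θ * p)‖ ^ 2) : ℝ) : ℂ) =
      ∑ p ∈ Ps, ∑ p' ∈ Ps, c p * (starRingEnd ℂ) (c p') *
        (cosKernel (fun m => w m p * w m p') H (2 * Real.pi * (((p : ℝ) - p') * θ)) : ℝ) := by
  have sum_swap : ∀ F : ℕ → ℕ → ℕ → ℂ, ∑ m ∈ Icc 1 H, ∑ p ∈ Ps, ∑ p' ∈ Ps, F m p p' =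
      ∑ p ∈ Ps, ∑ p' ∈ Ps, ∑ m ∈ Icc 1 H, F m p p' := fun F => by
    rw [sum_comm]
    exact sum_congr rfl fun p _ => sum_comm
  simp only [cosKernel_eq_sum_e, Complex.ofReal_add, Complex.ofReal_sum, norm_sq_sum_e]
  simp only [mul_add, sum_add_distrib, mul_sum, sum_swap, mul_right_comm _ θ, ← mul_assoc _ _ θ]

lemma sum_norm_sq_le_cosKernel (Ps : Finset ℕ) (c : ℕ → ℂ) (w : ℕ → ℕ → ℝ) (H : ℕ) (θ : ℝ) :
    ∑ m ∈ Icc 1 H, ‖∑ p ∈ Ps, c p * w m p * e (m * θ * p)‖ ^ 2 ≤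
      ∑ p ∈ Ps, ∑ p' ∈ Ps, ‖c p‖ * ‖c p'‖ *
        |cosKernel (fun m => w m p * w m p') H (2 * Real.pi * (((p : ℝ) - p') * θ))| := by
  set A : ℝ → ℕ → ℝ := fun t m => ‖∑ p ∈ Ps, c p * w m p * e (t * p)‖ ^ 2
  have hA : ∀ t m, 0 ≤ A t m := fun t m => sq_nonneg _
  have hsymm : 0 ≤ ∑ m ∈ Icc 1 H, (A (m * θ) m + A (-(m : ℝ) * θ) m) :=
    sum_nonneg fun m _ => add_nonneg (hA _ _) (hA _ _)
  calc ∑ m ∈ Icc 1 H, A (m * θ) m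
      ≤ ∑ m ∈ Icc 1 H, (A (m * θ) m + A (-(m : ℝ) * θ) m) :=
        sum_le_sum fun m _ => le_add_of_nonneg_right (hA _ _)
    _ ≤ A ((0 : ℕ) * θ) 0 + ∑ m ∈ Icc 1 H, (A (m * θ) m + A (-(m : ℝ) * θ) m) :=
        le_add_of_nonneg_left (hA _ _)
    _ = ‖∑ p ∈ Ps, ∑ p' ∈ Ps, c p * (starRingEnd ℂ) (c p') *
          (cosKernel (fun m => w m p * w m p') H (2 * Real.pi * (((p : ℝ) - p') * θ)) : ℝ)‖ := by
        rw [← sum_norm_sq_symm_eq_sum_cosKernel, Complex.norm_of_nonneg (add_nonneg (hA _ _) hsymm)]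
    _ ≤ _ := by
        refine (norm_sum_le _ _).trans (sum_le_sum fun p _ => (norm_sum_le _ _).trans
          (sum_le_sum fun p' _ => ?_))
        rw [norm_mul, norm_mul, RCLike.norm_conj, Complex.norm_real, Real.norm_eq_abs]

/-! ### Sums of truncated reciprocals over residue classes -/

/-- The primitive `∫₀ᵗ min(1, y / u) du`, with which sums of `min(1, y / s)` are compared. -/
noncomputable def truncLog (y t : ℝ) : ℝ := if t ≤ y then t else y + y * Real.log (t / y)

lemma one_sub_div_le_log_div {u v : ℝ} (hu : 0 < u) (hv : 0 < v) :
    1 - u / v ≤ Real.log (v / u) := by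
  simpa only [inv_div] using Real.one_sub_inv_le_log_of_pos (div_pos hv hu)

lemma min_one_div_le_truncLog_sub {y s : ℝ} (hy : 0 < y) (hs : 1 ≤ s) :
    min 1 (y / s) ≤ truncLog y s - truncLog y (s - 1) := by
  have hs0 : 0 < s := by linarith
  rw [truncLog, truncLog]
  split_ifs with h h' h'
  · exact (min_le_left _ _).trans (by linarith)
  · exact absurd (by linarith) h'
  · rw [not_le] at h
    have hlog := mul_le_mul_of_nonneg_left (one_sub_div_le_log_div hy hs0) hy.le
    have hquad : y / s ≤ y + y * (1 - y / s) - (s - 1) := by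
      have hexpand : (y + y * (1 - y / s) - (s - 1)) * s = 2 * y * s - y ^ 2 - s * (s - 1) := by
        field_simp
        ring
      rw [div_le_iff₀ hs0, hexpand]
      nlinarith
    exact (min_le_right _ _).trans (by linarith)
  · rw [not_le] at h'
    have hs1 : 0 < s - 1 := by linarith
    have hlog := mul_le_mul_of_nonneg_left (one_sub_div_le_log_div hs1 hs0) hy.le
    have hsub : Real.log (s / (s - 1)) = Real.log (s / y) - Real.log ((s - 1) / y) := by
      rw [Real.log_div hs0.ne' hy.ne', Real.log_div hs1.ne' hy.ne',
        Real.log_div hs0.ne' hs1.ne']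
      ring
    rw [hsub] at hlog
    calc min 1 (y / s) ≤ y / s := min_le_right _ _
      _ = y * (1 - (s - 1) / s) := by field_simp; ring
      _ ≤ _ := by linarith

lemma sum_min_one_div_le_truncLog {y : ℝ} (hy : 0 < y) (n : ℕ) :
    ∑ s ∈ Icc 1 n, min 1 (y / (s : ℝ)) ≤ truncLog y n := by
  induction n with
  | zero => simp [truncLog, hy.le]
  | succ n ih =>
    have hstep := min_one_div_le_truncLog_sub hy (s := (n + 1 : ℕ)) (by simp)
    rw [Nat.cast_succ, add_sub_cancel_right] at hstep
    rw [sum_Icc_succ_top (by lia), Nat.cast_succ]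
    linarith

lemma truncLog_le {y Y t : ℝ} (hy : 0 < y) (hyY : y ≤ Y) (ht : t ≤ Y) :
    truncLog y t ≤ y * (1 + Real.log (Y / y)) := by
  have hlog : 0 ≤ Real.log (Y / y) := Real.log_nonneg ((one_le_div hy).2 hyY)
  rw [truncLog]
  split_ifs with h
  · nlinarith
  · have : 0 < t := by linarith
    rw [mul_one_add]
    gcongr

lemma sum_min_div_le {A b Y : ℝ} (hA : 0 < A) (hb : 0 < b) (hY : b / A ≤ Y) {n : ℕ}
    (hn : (n : ℝ) ≤ Y) :
    ∑ s ∈ Icc 1 n, min A (b / (s : ℝ)) ≤ b * (1 + Real.log (Y * A / b)) := by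
  have hy : 0 < b / A := div_pos hb hA
  calc ∑ s ∈ Icc 1 n, min A (b / (s : ℝ)) = A * ∑ s ∈ Icc 1 n, min 1 (b / A / (s : ℝ)) := by
        rw [mul_sum]
        refine sum_congr rfl fun s _ => ?_
        rw [mul_min_of_nonneg _ _ hA.le, mul_one]
        congr 1
        field_simp
    _ ≤ A * (b / A * (1 + Real.log (Y / (b / A)))) := by
        gcongr
        exact (sum_min_one_div_le_truncLog hy n).trans (truncLog_le hy hY hn)
    _ = b * (1 + Real.log (Y * A / b)) := by
        rw [div_div_eq_mul_div]
        field_simp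

lemma sum_min_div_sq_le {A b C Y : ℝ} (hA : 0 < A) (hb : 0 < b) (hC : 0 ≤ C) (hY : b / A ≤ Y)
    (n : ℕ) :
    ∑ s ∈ Ico 1 n, min A (min (b / (s : ℝ)) (C / (s : ℝ) ^ 2)) ≤
      b * (1 + Real.log (Y * A / b)) + 2 * C / Y := by
  have hY0 : 0 < Y := (div_pos hb hA).trans_le hY
  set k := ⌊Y⌋₊
  have hsub : Ico 1 n ⊆ Icc 1 k ∪ Ioo k n := by
    intro s hs
    simp only [mem_Ico, mem_union, mem_Icc, mem_Ioo] at hs ⊢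
    lia
  have hdisj : Disjoint (Icc 1 k) (Ioo k n) :=
    disjoint_left.2 fun s hs hs' => (mem_Icc.1 hs).2.not_gt (mem_Ioo.1 hs').1
  have hhead : ∑ s ∈ Icc 1 k, min A (min (b / (s : ℝ)) (C / (s : ℝ) ^ 2)) ≤
      b * (1 + Real.log (Y * A / b)) :=
    (sum_le_sum fun s _ => min_le_min le_rfl (min_le_left _ _)).trans
      (sum_min_div_le hA hb hY (Nat.floor_le hY0.le))
  have htail : ∑ s ∈ Ioo k n, min A (min (b / (s : ℝ)) (C / (s : ℝ) ^ 2)) ≤ 2 * C / Y := by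
    calc ∑ s ∈ Ioo k n, min A (min (b / (s : ℝ)) (C / (s : ℝ) ^ 2))
        ≤ ∑ s ∈ Ioo k n, C * ((s : ℝ) ^ 2)⁻¹ :=
          sum_le_sum fun s _ => (min_le_right _ _).trans (min_le_right _ _)
      _ ≤ C * (2 / (k + 1)) := by
          rw [← mul_sum]
          exact mul_le_mul_of_nonneg_left (sum_Ioo_inv_sq_le k n) hC
      _ ≤ C * (2 / Y) := by
          gcongr
          exact (Nat.lt_floor_add_one Y).le
      _ = 2 * C / Y := by ring
  refine (sum_le_sum_of_subset_of_nonneg hsub fun s _ _ =>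
    le_min hA.le (le_min (by positivity) (by positivity))).trans ?_
  rw [sum_union hdisj]
  exact add_le_add hhead htail

/-- The bound available for a kernel of height `A` and curvature `c` at distance `s / n` from the
integers. -/
noncomputable def kernelBound (A c : ℝ) (n s : ℕ) : ℝ :=
  min A (min ((n : ℝ) / 2 / (s : ℝ)) (c * (n : ℝ) ^ 2 / 4 / (s : ℝ) ^ 2))

/-- The logarithm lost when `kernelBound A c n` is averaged over all residues modulo `n`. The two
competing terms come from using, respectively not using, the quadratic decay of the kernel. -/
noncomputable def kernelLog (A c : ℝ) : ℝ :=
  min (2 + Real.log (2 * c * A)) (1 + Real.log (2 * A))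

lemma kernelBound_nonneg {A c : ℝ} (hA : 0 ≤ A) (hc : 0 ≤ c) (n s : ℕ) :
    0 ≤ kernelBound A c n s :=
  le_min hA (le_min (by positivity) (by positivity))

lemma kernelLog_nonneg {A c : ℝ} (hA : 1 ≤ A) (hcA : 1 ≤ 2 * c * A) : 0 ≤ kernelLog A c :=
  le_min (add_nonneg zero_le_two (Real.log_nonneg hcA))
    (add_nonneg zero_le_one (Real.log_nonneg (by linarith)))

lemma sum_kernelBound_le {A c : ℝ} (hA : 1 ≤ A) (hc : 0 < c) (hcA : 1 ≤ 2 * c * A) (n : ℕ) :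
    ∑ s ∈ Ico 1 n, kernelBound A c n s ≤ n * kernelLog A c / 2 := by
  rcases n.eq_zero_or_pos with rfl | hn
  · simp
  have hn' : (0 : ℝ) < n := by exact_mod_cast hn
  have hA0 : 0 < A := by linarith
  have hquad : ∑ s ∈ Ico 1 n, kernelBound A c n s ≤ n / 2 * (2 + Real.log (2 * c * A)) := by
    have h := sum_min_div_sq_le (b := (n : ℝ) / 2) (C := c * (n : ℝ) ^ 2 / 4) (Y := c * n) hA0
      (by positivity) (by positivity) (by rw [div_le_iff₀ hA0]; nlinarith) n
    refine h.trans_eq ?_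
    rw [show c * n * A / (n / 2) = 2 * c * A by field_simp,
      show 2 * (c * (n : ℝ) ^ 2 / 4) / (c * n) = n / 2 by field_simp; norm_num]
    ring
  have hlin : ∑ s ∈ Ico 1 n, kernelBound A c n s ≤ n / 2 * (1 + Real.log (2 * A)) := by
    have h := sum_min_div_le (b := (n : ℝ) / 2) hA0 (by positivity)
      (by rw [div_le_iff₀ hA0]; nlinarith) (le_refl (n : ℝ))
    rw [show (n : ℝ) * A / (n / 2) = 2 * A by field_simp] at h
    calc ∑ s ∈ Ico 1 n, kernelBound A c n s
        ≤ ∑ s ∈ Ico 1 n, min A ((n : ℝ) / 2 / s) :=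
          sum_le_sum fun s _ => min_le_min le_rfl (min_le_left _ _)
      _ ≤ ∑ s ∈ Icc 1 n, min A ((n : ℝ) / 2 / s) :=
          sum_le_sum_of_subset_of_nonneg Ico_subset_Icc_self fun s _ _ => by positivity
      _ ≤ _ := h
  rw [kernelLog, mul_div_right_comm, mul_min_of_nonneg _ _ (by positivity)]
  exact le_min hquad hlin

/-- The bounds satisfied by the value `x` at the angle `α` of a Fejér-type kernel of height `A`,
where `c` controls its quadratic decay. -/
structure IsKernelBounded (A c α x : ℝ) : Prop where
  nonneg : 0 ≤ x
  le : x ≤ A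
  mul_abs_sin_le : x * |Real.sin α| ≤ 1
  mul_sin_sq_le : x * Real.sin α ^ 2 ≤ c

lemma two_mul_div_le_abs_sin {n r : ℕ} (hn : 0 < n) (hr : 2 * r ≤ n) :
    2 * (r : ℝ) / n ≤ |Real.sin (Real.pi * (r / n))| := by
  have hn' : (0 : ℝ) < n := by exact_mod_cast hn
  have hhalf : Real.pi * (r / n) ≤ Real.pi / 2 := by
    have hr' : (r : ℝ) / n ≤ 1 / 2 := by
      rw [div_le_div_iff₀ hn' two_pos, one_mul, mul_comm]
      exact_mod_cast hr
    rw [div_eq_mul_one_div Real.pi 2]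
    exact mul_le_mul_of_nonneg_left hr' Real.pi_pos.le
  calc 2 * (r : ℝ) / n = 2 / Real.pi * (Real.pi * (r / n)) := by field_simp
    _ ≤ Real.sin (Real.pi * (r / n)) := Real.mul_le_sin (by positivity) hhalf
    _ ≤ _ := le_abs_self _

lemma IsKernelBounded.le_kernelBound {A c α x : ℝ} (hx : IsKernelBounded A c α x) {n s : ℕ}
    (hn : 0 < n) (hs : 0 < s) (hα : 2 * (s : ℝ) / n ≤ |Real.sin α|) : x ≤ kernelBound A c n s := by
  have : (0 : ℝ) < s := by exact_mod_cast hs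
  have : (0 : ℝ) < n := by exact_mod_cast hn
  have := hx.nonneg
  refine le_min hx.le (le_min ?_ ?_)
  · rw [div_div, le_div_iff₀ (by positivity)]
    calc x * (2 * s) = x * (2 * (s : ℝ) / n) * n := by field_simp
      _ ≤ x * |Real.sin α| * n := by gcongr
      _ ≤ 1 * n := by gcongr; exact hx.mul_abs_sin_le
      _ = n := one_mul _
  · rw [div_div, le_div_iff₀ (by positivity)]
    calc x * (4 * (s : ℝ) ^ 2) = x * (2 * (s : ℝ) / n) ^ 2 * n ^ 2 := by field_simp; ring
      _ ≤ x * |Real.sin α| ^ 2 * n ^ 2 := by gcongr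
      _ ≤ c * n ^ 2 := by
          rw [sq_abs]
          gcongr
          exact hx.mul_sin_sq_le

lemma abs_sin_pi_mul_eq_of_intModEq {n : ℕ} (hn : n ≠ 0) {b r : ℤ} (h : b ≡ r [ZMOD n]) :
    |Real.sin (Real.pi * ((b : ℝ) / n))| = |Real.sin (Real.pi * ((r : ℝ) / n))| := by
  obtain ⟨k, hk⟩ := h.dvd
  have hshift : Real.pi * ((r : ℝ) / n) = Real.pi * ((b : ℝ) / n) + k * Real.pi := by
    rw [show r = b + n * k by linarith]
    push_cast
    field_simp
  rw [hshift, Real.sin_add_int_mul_pi, abs_mul, abs_neg_one_zpow, one_mul]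

/-- Sum of the kernel bounds at both distances of a nonzero residue to `0`. Taking the sum rather
than the bound at the nearer one makes the average over residues easy to compute. -/
noncomputable def residueBound (A c : ℝ) (n : ℕ) (x : ZMod n) : ℝ :=
  if x = 0 then 0 else kernelBound A c n x.val + kernelBound A c n (n - x.val)

lemma residueBound_nonneg {A c : ℝ} (hA : 0 ≤ A) (hc : 0 ≤ c) (n : ℕ) (x : ZMod n) :
    0 ≤ residueBound A c n x := by
  rw [residueBound]
  split_ifs
  · exact le_rfl
  · exact add_nonneg (kernelBound_nonneg hA hc _ _) (kernelBound_nonneg hA hc _ _)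

lemma IsKernelBounded.le_residueBound {A c x : ℝ} (hA : 0 ≤ A) (hc : 0 ≤ c) {n : ℕ} [NeZero n]
    {b : ℤ} (hx : IsKernelBounded A c (Real.pi * ((b : ℝ) / n)) x) (hb : (b : ZMod n) ≠ 0) :
    x ≤ residueBound A c n b := by
  have hn : 0 < n := NeZero.pos n
  set v := (b : ZMod n).val with hv
  have hvpos : 0 < v := Nat.pos_of_ne_zero fun h => hb ((ZMod.val_eq_zero _).1 h)
  have hvlt : v < n := ZMod.val_lt _
  have hmod : b ≡ (v : ℤ) [ZMOD n] := by
    rw [← ZMod.intCast_eq_intCast_iff, Int.cast_natCast, hv, ZMod.natCast_zmod_val]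
  have hsin := abs_sin_pi_mul_eq_of_intModEq hn.ne' hmod
  rw [Int.cast_natCast] at hsin
  rw [residueBound, if_neg hb, ← hv]
  rcases le_total (2 * v) n with h | h
  · refine le_add_of_le_of_nonneg ?_ (kernelBound_nonneg hA hc _ _)
    exact hx.le_kernelBound hn hvpos (hsin ▸ two_mul_div_le_abs_sin hn h)
  · refine le_add_of_nonneg_of_le (kernelBound_nonneg hA hc _ _) ?_
    have hreflect : Real.pi * (((n - v : ℕ) : ℝ) / n) = Real.pi - Real.pi * (v / n) := by
      rw [Nat.cast_sub hvlt.le]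
      field_simp
    have hsin_le := two_mul_div_le_abs_sin (r := n - v) hn (by lia)
    rw [hreflect, Real.sin_pi_sub, ← hsin] at hsin_le
    exact hx.le_kernelBound hn (by lia) hsin_le

lemma sum_range_natCast_zmod {M : Type*} [AddCommMonoid M] {n : ℕ} [NeZero n] (g : ZMod n → M) :
    ∑ k ∈ range n, g (k : ZMod n) = ∑ x, g x :=
  sum_nbij' (fun k => (k : ZMod n)) ZMod.val (fun _ _ => mem_univ _)
    (fun x _ => mem_range.2 (ZMod.val_lt x)) (fun _ hk => ZMod.val_cast_of_lt (mem_range.1 hk))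
    (fun x _ => ZMod.natCast_zmod_val x) fun _ _ => rfl

lemma sum_residueBound (A c : ℝ) (n : ℕ) [NeZero n] :
    ∑ x : ZMod n, residueBound A c n x = 2 * ∑ s ∈ Ico 1 n, kernelBound A c n s := by
  have hval : ∀ k ∈ Ico 1 n, residueBound A c n (k : ZMod n) =
      kernelBound A c n k + kernelBound A c n (n - k) := by
    intro k hk
    rw [mem_Ico] at hk
    have hv : (k : ZMod n).val = k := ZMod.val_cast_of_lt hk.2
    have hne : (k : ZMod n) ≠ 0 := fun h => by
      rw [h, ZMod.val_zero] at hv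
      lia
    rw [residueBound, if_neg hne, hv]
  have hreflect : ∑ k ∈ Ico 1 n, kernelBound A c n (n - k) =
      ∑ k ∈ Ico 1 n, kernelBound A c n k := by
    refine sum_nbij' (fun k => n - k) (fun k => n - k) ?_ ?_ ?_ ?_ fun _ _ => rfl <;>
      · intro k hk
        simp only [mem_Ico] at hk ⊢
        lia
  have hzero : residueBound A c n ((0 : ℕ) : ZMod n) = 0 := by simp [residueBound]
  rw [← sum_range_natCast_zmod, range_eq_Ico, sum_eq_sum_Ico_succ_bot (NeZero.pos n), hzero,
    zero_add, sum_congr rfl hval, sum_add_distrib, hreflect, two_mul]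

lemma sum_range_residueBound_mul_le {A c : ℝ} (hA : 1 ≤ A) (hc : 0 < c) (hcA : 1 ≤ 2 * c * A)
    {n : ℕ} [NeZero n] {a : ℤ} (ha : IsCoprime a n) :
    ∑ k ∈ range n, residueBound A c n ((k : ZMod n) * a) ≤ n * kernelLog A c := by
  obtain ⟨u, hu⟩ := (ZMod.coe_int_isUnit_iff_isCoprime a n).2 ha.symm
  calc ∑ k ∈ range n, residueBound A c n ((k : ZMod n) * a)
      = ∑ x : ZMod n, residueBound A c n (x * a) :=
        sum_range_natCast_zmod fun x : ZMod n => residueBound A c n (x * a)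
    _ = ∑ x, residueBound A c n x := by
        rw [← hu]
        exact Equiv.sum_comp (Units.mulRight u) (residueBound A c n)
    _ ≤ n * kernelLog A c := by
        rw [sum_residueBound]
        linarith [sum_kernelBound_le hA hc hcA n]

lemma sum_range_mul_period {n : ℕ} {g : ℕ → ℝ} (hg : Function.Periodic g n) (b : ℕ) :
    ∑ k ∈ range (b * n), g k = b * ∑ k ∈ range n, g k := by
  induction b with
  | zero => simp
  | succ b ih =>
    rw [Nat.succ_mul, sum_range_add, ih, sum_range_add_of_periodic hg]
    push_cast
    ring

lemma sum_Icc_le_of_periodic {n : ℕ} (hn : 0 < n) {g : ℕ → ℝ} (hg : Function.Periodic g n)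
    (hg0 : ∀ k, 0 ≤ g k) (X : ℕ) :
    ∑ k ∈ Icc 1 X, g k ≤ ((X : ℝ) / n + 1) * ∑ k ∈ range n, g k := by
  have hsub : Icc 1 X ⊆ range ((X / n + 1) * n) := by
    intro k hk
    rw [mem_range, add_one_mul]
    exact (mem_Icc.1 hk).2.trans_lt (Nat.lt_div_mul_add hn)
  calc ∑ k ∈ Icc 1 X, g k ≤ ∑ k ∈ range ((X / n + 1) * n), g k :=
        sum_le_sum_of_subset_of_nonneg hsub fun k _ _ => hg0 k
    _ = ((X / n : ℕ) + 1 : ℝ) * ∑ k ∈ range n, g k := by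
        rw [sum_range_mul_period hg, Nat.cast_succ]
    _ ≤ ((X : ℝ) / n + 1) * ∑ k ∈ range n, g k := by
        have : 0 ≤ ∑ k ∈ range n, g k := sum_nonneg fun k _ => hg0 k
        gcongr
        exact Nat.cast_div_le

lemma sum_le_of_isKernelBounded {A c : ℝ} (hA : 1 ≤ A) (hc : 0 < c) (hcA : 1 ≤ 2 * c * A) {n : ℕ}
    (hn : 0 < n) {a : ℤ} (ha : IsCoprime a n) {F : ℕ → ℝ} (X : ℕ)
    (hF : ∀ k ∈ Icc 1 X, IsKernelBounded A c (Real.pi * (((k * a : ℤ) : ℝ) / n)) (F k)) :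
    ∑ k ∈ Icc 1 X, F k ≤ A * ((X : ℝ) / n) + ((X : ℝ) / n + 1) * (n * kernelLog A c) := by
  have : NeZero n := ⟨hn.ne'⟩
  have hA0 : 0 ≤ A := by linarith
  set g : ℕ → ℝ := fun k => residueBound A c n ((k : ZMod n) * (a : ZMod n))
  have hg0 : ∀ k, 0 ≤ g k := fun k => residueBound_nonneg hA0 hc.le _ _
  have hunit : IsUnit (a : ZMod n) := (ZMod.coe_int_isUnit_iff_isCoprime a n).2 ha.symm
  have hpointwise : ∀ k ∈ Icc 1 X, F k ≤ (if n ∣ k then A else 0) + g k := by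
    intro k hk
    split_ifs with hd
    · exact (hF k hk).le.trans (le_add_of_nonneg_right (hg0 k))
    · have hka : (((k : ℤ) * a : ℤ) : ZMod n) ≠ 0 := by
        push_cast
        rwa [Ne, hunit.mul_left_eq_zero, ZMod.natCast_eq_zero_iff]
      have hbound := (hF k hk).le_residueBound hA0 hc.le hka
      push_cast at hbound
      rwa [zero_add]
  have hmult : ∑ k ∈ Icc 1 X, (if n ∣ k then A else 0) ≤ A * ((X : ℝ) / n) := by
    have hcard : #{k ∈ Icc 1 X | n ∣ k} = X / n := Nat.Ioc_filter_dvd_card_eq_div X n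
    rw [← sum_filter, sum_const, nsmul_eq_mul, hcard, mul_comm]
    exact mul_le_mul_of_nonneg_left Nat.cast_div_le hA0
  have hresidue : ∑ k ∈ Icc 1 X, g k ≤ ((X : ℝ) / n + 1) * (n * kernelLog A c) :=
    (sum_Icc_le_of_periodic hn (fun k => by simp [g]) hg0 X).trans
      (mul_le_mul_of_nonneg_left (sum_range_residueBound_mul_le hA hc hcA ha) (by positivity))
  calc ∑ k ∈ Icc 1 X, F k ≤ ∑ k ∈ Icc 1 X, ((if n ∣ k then A else 0) + g k) :=
        sum_le_sum hpointwise
    _ ≤ _ := sum_add_distrib.trans_le (add_le_add hmult hresidue)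

/-! ### Divisor sums of kernel values -/

lemma sum_filter_dvd_Icc {M : Type*} [AddCommMonoid M] (H : ℕ) {d : ℕ} (hd : 0 < d) (f : ℕ → M) :
    ∑ h ∈ Icc 1 H with d ∣ h, f h = ∑ k ∈ Icc 1 (H / d), f (k * d) := by
  refine sum_nbij' (· / d) (· * d) (fun h hh => ?_) (fun k hk => ?_)
    (fun h hh => Nat.div_mul_cancel (mem_filter.1 hh).2) (fun k _ => Nat.mul_div_cancel k hd)
    fun h hh => by rw [Nat.div_mul_cancel (mem_filter.1 hh).2]
  · rw [mem_filter, mem_Icc] at hh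
    exact mem_Icc.2
      ⟨Nat.div_pos (Nat.le_of_dvd hh.1.1 hh.2) hd, Nat.div_le_div_right hh.1.2⟩
  · rw [mem_Icc] at hk
    exact mem_filter.2 ⟨mem_Icc.2 ⟨Nat.mul_pos hk.1 hd, (Nat.le_div_iff_mul_le hd).1 hk.2⟩,
      Dvd.intro_left k rfl⟩

lemma sum_sum_divisors_mul {R : Type*} [NonUnitalNonAssocSemiring R] (H : ℕ) (w f : ℕ → R) :
    ∑ h ∈ Icc 1 H, (∑ d ∈ h.divisors, w d) * f h =
      ∑ d ∈ Icc 1 H, w d * ∑ k ∈ Icc 1 (H / d), f (k * d) := by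
  have hdivisors : ∀ h ∈ Icc 1 H, h.divisors = {d ∈ Icc 1 H | d ∣ h} := by
    refine fun h hh => Finset.ext fun d => ?_
    rw [mem_Icc] at hh
    rw [Nat.mem_divisors, mem_filter, mem_Icc]
    constructor
    · rintro ⟨hd, -⟩
      exact ⟨⟨Nat.pos_of_dvd_of_pos hd hh.1, (Nat.le_of_dvd hh.1 hd).trans hh.2⟩, hd⟩
    · rintro ⟨-, hd⟩
      exact ⟨hd, by lia⟩
  calc ∑ h ∈ Icc 1 H, (∑ d ∈ h.divisors, w d) * f h
      = ∑ h ∈ Icc 1 H, ∑ d ∈ Icc 1 H, if d ∣ h then w d * f h else 0 :=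
        sum_congr rfl fun h hh => by rw [hdivisors h hh, sum_mul, sum_filter]
    _ = ∑ d ∈ Icc 1 H, w d * ∑ k ∈ Icc 1 (H / d), f (k * d) := by
        rw [sum_comm]
        refine sum_congr rfl fun d hd => ?_
        rw [← sum_filter, ← mul_sum, sum_filter_dvd_Icc H (mem_Icc.1 hd).1]

lemma totient_mul_le (a b : ℕ) : (a * b).totient ≤ a * b.totient := by
  induction a using induction_on_primes with
  | zero => simp
  | one => simp
  | prime_mul p m hp ih =>
    rw [mul_assoc, mul_assoc]
    refine le_trans ?_ (Nat.mul_le_mul_left p ih)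
    by_cases hd : p ∣ m * b
    · rw [Nat.totient_mul_of_prime_of_dvd hp hd]
    · rw [Nat.totient_mul_of_prime_of_not_dvd hp hd]
      exact Nat.mul_le_mul_right _ (Nat.sub_le _ _)

lemma sigmaInv_mul_totient_le (q : ℕ) : sigmaInv q * q.totient ≤ q := by
  rw [sigmaInv, sum_mul]
  calc ∑ e ∈ q.divisors, (1 : ℝ) / e * q.totient ≤ ∑ e ∈ q.divisors, ((q / e).totient : ℝ) := by
        refine sum_le_sum fun e he => ?_
        have he0 : (0 : ℝ) < e := by exact_mod_cast Nat.pos_of_mem_divisors he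
        have htotient := totient_mul_le e (q / e)
        rw [Nat.mul_div_cancel' (Nat.dvd_of_mem_divisors he)] at htotient
        rw [one_div, inv_mul_le_iff₀ he0]
        exact_mod_cast htotient
    _ = ∑ e ∈ q.divisors, (e.totient : ℝ) := Nat.sum_div_divisors q fun e => (e.totient : ℝ)
    _ = q := by exact_mod_cast Nat.sum_totient q

lemma sum_gcd_div_sq_le (D : ℕ) {q : ℕ} (hq : q ≠ 0) :
    ∑ d ∈ Icc 1 D, (Nat.gcd d q : ℝ) / (d : ℝ) ^ 2 ≤ 2 * sigmaInv q := by
  have hgcd : ∀ d, (Nat.gcd d q : ℝ) / (d : ℝ) ^ 2 ≤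
      ∑ e ∈ q.divisors, if e ∣ d then (e : ℝ) / (d : ℝ) ^ 2 else 0 := by
    intro d
    have hmem : Nat.gcd d q ∈ q.divisors := Nat.mem_divisors.2 ⟨Nat.gcd_dvd_right d q, hq⟩
    refine (le_of_eq ?_).trans (single_le_sum (fun e _ => ?_) hmem)
    · rw [if_pos (Nat.gcd_dvd_left d q)]
    · split_ifs <;> positivity
  calc ∑ d ∈ Icc 1 D, (Nat.gcd d q : ℝ) / (d : ℝ) ^ 2
      ≤ ∑ d ∈ Icc 1 D, ∑ e ∈ q.divisors, (if e ∣ d then (e : ℝ) / (d : ℝ) ^ 2 else 0) :=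
        sum_le_sum fun d _ => hgcd d
    _ = ∑ e ∈ q.divisors, ∑ k ∈ Icc 1 (D / e), (e : ℝ) / ((k * e : ℕ) : ℝ) ^ 2 := by
        rw [sum_comm]
        refine sum_congr rfl fun e he => ?_
        rw [← sum_filter, sum_filter_dvd_Icc D (Nat.pos_of_mem_divisors he)]
    _ = ∑ e ∈ q.divisors, (∑ k ∈ Icc 1 (D / e), 1 / (k : ℝ) ^ 2) * (1 / (e : ℝ)) := by
        refine sum_congr rfl fun e he => ?_
        have he0 : (e : ℝ) ≠ 0 := by exact_mod_cast (Nat.pos_of_mem_divisors he).ne'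
        rw [sum_mul]
        refine sum_congr rfl fun k _ => ?_
        push_cast
        field_simp
    _ ≤ ∑ e ∈ q.divisors, 2 * ((1 : ℝ) / e) :=
        sum_le_sum fun e _ => mul_le_mul_of_nonneg_right (sum_one_div_sq_le_two _) (by positivity)
    _ = 2 * sigmaInv q := by rw [sigmaInv, mul_sum]

lemma sum_one_div_le_one_add_log (D : ℕ) : ∑ d ∈ Icc 1 D, (1 : ℝ) / d ≤ 1 + Real.log D := by
  have h := harmonic_le_one_add_log D
  rw [harmonic_eq_sum_Icc] at h
  push_cast at h
  simpa only [one_div] using h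

lemma mul_mem_Icc_of_le_div {H d k : ℕ} (hd : 0 < d) (hk : k ∈ Icc 1 (H / d)) :
    k * d ∈ Icc 1 H := by
  rw [mem_Icc] at *
  exact ⟨Nat.mul_pos hk.1 hd, (Nat.le_div_iff_mul_le hd).1 hk.2⟩

lemma one_div_mul_sum_multiples_le {A : ℝ} (hA : 0 ≤ A) {F : ℕ → ℝ} {H : ℕ}
    (hF : ∀ h ∈ Icc 1 H, F h ≤ A) {d : ℕ} (hd : 0 < d) :
    1 / (d : ℝ) * ∑ k ∈ Icc 1 (H / d), F (k * d) ≤ A * H * ((d : ℝ) ^ 2)⁻¹ := by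
  have : (0 : ℝ) < d := by exact_mod_cast hd
  calc 1 / (d : ℝ) * ∑ k ∈ Icc 1 (H / d), F (k * d)
      ≤ 1 / (d : ℝ) * ∑ _k ∈ Icc 1 (H / d), A := by
        gcongr with k hk
        exact hF _ (mul_mem_Icc_of_le_div hd hk)
    _ = 1 / (d : ℝ) * (A * ((H / d : ℕ) : ℝ)) := by
        rw [sum_const, Nat.card_Icc, Nat.add_sub_cancel, nsmul_eq_mul, mul_comm A]
    _ ≤ 1 / (d : ℝ) * (A * (H / d)) := by
        gcongr
        exact Nat.cast_div_le
    _ = _ := by field_simp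

section

variable {A c : ℝ} {q : ℕ} {a : ℤ} {F : ℕ → ℝ} {H : ℕ}

-- After cancelling `gcd d q`, the multiples of `d` see the reduced fraction `d * a / q`.
lemma one_div_mul_sum_multiples_le_gcd (hA : 1 ≤ A) (hc : 0 < c) (hcA : 1 ≤ 2 * c * A)
    (hq : 0 < q) (ha : IsCoprime a q)
    (hF : ∀ h ∈ Icc 1 H, IsKernelBounded A c (Real.pi * (((h * a : ℤ) : ℝ) / q)) (F h))
    {d : ℕ} (hd : 0 < d) :
    1 / (d : ℝ) * ∑ k ∈ Icc 1 (H / d), F (k * d) ≤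
      A * H / q * ((Nat.gcd d q : ℝ) / (d : ℝ) ^ 2) + H * kernelLog A c * (1 / (d : ℝ) ^ 2) +
        q * kernelLog A c * (1 / (d : ℝ)) := by
  obtain ⟨d', n, hcop, hdd, hqn⟩ := Nat.exists_coprime d q
  set g := Nat.gcd d q
  have hg0 : 0 < g := Nat.gcd_pos_of_pos_left q hd
  have hn0 : 0 < n := Nat.pos_of_mul_pos_right (hqn ▸ hq)
  have hg0' : (0 : ℝ) < g := by exact_mod_cast hg0
  have hd0 : (0 : ℝ) < d := by exact_mod_cast hd
  have hn0' : (0 : ℝ) < n := by exact_mod_cast hn0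
  have hL := kernelLog_nonneg hA hcA
  have ha' : IsCoprime ((d' : ℤ) * a) n := by
    refine IsCoprime.mul_left (Nat.isCoprime_iff_coprime.2 hcop) ?_
    rw [hqn, Nat.cast_mul] at ha
    exact ha.of_mul_right_left
  have hqn' : (q : ℝ) = n * g := by exact_mod_cast hqn
  have hdd' : (d : ℝ) = d' * g := by exact_mod_cast hdd
  have hsum := sum_le_of_isKernelBounded hA hc hcA hn0 ha' (F := fun k => F (k * d)) (H / d) (by
    intro k hk
    have hkd := hF _ (mul_mem_Icc_of_le_div hd hk)
    have hangle : ((((k * d : ℕ) : ℤ) * a : ℤ) : ℝ) / q = (((k : ℤ) * (d' * a) : ℤ) : ℝ) / n := by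
      push_cast
      rw [hqn', hdd']
      field_simp
    rwa [hangle] at hkd)
  calc 1 / (d : ℝ) * ∑ k ∈ Icc 1 (H / d), F (k * d)
      ≤ 1 / (d : ℝ) * (A * (((H / d : ℕ) : ℝ) / n) +
          (((H / d : ℕ) : ℝ) / n + 1) * (n * kernelLog A c)) := by gcongr
    _ ≤ 1 / (d : ℝ) * (A * ((H / d : ℝ) / n) + ((H / d : ℝ) / n + 1) * (n * kernelLog A c)) := by
        have : ((H / d : ℕ) : ℝ) ≤ H / d := Nat.cast_div_le
        gcongr
    _ = A * H / q * ((g : ℝ) / (d : ℝ) ^ 2) + H * kernelLog A c * (1 / (d : ℝ) ^ 2) +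
          n * kernelLog A c * (1 / (d : ℝ)) := by
        rw [hqn']
        field_simp
        ring
    _ ≤ _ := by
        have : (n : ℝ) ≤ q := by exact_mod_cast Nat.le_of_dvd hq (hqn ▸ Dvd.intro g rfl)
        gcongr

lemma sum_small_divisors_le (hA : 1 ≤ A) (hc : 0 < c) (hcA : 1 ≤ 2 * c * A) (hq : 0 < q)
    (ha : IsCoprime a q)
    (hF : ∀ h ∈ Icc 1 H, IsKernelBounded A c (Real.pi * (((h * a : ℤ) : ℝ) / q)) (F h)) (D : ℕ) :
    ∑ d ∈ Icc 1 H with d ≤ D, 1 / (d : ℝ) * ∑ k ∈ Icc 1 (H / d), F (k * d) ≤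
      2 * A * H / q.totient + 2 * H * kernelLog A c + q * kernelLog A c * (1 + Real.log D) := by
  have hL := kernelLog_nonneg hA hcA
  have hφ : (0 : ℝ) < q.totient := by exact_mod_cast Nat.totient_pos.2 hq
  have : (0 : ℝ) < q := by exact_mod_cast hq
  have hsub : {d ∈ Icc 1 H | d ≤ D} ⊆ Icc 1 D := fun d hd => by
    rw [mem_filter, mem_Icc] at hd
    exact mem_Icc.2 ⟨hd.1.1, hd.2⟩
  have hgcd : ∑ d ∈ Icc 1 D, (Nat.gcd d q : ℝ) / (d : ℝ) ^ 2 ≤ 2 * (q / q.totient) :=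
    (sum_gcd_div_sq_le D hq.ne').trans
      (mul_le_mul_of_nonneg_left ((le_div_iff₀ hφ).2 (sigmaInv_mul_totient_le q)) zero_le_two)
  calc ∑ d ∈ Icc 1 H with d ≤ D, 1 / (d : ℝ) * ∑ k ∈ Icc 1 (H / d), F (k * d)
      ≤ ∑ d ∈ Icc 1 H with d ≤ D, (A * H / q * ((Nat.gcd d q : ℝ) / (d : ℝ) ^ 2) +
          H * kernelLog A c * (1 / (d : ℝ) ^ 2) + q * kernelLog A c * (1 / (d : ℝ))) :=
        sum_le_sum fun d hd => one_div_mul_sum_multiples_le_gcd hA hc hcA hq ha hF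
          (mem_Icc.1 (mem_filter.1 hd).1).1
    _ ≤ ∑ d ∈ Icc 1 D, (A * H / q * ((Nat.gcd d q : ℝ) / (d : ℝ) ^ 2) +
          H * kernelLog A c * (1 / (d : ℝ) ^ 2) + q * kernelLog A c * (1 / (d : ℝ))) :=
        sum_le_sum_of_subset_of_nonneg hsub fun _ _ _ => by positivity
    _ = A * H / q * ∑ d ∈ Icc 1 D, (Nat.gcd d q : ℝ) / (d : ℝ) ^ 2 +
          H * kernelLog A c * ∑ d ∈ Icc 1 D, 1 / (d : ℝ) ^ 2 +
          q * kernelLog A c * ∑ d ∈ Icc 1 D, 1 / (d : ℝ) := by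
        rw [sum_add_distrib, sum_add_distrib, mul_sum, mul_sum, mul_sum]
    _ ≤ A * H / q * (2 * (q / q.totient)) + H * kernelLog A c * 2 +
          q * kernelLog A c * (1 + Real.log D) := by
        gcongr
        · exact sum_one_div_sq_le_two D
        · exact sum_one_div_le_one_add_log D
    _ = _ := by field_simp

lemma sum_large_divisors_le (hA : 0 ≤ A) (hF : ∀ h ∈ Icc 1 H, F h ≤ A) (D : ℕ) :
    ∑ d ∈ Icc 1 H with ¬d ≤ D, 1 / (d : ℝ) * ∑ k ∈ Icc 1 (H / d), F (k * d) ≤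
      2 * A * H / (D + 1) := by
  have hsub : {d ∈ Icc 1 H | ¬d ≤ D} ⊆ Ioo D (H + 1) := fun d hd => by
    rw [mem_filter, mem_Icc] at hd
    exact mem_Ioo.2 ⟨not_le.1 hd.2, Nat.lt_succ_of_le hd.1.2⟩
  calc ∑ d ∈ Icc 1 H with ¬d ≤ D, 1 / (d : ℝ) * ∑ k ∈ Icc 1 (H / d), F (k * d)
      ≤ ∑ d ∈ Icc 1 H with ¬d ≤ D, A * H * ((d : ℝ) ^ 2)⁻¹ :=
        sum_le_sum fun d hd => one_div_mul_sum_multiples_le hA hF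
          (mem_Icc.1 (mem_filter.1 hd).1).1
    _ ≤ ∑ d ∈ Ioo D (H + 1), A * H * ((d : ℝ) ^ 2)⁻¹ :=
        sum_le_sum_of_subset_of_nonneg hsub fun _ _ _ => by positivity
    _ ≤ A * H * (2 / (D + 1)) := by
        rw [← mul_sum]
        exact mul_le_mul_of_nonneg_left (sum_Ioo_inv_sq_le D (H + 1)) (by positivity)
    _ = _ := by ring

lemma sum_sigmaInv_mul_le (hA : 1 ≤ A) (hc : 0 < c) (hcA : 1 ≤ 2 * c * A) (hq : 0 < q)
    (ha : IsCoprime a q)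
    (hF : ∀ h ∈ Icc 1 H, IsKernelBounded A c (Real.pi * (((h * a : ℤ) : ℝ) / q)) (F h)) (D : ℕ) :
    ∑ h ∈ Icc 1 H, sigmaInv h * F h ≤ 2 * A * H / q.totient + 2 * H * kernelLog A c +
      q * kernelLog A c * (1 + Real.log D) + 2 * A * H / (D + 1) := by
  calc ∑ h ∈ Icc 1 H, sigmaInv h * F h
      = ∑ d ∈ Icc 1 H, 1 / (d : ℝ) * ∑ k ∈ Icc 1 (H / d), F (k * d) :=
        sum_sum_divisors_mul H (fun d => 1 / (d : ℝ)) F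
    _ = _ := (sum_filter_add_sum_filter_not _ (· ≤ D) _).symm
    _ ≤ _ := add_le_add (sum_small_divisors_le hA hc hcA hq ha hF D)
        (sum_large_divisors_le (zero_le_one.trans hA) (fun h hh => (hF h hh).le) D)

end

/-! ### The bilinear sum over dyadic primes -/

/-- The bilinear sum `∑ m, f m * ∑ p ∈ X, f p * log p * ramp (m p) * e (m p θ)` over `m ≤ N`. -/
noncomputable def bilinearSum (f : ℕ → ℂ) (N : ℕ) (w θ : ℝ) (X : Finset ℕ) : ℂ :=
  ∑ m ∈ Icc 1 N, f m * ∑ p ∈ X, f p * Real.log p * ramp N w (m * p) * e (m * θ * p)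

lemma bilinearSum_eq_of_lt (f : ℕ → ℂ) {N P : ℕ} {w : ℝ} (hw : 0 < w) (θ : ℝ) (hP : 0 < P)
    {X : Finset ℕ} (hX : ∀ p ∈ X, P < p) :
    bilinearSum f N w θ X = ∑ m ∈ Icc 1 (N / P),
      f m * ∑ p ∈ X, f p * Real.log p * ramp N w (m * p) * e (m * θ * p) := by
  refine (sum_subset (Icc_subset_Icc_right (Nat.div_le_self N P)) fun m hm hm' => ?_).symm
  have hNm : N < m * P := by
    rw [mem_Icc] at hm hm'
    exact (Nat.div_lt_iff_lt_mul hP).1 (by lia)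
  refine mul_eq_zero_of_right _ (sum_eq_zero fun p hp => ?_)
  have hNp : (N : ℝ) ≤ m * p := by
    exact_mod_cast hNm.le.trans (Nat.mul_le_mul_left m (hX p hp).le)
  rw [ramp_eq_zero hw hNp, Complex.ofReal_zero, mul_zero, zero_mul]

lemma norm_sum_mul_sq_le {ι : Type*} (s : Finset ι) (f g : ι → ℂ) :
    ‖∑ i ∈ s, f i * g i‖ ^ 2 ≤ (∑ i ∈ s, ‖f i‖ ^ 2) * ∑ i ∈ s, ‖g i‖ ^ 2 := by
  refine le_trans ?_ (sum_mul_sq_le_sq_mul_sq s (‖f ·‖) (‖g ·‖))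
  gcongr
  exact norm_sum_le_of_le s fun i _ => norm_mul_le _ _

lemma sum_norm_sq_le_of_norm_le {f : ℕ → ℂ} {B : ℝ} (hf : ∀ n, ‖f n‖ ≤ B) (N P : ℕ) :
    ∑ m ∈ Icc 1 (N / P), ‖f m‖ ^ 2 ≤ B ^ 2 * ((N : ℝ) / P) := by
  calc ∑ m ∈ Icc 1 (N / P), ‖f m‖ ^ 2 ≤ ∑ _m ∈ Icc 1 (N / P), B ^ 2 :=
        sum_le_sum fun m _ => pow_le_pow_left₀ (norm_nonneg _) (hf m) 2
    _ = B ^ 2 * ((N / P : ℕ) : ℝ) := by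
        rw [sum_const, Nat.card_Icc, Nat.add_sub_cancel, nsmul_eq_mul, mul_comm]
    _ ≤ _ := mul_le_mul_of_nonneg_left Nat.cast_div_le (by positivity)

lemma norm_mul_log_le {f : ℕ → ℂ} {B : ℝ} (hf : ∀ n, ‖f n‖ ≤ B) {p : ℕ} (hp : p ≠ 0) {Q : ℝ}
    (hpQ : p ≤ Q) : ‖f p * (Real.log p : ℂ)‖ ≤ B * Real.log Q := by
  have hlog : 0 ≤ Real.log p := Real.log_natCast_nonneg p
  have hp0 : (0 : ℝ) < p := by exact_mod_cast Nat.pos_of_ne_zero hp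
  rw [norm_mul, Complex.norm_real, Real.norm_of_nonneg hlog]
  exact mul_le_mul (hf p) (Real.log_le_log hp0 hpQ) hlog ((norm_nonneg _).trans (hf p))

lemma norm_bilinearSum_sq_le {f : ℕ → ℂ} {B : ℝ} (hf : ∀ n, ‖f n‖ ≤ B) {N P : ℕ}
    {w : ℝ} (hw : 0 < w) (θ : ℝ) (hP : 0 < P) {X : Finset ℕ} (hX : ∀ p ∈ X, P < p ∧ p ≤ 2 * P) :
    ‖bilinearSum f N w θ X‖ ^ 2 ≤ B ^ 4 * ((N : ℝ) / P) * Real.log (2 * P) ^ 2 *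
      ∑ p ∈ X, ∑ p' ∈ X, |cosKernel (pairWeight N w p p') (N / P + 1)
        (2 * Real.pi * (((p : ℝ) - p') * θ))| := by
  set K : ℕ → ℕ → ℝ := fun p p' => |cosKernel (pairWeight N w p p') (N / P + 1)
    (2 * Real.pi * (((p : ℝ) - p') * θ))|
  set A : ℕ → ℂ := fun m => ∑ p ∈ X, f p * Real.log p * ramp N w (m * p) * e (m * θ * p)
  have hcoeff : ∀ p ∈ X, ‖f p * (Real.log p : ℂ)‖ ≤ B * Real.log (2 * P) := fun p hp =>
    norm_mul_log_le hf (by have := hX p hp; lia) (by exact_mod_cast (hX p hp).2)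
  have hmean : ∑ m ∈ Icc 1 (N / P), ‖A m‖ ^ 2 ≤
      (B * Real.log (2 * P)) ^ 2 * ∑ p ∈ X, ∑ p' ∈ X, K p p' := by
    calc ∑ m ∈ Icc 1 (N / P), ‖A m‖ ^ 2 ≤ ∑ m ∈ Icc 1 (N / P + 1), ‖A m‖ ^ 2 :=
          sum_le_sum_of_subset_of_nonneg (Icc_subset_Icc_right (Nat.le_succ _))
            fun _ _ _ => sq_nonneg _
      _ ≤ ∑ p ∈ X, ∑ p' ∈ X,
            ‖f p * (Real.log p : ℂ)‖ * ‖f p' * (Real.log p' : ℂ)‖ * K p p' :=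
          sum_norm_sq_le_cosKernel X (fun p => f p * Real.log p) (fun m p => ramp N w (m * p))
            (N / P + 1) θ
      _ ≤ ∑ p ∈ X, ∑ p' ∈ X, (B * Real.log (2 * P)) ^ 2 * K p p' := by
          refine sum_le_sum fun p hp => sum_le_sum fun p' hp' =>
            mul_le_mul_of_nonneg_right ?_ (abs_nonneg _)
          rw [sq]
          exact mul_le_mul (hcoeff p hp) (hcoeff p' hp') (norm_nonneg _)
            ((norm_nonneg _).trans (hcoeff p hp))
      _ = _ := by simp only [mul_sum]
  rw [bilinearSum_eq_of_lt f hw θ hP fun p hp => (hX p hp).1]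
  calc ‖∑ m ∈ Icc 1 (N / P), f m * A m‖ ^ 2
      ≤ (∑ m ∈ Icc 1 (N / P), ‖f m‖ ^ 2) * ∑ m ∈ Icc 1 (N / P), ‖A m‖ ^ 2 :=
        norm_sum_mul_sq_le _ _ _
    _ ≤ (B ^ 2 * ((N : ℝ) / P)) *
          ((B * Real.log (2 * P)) ^ 2 * ∑ p ∈ X, ∑ p' ∈ X, K p p') :=
        mul_le_mul (sum_norm_sq_le_of_norm_le hf N P) hmean (sum_nonneg fun _ _ => sq_nonneg _)
          (by positivity)
    _ = _ := by ring

/-- The largest number satisfying the bounds `IsKernelBounded A c α`. It majorizes all kernels of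
a dyadic block and is an even function of `α`. -/
noncomputable def kernelMajorant (A c α : ℝ) : ℝ :=
  if Real.sin α = 0 then A else min A (min (1 / |Real.sin α|) (c / Real.sin α ^ 2))

lemma IsKernelBounded.le_kernelMajorant {A c α x : ℝ} (hx : IsKernelBounded A c α x) :
    x ≤ kernelMajorant A c α := by
  rw [kernelMajorant]
  split_ifs with hsin
  · exact hx.le
  · have hpos : 0 < |Real.sin α| := abs_pos.2 hsin
    exact le_min hx.le (le_min ((le_div_iff₀ hpos).2 hx.mul_abs_sin_le)
      ((le_div_iff₀ (by positivity)).2 hx.mul_sin_sq_le))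

lemma isKernelBounded_kernelMajorant {A c : ℝ} (hA : 0 ≤ A) (hc : 0 ≤ c) (α : ℝ) :
    IsKernelBounded A c α (kernelMajorant A c α) := by
  rw [kernelMajorant]
  split_ifs with hsin
  · constructor <;> simp [hsin, hA, hc]
  · have hpos : 0 < |Real.sin α| := abs_pos.2 hsin
    refine ⟨le_min hA (le_min (by positivity) (by positivity)), min_le_left _ _, ?_, ?_⟩
    · rw [← le_div_iff₀ hpos]
      exact (min_le_right _ _).trans (min_le_left _ _)
    · rw [← le_div_iff₀ (by positivity)]
      exact (min_le_right _ _).trans (min_le_right _ _)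

lemma kernelMajorant_neg (A c α : ℝ) : kernelMajorant A c (-α) = kernelMajorant A c α := by
  simp only [kernelMajorant, Real.sin_neg, neg_eq_zero, abs_neg, neg_sq]

lemma kernelMajorant_dist (A c θ : ℝ) (m n : ℕ) :
    kernelMajorant A c (Real.pi * ((Nat.dist m n : ℝ) * θ)) =
      kernelMajorant A c (Real.pi * (((m : ℝ) - n) * θ)) := by
  rcases le_total m n with h | h
  · rw [Nat.dist_eq_sub_of_le h, ← kernelMajorant_neg, Nat.cast_sub h]
    ring_nf
  · rw [Nat.dist_eq_sub_of_le_right h, Nat.cast_sub h]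

section

variable {R : Type*} [CommSemiring R] {P : ℕ} {X : Finset ℕ}

lemma sum_sum_filter_lt_dist (hX : ∀ p ∈ X, ∀ p' ∈ X, p' ≤ p + P) (F : ℕ → R) :
    ∑ p ∈ X, ∑ p' ∈ X with p < p', F (Nat.dist p p') =
      ∑ h ∈ Icc 1 P, (#{p ∈ X | p + h ∈ X} : R) * F h := by
  have hshift : ∀ p ∈ X, ∑ p' ∈ X with p < p', F (Nat.dist p p') =
      ∑ h ∈ Icc 1 P with p + h ∈ X, F h := by
    refine fun p hp => sum_nbij' (· - p) (p + ·) (fun p' hp' => ?_) (fun h hh => ?_)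
      (fun p' hp' => Nat.add_sub_cancel' (mem_filter.1 hp').2.le)
      (fun h _ => Nat.add_sub_cancel_left p h)
      fun p' hp' => by rw [Nat.dist_eq_sub_of_le (mem_filter.1 hp').2.le]
    · rw [mem_filter] at hp'
      rw [mem_filter, mem_Icc, Nat.add_sub_cancel' hp'.2.le]
      exact ⟨by have := hX p hp p' hp'.1; lia, hp'.1⟩
    · rw [mem_filter, mem_Icc] at hh
      exact mem_filter.2 ⟨hh.2, by lia⟩
  rw [sum_congr rfl hshift]
  simp only [sum_filter]
  rw [sum_comm]
  refine sum_congr rfl fun h _ => ?_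
  rw [← sum_filter, sum_const, nsmul_eq_mul]

lemma sum_sum_dist_eq (hX : ∀ p ∈ X, ∀ p' ∈ X, p' ≤ p + P) (F : ℕ → R) :
    ∑ p ∈ X, ∑ p' ∈ X, F (Nat.dist p p') =
      #X * F 0 + 2 * ∑ h ∈ Icc 1 P, (#{p ∈ X | p + h ∈ X} : R) * F h := by
  have hsymm : ∑ p ∈ X, ∑ p' ∈ X with p' < p, F (Nat.dist p p') =
      ∑ p ∈ X, ∑ p' ∈ X with p < p', F (Nat.dist p p') := by
    simp only [sum_filter]
    rw [sum_comm]
    simp only [Nat.dist_comm]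
  have htrichotomy : ∀ p ∈ X, ∑ p' ∈ X, F (Nat.dist p p') =
      F 0 + ∑ p' ∈ X with p < p', F (Nat.dist p p') +
        ∑ p' ∈ X with p' < p, F (Nat.dist p p') := by
    intro p hp
    have hdiag : F 0 = ∑ p' ∈ X, if p' = p then F (Nat.dist p p') else 0 := by
      rw [sum_ite_eq' X p, if_pos hp, Nat.dist_self]
    rw [hdiag, sum_filter, sum_filter, ← sum_add_distrib, ← sum_add_distrib]
    refine sum_congr rfl fun p' _ => ?_
    rcases lt_trichotomy p p' with h | rfl | h
    · simp [h, h.ne', h.not_gt]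
    · simp
    · simp [h, h.ne, h.not_gt]
  rw [sum_congr rfl htrichotomy, sum_add_distrib, sum_add_distrib, hsymm,
    sum_sum_filter_lt_dist hX, sum_const, nsmul_eq_mul]
  ring

end

lemma isKernelBounded_cosKernel_pairWeight {N P : ℕ} (hP : 0 < P) (hPN : 3 * P ≤ N) {w : ℝ}
    (hw : 0 < w) {s t : ℝ} (hs : P ≤ s) (hs' : s ≤ 2 * P) (ht : 0 ≤ t) (ht' : t ≤ 2 * P) (x : ℝ) :
    IsKernelBounded (3 * ((N : ℝ) / P)) (8 * P / w) (x / 2)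
      |cosKernel (pairWeight N w s t) (N / P + 1) x| := by
  have hP' : (0 : ℝ) < P := by exact_mod_cast hP
  have hPN' : 3 ≤ (N : ℝ) / P := (le_div_iff₀ hP').2 (by exact_mod_cast hPN)
  have hs0 : 0 ≤ s := hP'.le.trans hs
  have hlength : (N : ℝ) ≤ ((N / P + 1 : ℕ) : ℝ) * s := by
    have hceil : N ≤ (N / P + 1) * P := by
      rw [Nat.add_mul, one_mul]
      exact (Nat.lt_div_mul_add hP).le
    calc (N : ℝ) ≤ ((N / P + 1 : ℕ) : ℝ) * P := by exact_mod_cast hceil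
      _ ≤ _ := by gcongr
  refine ⟨abs_nonneg _, (abs_cosKernel_pairWeight_le _ x).trans ?_,
    abs_cosKernel_pairWeight_mul_sin_le hw hs0 ht hlength x,
    (abs_cosKernel_pairWeight_mul_sin_sq_le hw hs0 ht hlength x).trans ?_⟩
  · have : ((N / P : ℕ) : ℝ) ≤ (N : ℝ) / P := Nat.cast_div_le
    push_cast
    linarith
  · rw [div_le_div_iff₀ (by positivity) hw]
    nlinarith

/-- The primes in `(2 ^ j, 2 ^ (j + 1)]`. -/
def dyadicPrimes (j : ℕ) : Finset ℕ := {p ∈ Ioc (2 ^ j) (2 * 2 ^ j) | p.Prime}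

lemma mem_Ioc_of_mem_dyadicPrimes {j p : ℕ} (hp : p ∈ dyadicPrimes j) :
    2 ^ j < p ∧ p ≤ 2 * 2 ^ j :=
  mem_Ioc.1 (mem_filter.1 hp).1

lemma card_dyadicPrimes_le (j : ℕ) : #(dyadicPrimes j) ≤ 2 ^ j := by
  refine (card_filter_le _ _).trans_eq ?_
  rw [Nat.card_Ioc]
  lia

lemma card_dyadicPrimes_pairs_le {j : ℕ} (hj : 130 ≤ j) {h : ℕ} (h0 : h ≠ 0) :
    (#{p ∈ dyadicPrimes j | p + h ∈ dyadicPrimes j} : ℝ) ≤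
      201 * sigmaInv h * ((2 : ℝ) ^ j / Real.log ((2 : ℝ) ^ j) ^ 2) := by
  refine le_trans ?_ (card_prime_pairs_le hj h0)
  norm_cast
  refine card_le_card fun p hp => ?_
  rw [mem_filter, dyadicPrimes, mem_filter, mem_filter] at hp
  exact mem_filter.2 ⟨hp.1.1, hp.1.2, hp.2.2⟩

lemma abs_cosKernel_pairWeight_le_kernelMajorant {N j : ℕ} (hjN : 3 * 2 ^ j ≤ N) {w : ℝ}
    (hw : 0 < w) (θ : ℝ) {p p' : ℕ} (hp : p ∈ dyadicPrimes j) (hp' : p' ∈ dyadicPrimes j) :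
    |cosKernel (pairWeight N w p p') (N / 2 ^ j + 1) (2 * Real.pi * (((p : ℝ) - p') * θ))| ≤
      kernelMajorant (3 * ((N : ℝ) / 2 ^ j)) (8 * 2 ^ j / w)
        (Real.pi * ((Nat.dist p p' : ℕ) * θ)) := by
  obtain ⟨hp₁, hp₂⟩ := mem_Ioc_of_mem_dyadicPrimes hp
  obtain ⟨-, hp'₂⟩ := mem_Ioc_of_mem_dyadicPrimes hp'
  have hbounded := isKernelBounded_cosKernel_pairWeight (Nat.two_pow_pos j) hjN hw
    (s := p) (t := p') (by exact_mod_cast hp₁.le) (by exact_mod_cast hp₂) (Nat.cast_nonneg _)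
    (by exact_mod_cast hp'₂) (2 * Real.pi * (((p : ℝ) - p') * θ))
  rw [mul_assoc, mul_div_cancel_left₀ _ two_ne_zero, Nat.cast_pow, Nat.cast_two] at hbounded
  rw [kernelMajorant_dist, mul_assoc]
  exact hbounded.le_kernelMajorant

lemma sum_abs_cosKernel_le_sum_sigmaInv {N j : ℕ} (hj : 130 ≤ j) (hjN : 3 * 2 ^ j ≤ N) {w : ℝ}
    (hw : 0 < w) (θ : ℝ) :
    ∑ p ∈ dyadicPrimes j, ∑ p' ∈ dyadicPrimes j,
      |cosKernel (pairWeight N w p p') (N / 2 ^ j + 1) (2 * Real.pi * (((p : ℝ) - p') * θ))| ≤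
      3 * N + 402 * ((2 : ℝ) ^ j / Real.log ((2 : ℝ) ^ j) ^ 2) * ∑ h ∈ Icc 1 (2 ^ j), sigmaInv h *
        kernelMajorant (3 * ((N : ℝ) / 2 ^ j)) (8 * 2 ^ j / w) (Real.pi * (h * θ)) := by
  set A : ℝ := 3 * ((N : ℝ) / 2 ^ j) with hA
  set Y : ℝ := (2 : ℝ) ^ j / Real.log ((2 : ℝ) ^ j) ^ 2
  set F : ℕ → ℝ := fun h => kernelMajorant A (8 * 2 ^ j / w) (Real.pi * (h * θ))
  have hFb : ∀ h : ℕ, IsKernelBounded A (8 * 2 ^ j / w) (Real.pi * (h * θ)) (F h) := fun h =>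
    isKernelBounded_kernelMajorant (by positivity) (by positivity) _
  have hdiff : ∀ p ∈ dyadicPrimes j, ∀ p' ∈ dyadicPrimes j, p' ≤ p + 2 ^ j := by
    intro p hp p' hp'
    have hp₁ := (mem_Ioc_of_mem_dyadicPrimes hp).1
    have hp'₂ := (mem_Ioc_of_mem_dyadicPrimes hp').2
    lia
  calc _ ≤ ∑ p ∈ dyadicPrimes j, ∑ p' ∈ dyadicPrimes j, F (Nat.dist p p') :=
        sum_le_sum fun p hp => sum_le_sum fun p' hp' =>
          abs_cosKernel_pairWeight_le_kernelMajorant hjN hw θ hp hp'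
    _ = #(dyadicPrimes j) * F 0 + 2 * ∑ h ∈ Icc 1 (2 ^ j),
          (#{p ∈ dyadicPrimes j | p + h ∈ dyadicPrimes j} : ℝ) * F h :=
        sum_sum_dist_eq hdiff F
    _ ≤ 2 ^ j * A + 2 * ∑ h ∈ Icc 1 (2 ^ j), 201 * sigmaInv h * Y * F h := by
        gcongr with h hh
        · exact (hFb 0).nonneg
        · exact_mod_cast card_dyadicPrimes_le j
        · exact (hFb 0).le
        · exact (hFb h).nonneg
        · exact card_dyadicPrimes_pairs_le hj (by have := mem_Icc.1 hh; lia)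
    _ = 3 * N + 402 * Y * ∑ h ∈ Icc 1 (2 ^ j), sigmaInv h * F h := by
        rw [hA, mul_sum, mul_sum]
        congr 1
        · field_simp
        · exact sum_congr rfl fun h _ => by ring

lemma sum_sigmaInv_mul_kernelMajorant_le {N q j : ℕ} (hq : 0 < q) (hqN : q ≤ N)
    (hjN : 2 ^ j ≤ N) {a : ℤ} (ha : IsCoprime a q) :
    ∑ h ∈ Icc 1 (2 ^ j), sigmaInv h *
        kernelMajorant (3 * ((N : ℝ) / 2 ^ j)) (8 * 2 ^ j / q) (Real.pi * (h * (a / q))) ≤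
      6 * N / q.totient + 2 * 2 ^ j * kernelLog (3 * ((N : ℝ) / 2 ^ j)) (8 * 2 ^ j / q) +
        q * kernelLog (3 * ((N : ℝ) / 2 ^ j)) (8 * 2 ^ j / q) * (1 + Real.log (N / q)) +
          6 * q := by
  have hq' : (0 : ℝ) < q := by exact_mod_cast hq
  have hR : 1 ≤ (N : ℝ) / q := (one_le_div hq').2 (by exact_mod_cast hqN)
  have hM : 1 ≤ (N : ℝ) / 2 ^ j := (one_le_div (by positivity)).2 (by exact_mod_cast hjN)
  set A : ℝ := 3 * ((N : ℝ) / 2 ^ j) with hA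
  set c : ℝ := 8 * 2 ^ j / q with hc
  set D := ⌊(N : ℝ) / q⌋₊
  have hA1 : 1 ≤ A := by linarith
  have hc0 : 0 < c := by positivity
  have hcA : 1 ≤ 2 * c * A := by
    rw [show 2 * c * A = 48 * ((N : ℝ) / q) by rw [hA, hc]; field_simp; ring]
    linarith
  have hL := kernelLog_nonneg hA1 hcA
  have hAP : 2 * A * 2 ^ j = 6 * N := by rw [hA]; field_simp; ring
  have hD1 : (1 : ℝ) ≤ D := by exact_mod_cast Nat.one_le_floor_iff _ |>.2 hR
  have htail : 6 * (N : ℝ) / (D + 1) ≤ 6 * q := by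
    rw [div_le_iff₀ (by positivity), mul_assoc]
    gcongr
    exact ((div_lt_iff₀' hq').1 (Nat.lt_floor_add_one _)).le
  have hlog : Real.log D ≤ Real.log (N / q) :=
    Real.log_le_log (by linarith) (Nat.floor_le (by positivity))
  have hsum := sum_sigmaInv_mul_le hA1 hc0 hcA hq ha (H := 2 ^ j)
    (F := fun h => kernelMajorant A c (Real.pi * (h * (a / q)))) (fun h _ => by
      rw [Int.cast_mul, Int.cast_natCast, mul_div_assoc]
      exact isKernelBounded_kernelMajorant (by linarith) hc0.le _) D
  push_cast at hsum
  rw [hAP] at hsum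
  refine hsum.trans ?_
  gcongr

lemma sum_abs_cosKernel_le {N q j : ℕ} (hq : 0 < q) (hqN : q ≤ N) (hj : 130 ≤ j)
    (hjN : 3 * 2 ^ j ≤ N) {a : ℤ} (ha : IsCoprime a q) :
    ∑ p ∈ dyadicPrimes j, ∑ p' ∈ dyadicPrimes j,
      |cosKernel (pairWeight N q p p') (N / 2 ^ j + 1)
        (2 * Real.pi * (((p : ℝ) - p') * (a / q)))| ≤
      3 * N + 402 * ((2 : ℝ) ^ j / Real.log ((2 : ℝ) ^ j) ^ 2) *
        (6 * N / q.totient + 2 * 2 ^ j * kernelLog (3 * ((N : ℝ) / 2 ^ j)) (8 * 2 ^ j / q) +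
          q * kernelLog (3 * ((N : ℝ) / 2 ^ j)) (8 * 2 ^ j / q) * (1 + Real.log (N / q)) +
            6 * q) := by
  refine (sum_abs_cosKernel_le_sum_sigmaInv hj hjN (by exact_mod_cast hq) _).trans ?_
  gcongr
  exact sum_sigmaInv_mul_kernelMajorant_le hq hqN (by lia) ha

lemma kernelLog_le_log_div_add_six {N q : ℕ} (hN : N ≠ 0) (hq : q ≠ 0) (j : ℕ) :
    kernelLog (3 * ((N : ℝ) / 2 ^ j)) (8 * 2 ^ j / q) ≤ Real.log (N / q) + 6 := by
  have hlog : Real.log 48 ≤ 4 := by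
    rw [Real.log_le_iff_le_exp (by norm_num)]
    calc (48 : ℝ) ≤ 2.7 ^ 4 := by norm_num
      _ ≤ Real.exp 1 ^ 4 := by gcongr; linarith [Real.exp_one_gt_d9]
      _ = Real.exp 4 := by rw [← Real.exp_nat_mul]; norm_num
  have hq' : (q : ℝ) ≠ 0 := by exact_mod_cast hq
  refine (min_le_left _ _).trans ?_
  rw [show 2 * (8 * (2 : ℝ) ^ j / q) * (3 * ((N : ℝ) / 2 ^ j)) = 48 * (N / q) by field_simp; ring,
    Real.log_mul (by norm_num) (by positivity)]
  linarith

lemma kernelLog_le_one_add_log (N q j : ℕ) :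
    kernelLog (3 * ((N : ℝ) / 2 ^ j)) (8 * 2 ^ j / q) ≤ 1 + Real.log (6 * ((N : ℝ) / 2 ^ j)) := by
  refine (min_le_right _ _).trans_eq ?_
  rw [← mul_assoc]
  norm_num

lemma log_two_mul_two_pow (j : ℕ) : Real.log (2 * 2 ^ j) = (j + 1) * Real.log 2 := by
  rw [← pow_succ', Real.log_pow, Nat.cast_succ]

lemma log_two_mul_sq_mul_le {j : ℕ} (hj : 130 ≤ j) :
    Real.log (2 * 2 ^ j) ^ 2 * ((2 : ℝ) ^ j / Real.log (2 ^ j) ^ 2) ≤ 1.016 * 2 ^ j := by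
  have hj' : (130 : ℝ) ≤ j := by exact_mod_cast hj
  have : 0 < Real.log 2 := Real.log_pos one_lt_two
  calc Real.log (2 * 2 ^ j) ^ 2 * ((2 : ℝ) ^ j / Real.log (2 ^ j) ^ 2)
      = (((j : ℝ) + 1) ^ 2 / (j : ℝ) ^ 2) * 2 ^ j := by
        rw [log_two_mul_two_pow, Real.log_pow]
        field_simp
    _ ≤ 1.016 * 2 ^ j := by
        gcongr
        rw [div_le_iff₀ (by positivity)]
        nlinarith

lemma sum_abs_cosKernel_le_log {N q j : ℕ} (hq : 0 < q) (hqN : q ≤ N) (hj : 130 ≤ j)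
    (hjN : 3 * 2 ^ j ≤ N) {a : ℤ} (ha : IsCoprime a q) :
    ∑ p ∈ dyadicPrimes j, ∑ p' ∈ dyadicPrimes j,
      |cosKernel (pairWeight N q p p') (N / 2 ^ j + 1)
        (2 * Real.pi * (((p : ℝ) - p') * (a / q)))| ≤
      3 * N + 402 * ((2 : ℝ) ^ j / Real.log ((2 : ℝ) ^ j) ^ 2) *
        (6 * N / q.totient + 2 * 2 ^ j * (1 + Real.log (6 * ((N : ℝ) / 2 ^ j))) +
          q * ((Real.log (N / q) + 6) * (Real.log (N / q) + 1) + 6)) := by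
  have hx : 0 ≤ Real.log (N / q) :=
    Real.log_nonneg ((one_le_div (by exact_mod_cast hq)).2 (by exact_mod_cast hqN))
  refine (sum_abs_cosKernel_le hq hqN hj hjN ha).trans ?_
  calc _ ≤ 3 * N + 402 * ((2 : ℝ) ^ j / Real.log ((2 : ℝ) ^ j) ^ 2) *
        (6 * N / q.totient + 2 * 2 ^ j * (1 + Real.log (6 * ((N : ℝ) / 2 ^ j))) +
          q * (Real.log (N / q) + 6) * (1 + Real.log (N / q)) + 6 * q) := by
        gcongr
        · exact kernelLog_le_one_add_log N q j
        · exact kernelLog_le_log_div_add_six (hq.trans_le hqN).ne' hq.ne' j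
    _ = _ := by ring

lemma norm_bilinearSum_dyadic_sq_le {f : ℕ → ℂ} {B : ℝ} (hf : ∀ n, ‖f n‖ ≤ B) {N q j : ℕ}
    (hq : 0 < q) (hqN : q ≤ N) (hj : 130 ≤ j) (hjN : 3 * 2 ^ j ≤ N) {a : ℤ} (ha : IsCoprime a q) :
    ‖bilinearSum f N q (a / q) (dyadicPrimes j)‖ ^ 2 ≤ B ^ 4 * (
      3 * (N : ℝ) ^ 2 * (Real.log (2 * 2 ^ j) ^ 2 / 2 ^ j) + 2454 * ((N : ℝ) ^ 2 / q.totient) +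
      818 * (N : ℝ) ^ 2 * ((2 : ℝ) ^ j / N * (1 + Real.log (6 * ((N : ℝ) / 2 ^ j)))) +
      409 * (N * q) * ((Real.log (N / q) + 6) * (Real.log (N / q) + 1) + 6)) := by
  have hq' : (0 : ℝ) < q := by exact_mod_cast hq
  have : (0 : ℝ) < N := by exact_mod_cast hq.trans_le hqN
  have hcauchy := norm_bilinearSum_sq_le hf hq' ((a : ℝ) / q) (Nat.two_pow_pos j)
    (fun p hp => mem_Ioc_of_mem_dyadicPrimes hp) (N := N)
  push_cast at hcauchy
  have hx : 0 ≤ Real.log (N / q) := Real.log_nonneg ((one_le_div hq').2 (by exact_mod_cast hqN))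
  have hM : 3 ≤ (N : ℝ) / 2 ^ j := (le_div_iff₀ (by positivity)).2 (by exact_mod_cast hjN)
  have : 0 ≤ Real.log (6 * ((N : ℝ) / 2 ^ j)) := Real.log_nonneg (by linarith)
  set l := Real.log (2 * (2 : ℝ) ^ j)
  set Y := (2 : ℝ) ^ j / Real.log ((2 : ℝ) ^ j) ^ 2 with hY
  have hlY : l ^ 2 * Y ≤ 1.016 * 2 ^ j := log_two_mul_sq_mul_le hj
  have hkernel := sum_abs_cosKernel_le_log hq hqN hj hjN ha
  rw [← hY] at hkernel
  clear_value Y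
  set G := 6 * (N : ℝ) / q.totient + 2 * 2 ^ j * (1 + Real.log (6 * ((N : ℝ) / 2 ^ j))) +
    q * ((Real.log (N / q) + 6) * (Real.log (N / q) + 1) + 6) with hG
  have : 0 ≤ G := by positivity
  calc ‖bilinearSum f N q (a / q) (dyadicPrimes j)‖ ^ 2
      ≤ B ^ 4 * ((N : ℝ) / 2 ^ j) * l ^ 2 * (3 * N + 402 * Y * G) :=
        hcauchy.trans (by gcongr)
    _ = B ^ 4 * (3 * (N : ℝ) ^ 2 * (l ^ 2 / 2 ^ j) + 402 * (N / 2 ^ j) * G * (l ^ 2 * Y)) := by ring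
    _ ≤ B ^ 4 * (3 * (N : ℝ) ^ 2 * (l ^ 2 / 2 ^ j) + 402 * (N / 2 ^ j) * G * (1.016 * 2 ^ j)) := by
        gcongr
    _ = B ^ 4 * (3 * (N : ℝ) ^ 2 * (l ^ 2 / 2 ^ j) + (402 * 1.016) * N * G) := by
        congr 2
        field_simp
    _ ≤ B ^ 4 * (3 * (N : ℝ) ^ 2 * (l ^ 2 / 2 ^ j) + 409 * N * G) := by
        gcongr
        norm_num
    _ = _ := by
        rw [hG]
        field_simp
        ring

lemma three_mul_add_one_sq_le_pow {j : ℕ} (hj : 130 ≤ j) :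
    3 * ((j : ℝ) + 1) ^ 2 ≤ 1.62 ^ j := by
  induction j, hj using Nat.le_induction with
  | base => norm_num
  | succ n hn ih =>
    have : (130 : ℝ) ≤ n := by exact_mod_cast hn
    rw [pow_succ (1.62 : ℝ)]
    push_cast
    nlinarith

lemma log_sq_div_two_pow_le {j : ℕ} (hj : 130 ≤ j) :
    3 * (Real.log (2 * 2 ^ j) ^ 2 / 2 ^ j) ≤ ((0.9 : ℝ) ^ j) ^ 2 := by
  have hlog_two : Real.log 2 ≤ 1 := by linarith [Real.log_two_lt_d9]
  rw [log_two_mul_two_pow, ← mul_div_assoc, div_le_iff₀ (by positivity)]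
  calc 3 * (((j : ℝ) + 1) * Real.log 2) ^ 2 ≤ 3 * (((j : ℝ) + 1) * 1) ^ 2 := by gcongr
    _ ≤ 1.62 ^ j := by simpa only [mul_one] using three_mul_add_one_sq_le_pow hj
    _ = (0.9 ^ j) ^ 2 * 2 ^ j := by rw [← pow_mul, mul_comm j 2, pow_mul, ← mul_pow]; norm_num

lemma one_add_log_six_mul_le {t : ℝ} (ht : 1 ≤ t) : 1 + Real.log (6 * t) ≤ 6 * √t := by
  have hsqrt : 1 ≤ √t := Real.one_le_sqrt.2 ht
  have hlog_six : Real.log 6 ≤ 5 := by linarith [Real.log_le_sub_one_of_pos (x := 6) (by norm_num)]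
  have hlog_sqrt := Real.log_sqrt (zero_le_one.trans ht)
  have hlog_le := Real.log_le_sub_one_of_pos (zero_lt_one.trans_le hsqrt)
  rw [Real.log_mul (by norm_num) (by linarith)]
  linarith

lemma mul_inv_pow_sq_le_sqrt {t : ℝ} {k : ℕ} (ht : 2 ^ (k + 50) ≤ t) :
    4908 * ((0.9 : ℝ) ^ k)⁻¹ ^ 2 ≤ √t := by
  refine Real.le_sqrt_of_sq_le (le_trans ?_ ht)
  calc (4908 * ((0.9 : ℝ) ^ k)⁻¹ ^ 2) ^ 2 = 4908 ^ 2 * (0.9⁻¹ ^ 4) ^ k := by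
        rw [mul_pow, ← pow_mul, ← inv_pow, ← pow_mul, ← pow_mul, mul_comm k]
    _ ≤ 2 ^ 50 * 2 ^ k := by gcongr <;> norm_num
    _ = 2 ^ (k + 50) := by rw [← pow_add, add_comm]

lemma log_div_le_pow {N j J : ℕ} (hjJ : j ≤ J) (hJ : 2 ^ (J + 50) ≤ N) :
    818 * ((2 : ℝ) ^ j / N * (1 + Real.log (6 * ((N : ℝ) / 2 ^ j)))) ≤
      ((0.9 : ℝ) ^ (J - j)) ^ 2 := by
  set t : ℝ := (N : ℝ) / 2 ^ j with ht
  have htwo : (2 : ℝ) ^ (J - j + 50) ≤ t := by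
    rw [ht, le_div_iff₀ (by positivity), ← pow_add, show J - j + 50 + j = J + 50 by lia]
    exact_mod_cast hJ
  have ht1 : 1 ≤ t := (one_le_pow₀ one_le_two).trans htwo
  have hsqrt : 0 < √t := Real.sqrt_pos.2 (by linarith)
  calc 818 * ((2 : ℝ) ^ j / N * (1 + Real.log (6 * t))) = 818 * (1 + Real.log (6 * t)) / t := by
        rw [ht, mul_div_assoc, div_div_eq_mul_div]
        ring
    _ ≤ 818 * (6 * √t) / t := by gcongr; exact one_add_log_six_mul_le ht1
    _ = 4908 / √t := by
        rw [← mul_assoc, mul_div_assoc, Real.sqrt_div_self', mul_one_div]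
        norm_num
    _ ≤ ((0.9 : ℝ) ^ (J - j)) ^ 2 := by
        rw [div_le_iff₀ hsqrt, ← div_le_iff₀' (by positivity), div_eq_mul_inv, ← inv_pow]
        exact mul_inv_pow_sq_le_sqrt htwo

/-- The part of the bound for `bilinearSum f N q (a / q) (dyadicPrimes j)` that does not depend
on `j`. -/
noncomputable def dyadicError (N q : ℕ) : ℝ :=
  50 * (N / √q.totient) +
    √(409 * (N * q) * ((Real.log (N / q) + 6) * (Real.log (N / q) + 1) + 6))

lemma dyadicError_nonneg (N q : ℕ) : 0 ≤ dyadicError N q := by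
  unfold dyadicError
  positivity

lemma sq_le_dyadicError_sq {N q : ℕ} (hq : 0 < q) (hqN : q ≤ N) :
    2454 * ((N : ℝ) ^ 2 / q.totient) +
      409 * (N * q) * ((Real.log (N / q) + 6) * (Real.log (N / q) + 1) + 6) ≤
        dyadicError N q ^ 2 := by
  have : 0 ≤ Real.log (N / q) :=
    Real.log_nonneg ((one_le_div (by exact_mod_cast hq)).2 (by exact_mod_cast hqN))
  have hsqrt := Real.sq_sqrt (show (0 : ℝ) ≤ 409 * (N * q) *
    ((Real.log (N / q) + 6) * (Real.log (N / q) + 1) + 6) by positivity)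
  have htotient : (50 * (N / √q.totient)) ^ 2 = 2500 * ((N : ℝ) ^ 2 / q.totient) := by
    rw [mul_pow, div_pow, Real.sq_sqrt (Nat.cast_nonneg _)]
    norm_num
  have : 0 ≤ (N : ℝ) ^ 2 / q.totient := by positivity
  rw [dyadicError, add_sq, htotient, hsqrt]
  have : 0 ≤ 50 * (N / √q.totient) *
      √(409 * (N * q) * ((Real.log (N / q) + 6) * (Real.log (N / q) + 1) + 6)) := by positivity
  linarith

lemma norm_bilinearSum_dyadic_le {f : ℕ → ℂ} {B : ℝ} (hf : ∀ n, ‖f n‖ ≤ B) {N q j J : ℕ}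
    (hq : 0 < q) (hqN : q ≤ N) (hj : 130 ≤ j) (hjJ : j ≤ J) (hJ : 2 ^ (J + 50) ≤ N)
    {a : ℤ} (ha : IsCoprime a q) :
    ‖bilinearSum f N q (a / q) (dyadicPrimes j)‖ ≤
      B ^ 2 * (N * 0.9 ^ j + N * 0.9 ^ (J - j) + dyadicError N q) := by
  have hjN : 3 * 2 ^ j ≤ N := by
    calc 3 * 2 ^ j ≤ 2 ^ (j + 2) := by lia
      _ ≤ 2 ^ (J + 50) := Nat.pow_le_pow_right two_pos (by lia)
      _ ≤ N := hJ
  set u : ℝ := N * 0.9 ^ j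
  set v : ℝ := N * 0.9 ^ (J - j)
  have hu : 0 ≤ u := by positivity
  have hv : 0 ≤ v := by positivity
  have hE := dyadicError_nonneg N q
  refine (pow_le_pow_iff_left₀ (norm_nonneg _) (by positivity) two_ne_zero).1 ?_
  rw [mul_pow, ← pow_mul]
  refine (norm_bilinearSum_dyadic_sq_le hf hq hqN hj hjN ha).trans ?_
  gcongr
  have hu_sq : 3 * (N : ℝ) ^ 2 * (Real.log (2 * 2 ^ j) ^ 2 / 2 ^ j) ≤ u ^ 2 := by
    rw [mul_pow, mul_assoc, mul_left_comm]
    gcongr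
    exact log_sq_div_two_pow_le hj
  have hv_sq : 818 * (N : ℝ) ^ 2 * ((2 : ℝ) ^ j / N * (1 + Real.log (6 * ((N : ℝ) / 2 ^ j)))) ≤
      v ^ 2 := by
    rw [mul_pow, mul_assoc, mul_left_comm]
    gcongr
    exact log_div_le_pow hjJ hJ
  have hE_sq := sq_le_dyadicError_sq hq hqN
  nlinarith [mul_nonneg hu hv, mul_nonneg hu hE, mul_nonneg hv hE]

lemma bilinearSum_union (f : ℕ → ℂ) (N : ℕ) (w θ : ℝ) {X Y : Finset ℕ} (h : Disjoint X Y) :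
    bilinearSum f N w θ (X ∪ Y) = bilinearSum f N w θ X + bilinearSum f N w θ Y := by
  simp only [bilinearSum, sum_union h, mul_add, sum_add_distrib]

lemma bilinearSum_Ioc_add (f : ℕ → ℂ) (N : ℕ) (w θ : ℝ) {x y z : ℕ} (hxy : x ≤ y) (hyz : y ≤ z) :
    bilinearSum f N w θ {p ∈ Ioc x y | p.Prime} + bilinearSum f N w θ {p ∈ Ioc y z | p.Prime} =
      bilinearSum f N w θ {p ∈ Ioc x z | p.Prime} := by
  rw [← Ioc_union_Ioc_eq_Ioc hxy hyz, filter_union, bilinearSum_union]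
  exact disjoint_filter_filter (Ioc_disjoint_Ioc_of_le le_rfl)

lemma norm_bilinearSum_Ioc_le_sum {f : ℕ → ℂ} {B : ℝ} (hf : ∀ n, ‖f n‖ ≤ B) {N q J K : ℕ}
    (hq : 0 < q) (hqN : q ≤ N) (hK : 130 ≤ K) (hKJ : K ≤ J) (hJ : 2 ^ (J + 50) ≤ N)
    {a : ℤ} (ha : IsCoprime a q) :
    ‖bilinearSum f N q (a / q) {p ∈ Ioc (2 ^ 130) (2 ^ K) | p.Prime}‖ ≤
      ∑ j ∈ Ico 130 K, B ^ 2 * (N * 0.9 ^ j + N * 0.9 ^ (J - j) + dyadicError N q) := by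
  induction K, hK using Nat.le_induction with
  | base => simp [bilinearSum]
  | succ K hK ih =>
    rw [← bilinearSum_Ioc_add f N q _ (Nat.pow_le_pow_right two_pos hK)
      (Nat.pow_le_pow_right two_pos K.le_succ), sum_Ico_succ_top hK, pow_succ' 2 K]
    exact (norm_add_le _ _).trans
      (add_le_add (ih (by lia)) (norm_bilinearSum_dyadic_le hf hq hqN hK (by lia) hJ ha))

lemma sum_Ico_pow_le (m n : ℕ) : ∑ j ∈ Ico m n, (0.9 : ℝ) ^ j ≤ 10 := by
  calc ∑ j ∈ Ico m n, (0.9 : ℝ) ^ j ≤ 0.9 ^ m / (1 - 0.9) :=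
        geom_sum_Ico_le_of_lt_one (by norm_num) (by norm_num)
    _ ≤ 1 / (1 - 0.9) := by gcongr; exact pow_le_one₀ (by norm_num) (by norm_num)
    _ ≤ 10 := by norm_num

lemma norm_bilinearSum_middle_le {f : ℕ → ℂ} {B : ℝ} (hf : ∀ n, ‖f n‖ ≤ B) {N q J : ℕ}
    (hq : 0 < q) (hqN : q ≤ N) (hJ130 : 130 ≤ J) (hJ : 2 ^ (J + 50) ≤ N)
    {a : ℤ} (ha : IsCoprime a q) :
    ‖bilinearSum f N q (a / q) {p ∈ Ioc (2 ^ 130) (2 ^ J) | p.Prime}‖ ≤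
      B ^ 2 * (20 * N + Real.log N / Real.log 2 * dyadicError N q) := by
  have hincreasing := sum_Ico_pow_le 130 J
  have hdecreasing : ∑ j ∈ Ico 130 J, (0.9 : ℝ) ^ (J - j) ≤ 10 := by
    rw [sum_Ico_reflect _ _ J.le_succ]
    exact sum_Ico_pow_le _ _
  have hcard : ((J - 130 : ℕ) : ℝ) ≤ Real.log N / Real.log 2 := by
    rw [le_div_iff₀ (Real.log_pos one_lt_two), ← Real.log_pow]
    refine Real.log_le_log (by positivity) ?_
    exact_mod_cast (Nat.pow_le_pow_right two_pos (by lia)).trans hJ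
  refine (norm_bilinearSum_Ioc_le_sum hf hq hqN hJ130 le_rfl hJ ha).trans ?_
  rw [← mul_sum, sum_add_distrib, sum_add_distrib, ← mul_sum, ← mul_sum, sum_const, nsmul_eq_mul,
    Nat.card_Ico]
  have := dyadicError_nonneg N q
  calc _ ≤ B ^ 2 * (N * 10 + N * 10 + Real.log N / Real.log 2 * dyadicError N q) := by gcongr
    _ = _ := by ring

/-! ### Small and large primes -/

lemma norm_bilinearSum_term_le {f : ℕ → ℂ} {B : ℝ} (hf : ∀ n, ‖f n‖ ≤ B) (N : ℕ) {w : ℝ}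
    (hw : 0 < w) (θ : ℝ) (m p : ℕ) :
    ‖f p * Real.log p * ramp N w (m * p) * e (m * θ * p)‖ ≤
      if m * p ≤ N then B * Real.log p else 0 := by
  have hlog : 0 ≤ Real.log p := Real.log_natCast_nonneg p
  have hramp := ramp_nonneg N w (m * p)
  rw [norm_mul, norm_e, mul_one, norm_mul, norm_mul, Complex.norm_real, Complex.norm_real,
    Real.norm_of_nonneg hlog, Real.norm_of_nonneg hramp]
  split_ifs with hmp
  · calc ‖f p‖ * Real.log p * ramp N w (m * p) ≤ ‖f p‖ * Real.log p * 1 := by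
          gcongr
          exact ramp_le_one N w (m * p)
      _ ≤ B * Real.log p := by
          rw [mul_one]
          gcongr
          exact hf p
  · rw [ramp_eq_zero hw (by exact_mod_cast (not_le.1 hmp).le), mul_zero]

lemma filter_mul_le_Icc {V N p : ℕ} (hp : 0 < p) (hV : N / p ≤ V) :
    {m ∈ Icc 1 V | m * p ≤ N} = Icc 1 (N / p) := by
  refine Finset.ext fun m => ?_
  rw [mem_filter, mem_Icc, mem_Icc, ← Nat.le_div_iff_mul_le hp]
  lia

lemma norm_bilinearSum_le {f : ℕ → ℂ} {B : ℝ} (hf : ∀ n, ‖f n‖ ≤ B) (N : ℕ) {w : ℝ} (hw : 0 < w)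
    (θ : ℝ) {X : Finset ℕ} (hX : ∀ p ∈ X, 0 < p) :
    ‖bilinearSum f N w θ X‖ ≤ B ^ 2 * ∑ p ∈ X, Real.log p * (N / p : ℕ) := by
  have hB : 0 ≤ B := (norm_nonneg _).trans (hf 0)
  calc ‖bilinearSum f N w θ X‖
      ≤ ∑ m ∈ Icc 1 N, B * ∑ p ∈ X, if m * p ≤ N then B * Real.log p else 0 := by
        refine norm_sum_le_of_le _ fun m _ => ?_
        rw [norm_mul]
        gcongr
        · exact hf m
        · exact norm_sum_le_of_le _ fun p _ => norm_bilinearSum_term_le hf N hw θ m p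
    _ = B * ∑ p ∈ X, ∑ m ∈ Icc 1 N, (if m * p ≤ N then B * Real.log p else 0) := by
        rw [← mul_sum, sum_comm]
    _ = B * ∑ p ∈ X, B * (Real.log p * (N / p : ℕ)) := by
        refine congrArg _ (sum_congr rfl fun p hp => ?_)
        rw [← sum_filter, sum_const, nsmul_eq_mul, filter_mul_le_Icc (hX p hp)
          (Nat.div_le_self N p), Nat.card_Icc, Nat.add_sub_cancel]
        ring
    _ = _ := by
        rw [← mul_sum]
        ring

lemma sum_div_le_dyadic {g : ℕ → ℝ} (hg : ∀ n, 0 ≤ g n) (K : ℕ) :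
    ∑ d ∈ Ioc 1 (2 ^ K), g d / d ≤
      ∑ j ∈ range K, (∑ d ∈ Ioc 0 (2 ^ (j + 1)), g d) / 2 ^ j := by
  induction K with
  | zero => simp
  | succ K ih =>
    rw [← sum_Ioc_consecutive _ Nat.one_le_two_pow (Nat.pow_le_pow_right two_pos K.le_succ),
      sum_range_succ]
    refine add_le_add ih ?_
    calc ∑ d ∈ Ioc (2 ^ K) (2 ^ (K + 1)), g d / d
        ≤ ∑ d ∈ Ioc (2 ^ K) (2 ^ (K + 1)), g d / 2 ^ K := by
          refine sum_le_sum fun d hd => div_le_div_of_nonneg_left (hg d) (by positivity) ?_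
          exact_mod_cast (mem_Ioc.1 hd).1.le
      _ ≤ ∑ d ∈ Ioc 0 (2 ^ (K + 1)), g d / 2 ^ K :=
          sum_le_sum_of_subset_of_nonneg (Ioc_subset_Ioc_left (Nat.zero_le _))
            fun d _ _ => div_nonneg (hg d) (by positivity)
      _ = _ := (sum_div _ _ _).symm

lemma log_four : Real.log 4 = 2 * Real.log 2 := by
  rw [show (4 : ℝ) = 2 ^ 2 by norm_num, Real.log_pow, Nat.cast_two]

lemma sum_log_prime_le (n : ℕ) : ∑ p ∈ Ioc 0 n with p.Prime, Real.log p ≤ Real.log 4 * n := by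
  have htheta := Chebyshev.theta_le_log4_mul_x (x := n) (Nat.cast_nonneg n)
  rwa [Chebyshev.theta, Nat.floor_natCast] at htheta

lemma sum_log_prime_div_le (K : ℕ) :
    ∑ p ∈ Ioc 1 (2 ^ K : ℕ) with p.Prime, Real.log p / p ≤ 2 * Real.log 4 * K := by
  set g : ℕ → ℝ := fun d => if d.Prime then Real.log d else 0
  have hg : ∀ n, 0 ≤ g n := fun n => ite_nonneg (Real.log_natCast_nonneg n) le_rfl
  calc ∑ p ∈ Ioc 1 (2 ^ K : ℕ) with p.Prime, Real.log p / p = ∑ d ∈ Ioc 1 (2 ^ K), g d / d := by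
        simp only [sum_filter, g, ite_div, zero_div]
    _ ≤ ∑ j ∈ range K, (∑ d ∈ Ioc 0 (2 ^ (j + 1)), g d) / 2 ^ j := sum_div_le_dyadic hg K
    _ ≤ ∑ _j ∈ range K, 2 * Real.log 4 := by
        refine sum_le_sum fun j _ => ?_
        rw [div_le_iff₀ (by positivity), ← sum_filter]
        refine (sum_log_prime_le _).trans_eq ?_
        push_cast
        ring
    _ = 2 * Real.log 4 * K := by rw [sum_const, card_range, nsmul_eq_mul, mul_comm]

lemma norm_bilinearSum_low_le {f : ℕ → ℂ} {B : ℝ} (hf : ∀ n, ‖f n‖ ≤ B) (N K : ℕ) {w : ℝ}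
    (hw : 0 < w) (θ : ℝ) :
    ‖bilinearSum f N w θ {p ∈ Ioc 1 (2 ^ K) | p.Prime}‖ ≤ B ^ 2 * (2 * Real.log 4 * K * N) := by
  refine (norm_bilinearSum_le hf N hw θ fun p hp => (mem_filter.1 hp).2.pos).trans ?_
  gcongr
  calc ∑ p ∈ Ioc 1 (2 ^ K : ℕ) with p.Prime, Real.log p * (N / p : ℕ)
      ≤ ∑ p ∈ Ioc 1 (2 ^ K : ℕ) with p.Prime, Real.log p * (N / p) := by
        gcongr
        exact Nat.cast_div_le
    _ = (∑ p ∈ Ioc 1 (2 ^ K : ℕ) with p.Prime, Real.log p / p) * N := by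
        rw [sum_mul]
        exact sum_congr rfl fun p _ => by ring
    _ ≤ 2 * Real.log 4 * K * N := by
        gcongr
        exact sum_log_prime_div_le K

lemma sum_log_mul_div_le {P N : ℕ} (hP : 0 < P) :
    ∑ p ∈ Ioc P N with p.Prime, Real.log p * (N / p : ℕ) ≤
      Real.log 4 * N * (1 + Real.log (N / P : ℕ)) := by
  have : 0 ≤ Real.log 4 := Real.log_nonneg (by norm_num)
  calc ∑ p ∈ Ioc P N with p.Prime, Real.log p * (N / p : ℕ)
      = ∑ p ∈ Ioc P N with p.Prime, ∑ m ∈ Icc 1 (N / P), if m * p ≤ N then Real.log p else 0 := by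
        refine sum_congr rfl fun p hp => ?_
        rw [mem_filter, mem_Ioc] at hp
        rw [← sum_filter, sum_const, nsmul_eq_mul, mul_comm,
          filter_mul_le_Icc hp.2.pos (Nat.div_le_div_left hp.1.1.le hP), Nat.card_Icc,
          Nat.add_sub_cancel]
    -- Chebyshev's bound over `p ≤ N / m` leaves a harmonic sum over `m`.
    _ = ∑ m ∈ Icc 1 (N / P), ∑ p ∈ Ioc P N with p.Prime, if m * p ≤ N then Real.log p else 0 :=
        sum_comm
    _ ≤ ∑ m ∈ Icc 1 (N / P), Real.log 4 * N * (1 / m) := by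
        refine sum_le_sum fun m hm => ?_
        have hsubset : {p ∈ {p ∈ Ioc P N | p.Prime} | m * p ≤ N} ⊆
            {p ∈ Ioc 0 (N / m) | p.Prime} := by
          intro p hp
          rw [mem_filter, mem_filter] at hp
          rw [mem_filter, mem_Ioc, Nat.le_div_iff_mul_le (mem_Icc.1 hm).1, mul_comm p]
          exact ⟨⟨hp.1.2.pos, hp.2⟩, hp.1.2⟩
        rw [← sum_filter, mul_assoc, mul_one_div]
        calc _ ≤ ∑ p ∈ Ioc 0 (N / m) with p.Prime, Real.log p :=
              sum_le_sum_of_subset_of_nonneg hsubset fun p _ _ => Real.log_natCast_nonneg p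
          _ ≤ Real.log 4 * (N / m : ℕ) := sum_log_prime_le _
          _ ≤ Real.log 4 * (N / m) := by gcongr; exact Nat.cast_div_le
    _ ≤ Real.log 4 * N * (1 + Real.log (N / P : ℕ)) := by
        rw [← mul_sum]
        gcongr
        exact sum_one_div_le_one_add_log _

lemma norm_bilinearSum_high_le {f : ℕ → ℂ} {B : ℝ} (hf : ∀ n, ‖f n‖ ≤ B) {N J k : ℕ}
    (hNJ : N < 2 ^ (J + k)) {w : ℝ} (hw : 0 < w) (θ : ℝ) :
    ‖bilinearSum f N w θ {p ∈ Ioc (2 ^ J) N | p.Prime}‖ ≤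
      B ^ 2 * (Real.log 4 * N * (1 + k * Real.log 2)) := by
  refine (norm_bilinearSum_le hf N hw θ fun p hp => (mem_filter.1 hp).2.pos).trans ?_
  have : 0 < Real.log 4 := Real.log_pos (by norm_num)
  gcongr
  refine (sum_log_mul_div_le (Nat.two_pow_pos J)).trans ?_
  gcongr
  rw [← Real.log_pow]
  rcases (N / 2 ^ J).eq_zero_or_pos with hzero | hpos
  · rw [hzero, Nat.cast_zero, Real.log_zero]
    exact Real.log_nonneg (one_le_pow₀ one_le_two)
  · refine Real.log_le_log (by exact_mod_cast hpos) ?_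
    exact_mod_cast Nat.div_le_of_le_mul (by rw [← pow_add]; exact hNJ.le)

/-! ### Proper prime powers -/

open ArithmeticFunction

lemma BoundedMultiplicative.one_le {B : ℝ} {f : ArithmeticFunction ℂ}
    (hf : BoundedMultiplicative B f) : 1 ≤ B := by
  simpa only [hf.1.map_one, norm_one] using hf.2 1

/-- The von Mangoldt function restricted to the prime powers that are not prime. -/
noncomputable def properVonMangoldt (d : ℕ) : ℝ := if d.Prime then 0 else vonMangoldt d

lemma properVonMangoldt_nonneg (d : ℕ) : 0 ≤ properVonMangoldt d :=
  ite_nonneg le_rfl vonMangoldt_nonneg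

lemma properVonMangoldt_sq {p : ℕ} (hp : p.Prime) : properVonMangoldt (p ^ 2) = Real.log p := by
  rw [properVonMangoldt, if_neg (Nat.Prime.not_prime_pow le_rfl), vonMangoldt_apply_pow two_ne_zero,
    vonMangoldt_apply_prime hp]

/-- The part of `log n` coming from the divisors of `n` that are proper prime powers. -/
noncomputable def properPowerLog (n : ℕ) : ℝ := ∑ d ∈ n.divisors, properVonMangoldt d

lemma properPowerLog_nonneg (n : ℕ) : 0 ≤ properPowerLog n :=
  sum_nonneg fun d _ => properVonMangoldt_nonneg d

lemma sum_log_primeFactors_add_properPowerLog (n : ℕ) :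
    ∑ p ∈ n.primeFactors, Real.log p + properPowerLog n = Real.log n := by
  have hprimeFactors : n.primeFactors = {d ∈ n.divisors | d.Prime} := by
    refine Finset.ext fun p => ?_
    rw [Nat.mem_primeFactors, mem_filter, Nat.mem_divisors]
    tauto
  rw [← vonMangoldt_sum, properPowerLog, hprimeFactors, sum_filter, ← sum_add_distrib]
  refine sum_congr rfl fun d _ => ?_
  rw [properVonMangoldt]
  split_ifs with hd
  · rw [vonMangoldt_apply_prime hd, add_zero]
  · rw [zero_add]

lemma sum_log_sq_dvd_le {n : ℕ} (hn : n ≠ 0) :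
    ∑ p ∈ n.primeFactors with p ^ 2 ∣ n, Real.log p ≤ properPowerLog n := by
  set X := {p ∈ n.primeFactors | p ^ 2 ∣ n}
  calc ∑ p ∈ X, Real.log p = ∑ p ∈ X, properVonMangoldt (p ^ 2) :=
        sum_congr rfl fun p hp =>
          (properVonMangoldt_sq (Nat.prime_of_mem_primeFactors (mem_filter.1 hp).1)).symm
    _ = ∑ d ∈ X.image (· ^ 2), properVonMangoldt d :=
        (sum_image fun p _ p' _ h => Nat.pow_left_injective two_ne_zero h).symm
    _ ≤ properPowerLog n := by
        refine sum_le_sum_of_subset_of_nonneg (fun d hd => ?_) fun d _ _ =>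
          properVonMangoldt_nonneg d
        obtain ⟨p, hp, rfl⟩ := mem_image.1 hd
        exact Nat.mem_divisors.2 ⟨(mem_filter.1 hp).2, hn⟩

lemma sum_succ_mul_pow_le (K : ℕ) : ∑ j ∈ range K, ((j : ℝ) + 1) * (3 / 4) ^ j ≤ 16 := by
  have hclosed : ∑ j ∈ range K, ((j : ℝ) + 1) * (3 / 4) ^ j =
      16 - (16 + 4 * K) * (3 / 4) ^ K := by
    induction K with
    | zero => simp
    | succ K ih =>
      rw [sum_range_succ, ih, pow_succ]
      push_cast
      ring
  rw [hclosed]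
  exact sub_le_self _ (by positivity)

lemma sum_properVonMangoldt_le {n : ℕ} (hn : n ≠ 0) :
    ∑ d ∈ Ioc 0 n, properVonMangoldt d ≤ 2 * √n * Real.log n := by
  have hpsi := Chebyshev.psi_sub_theta_le (x := n) (by exact_mod_cast Nat.one_le_iff_ne_zero.2 hn)
  rw [Chebyshev.psi_sub_theta_eq_sum_not_prime, Nat.floor_natCast, sum_filter] at hpsi
  simpa only [properVonMangoldt, ite_not] using hpsi

lemma sqrt_two_pow_succ_le (j : ℕ) : √((2 : ℝ) ^ (j + 1)) ≤ 1.4143 * (3 / 2) ^ j := by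
  rw [Real.sqrt_le_left (by positivity)]
  calc (2 : ℝ) ^ (j + 1) = 2 * 2 ^ j := pow_succ' 2 j
    _ ≤ 1.4143 ^ 2 * ((3 / 2) ^ 2) ^ j := by gcongr <;> norm_num
    _ = (1.4143 * (3 / 2) ^ j) ^ 2 := by rw [mul_pow, ← pow_mul, ← pow_mul, mul_comm 2 j]

lemma sum_properVonMangoldt_div_two_pow_le (j : ℕ) :
    (∑ d ∈ Ioc 0 (2 ^ (j + 1)), properVonMangoldt d) / 2 ^ j ≤ 2 * ((j + 1) * (3 / 4) ^ j) := by
  have hlog_two : Real.log 2 ≤ 0.7 := by linarith [Real.log_two_lt_d9]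
  rw [div_le_iff₀ (by positivity)]
  calc ∑ d ∈ Ioc 0 (2 ^ (j + 1)), properVonMangoldt d
      ≤ 2 * √(2 ^ (j + 1)) * ((j + 1) * Real.log 2) := by
        simpa using sum_properVonMangoldt_le (Nat.two_pow_pos (j + 1)).ne'
    _ ≤ 2 * (1.4143 * (3 / 2) ^ j) * ((j + 1) * 0.7) := by
        gcongr
        exact sqrt_two_pow_succ_le j
    _ = (2 * 1.4143 * 0.7) * ((j + 1) * (3 / 2) ^ j) := by ring
    _ ≤ 2 * ((j + 1) * (3 / 2) ^ j) := by gcongr; norm_num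
    _ = 2 * ((j + 1) * (3 / 4) ^ j) * 2 ^ j := by
        rw [mul_assoc 2, mul_assoc, ← mul_pow]
        norm_num

lemma sum_properVonMangoldt_div_le (n : ℕ) : ∑ d ∈ Icc 1 n, properVonMangoldt d / d ≤ 32 := by
  have hsubset : Icc 1 n ⊆ insert 1 (Ioc 1 (2 ^ n)) := by
    intro d hd
    rw [mem_Icc] at hd
    rw [mem_insert, mem_Ioc]
    have := (Nat.lt_two_pow_self (n := n)).le
    lia
  calc ∑ d ∈ Icc 1 n, properVonMangoldt d / d
      ≤ ∑ d ∈ insert 1 (Ioc 1 (2 ^ n)), properVonMangoldt d / d :=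
        sum_le_sum_of_subset_of_nonneg hsubset fun d _ _ =>
          div_nonneg (properVonMangoldt_nonneg d) (Nat.cast_nonneg d)
    _ = ∑ d ∈ Ioc 1 (2 ^ n), properVonMangoldt d / d := by
        rw [sum_insert (by simp), properVonMangoldt, if_neg Nat.not_prime_one,
          vonMangoldt_apply_one, zero_div, zero_add]
    _ ≤ ∑ j ∈ range n, (∑ d ∈ Ioc 0 (2 ^ (j + 1)), properVonMangoldt d) / 2 ^ j :=
        sum_div_le_dyadic properVonMangoldt_nonneg n
    _ ≤ ∑ j ∈ range n, 2 * (((j : ℝ) + 1) * (3 / 4) ^ j) :=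
        sum_le_sum fun j _ => sum_properVonMangoldt_div_two_pow_le j
    _ = 2 * ∑ j ∈ range n, ((j : ℝ) + 1) * (3 / 4) ^ j := by rw [mul_sum]
    _ ≤ 32 := by linarith [sum_succ_mul_pow_le n]

lemma sum_properPowerLog_le (N : ℕ) : ∑ n ∈ Icc 1 N, properPowerLog n ≤ 32 * N := by
  calc ∑ n ∈ Icc 1 N, properPowerLog n = ∑ d ∈ Icc 1 N, properVonMangoldt d * (N / d : ℕ) := by
        have hswap := sum_sum_divisors_mul N properVonMangoldt fun _ => 1
        simpa only [properPowerLog, mul_one, sum_const, nsmul_eq_mul, Nat.card_Icc,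
          Nat.add_sub_cancel] using hswap
    _ ≤ ∑ d ∈ Icc 1 N, properVonMangoldt d * (N / d) := by
        gcongr
        · exact properVonMangoldt_nonneg _
        · exact Nat.cast_div_le
    _ = (∑ d ∈ Icc 1 N, properVonMangoldt d / d) * N := by
        rw [sum_mul]
        exact sum_congr rfl fun d _ => by ring
    _ ≤ 32 * N := by
        gcongr
        exact sum_properVonMangoldt_div_le N

section Multiplicative

variable {B : ℝ} {f : ArithmeticFunction ℂ}

lemma norm_sub_mul_mul_log_le (hf : BoundedMultiplicative B f) {n p : ℕ}
    (hp : p ∈ n.primeFactors) :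
    ‖(f n - f (n / p) * f p) * (Real.log p : ℂ)‖ ≤
      if p ^ 2 ∣ n then 2 * B ^ 2 * Real.log p else 0 := by
  have hB := hf.one_le
  have hdvd := Nat.dvd_of_mem_primeFactors hp
  split_ifs with hsq
  · rw [norm_mul, Complex.norm_real, Real.norm_of_nonneg (Real.log_natCast_nonneg p)]
    gcongr
    calc ‖f n - f (n / p) * f p‖ ≤ ‖f n‖ + ‖f (n / p)‖ * ‖f p‖ := by
          rw [← norm_mul]
          exact norm_sub_le _ _
      _ ≤ B + B * B := by gcongr <;> exact hf.2 _
      _ ≤ 2 * B ^ 2 := by nlinarith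
  · have hcoprime : (n / p).Coprime p := by
      refine (((Nat.prime_of_mem_primeFactors hp).coprime_iff_not_dvd).2 fun hd => hsq ?_).symm
      rw [sq]
      exact (Nat.dvd_div_iff_mul_dvd hdvd).1 hd
    rw [← hf.1.map_mul_of_coprime hcoprime, Nat.div_mul_cancel hdvd, sub_self, zero_mul, norm_zero]

lemma norm_mul_log_sub_sum_le (hf : BoundedMultiplicative B f) {n : ℕ} (hn : n ≠ 0) :
    ‖f n * (Real.log n : ℂ) - ∑ p ∈ n.primeFactors, f (n / p) * (f p * (Real.log p : ℂ))‖ ≤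
      3 * B ^ 2 * properPowerLog n := by
  have hB := hf.one_le
  have hnonneg := properPowerLog_nonneg n
  have hdecomp :
      f n * (Real.log n : ℂ) - ∑ p ∈ n.primeFactors, f (n / p) * (f p * (Real.log p : ℂ)) =
        ∑ p ∈ n.primeFactors, (f n - f (n / p) * f p) * (Real.log p : ℂ) +
          f n * (properPowerLog n : ℂ) := by
    rw [← sum_log_primeFactors_add_properPowerLog n]
    push_cast
    rw [mul_add, mul_sum, add_sub_right_comm, ← sum_sub_distrib]
    exact congrArg (· + _) (sum_congr rfl fun p _ => by ring)
  have hprimes : ‖∑ p ∈ n.primeFactors, (f n - f (n / p) * f p) * (Real.log p : ℂ)‖ ≤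
      2 * B ^ 2 * properPowerLog n := by
    refine (norm_sum_le_of_le _ fun p hp => norm_sub_mul_mul_log_le hf hp).trans ?_
    rw [← sum_filter, ← mul_sum]
    gcongr
    exact sum_log_sq_dvd_le hn
  have hpowers : ‖f n * (properPowerLog n : ℂ)‖ ≤ B ^ 2 * properPowerLog n := by
    rw [norm_mul, Complex.norm_real, Real.norm_of_nonneg hnonneg]
    gcongr
    exact (hf.2 n).trans (le_self_pow₀ hB two_ne_zero)
  rw [hdecomp]
  linarith [norm_add_le (∑ p ∈ n.primeFactors, (f n - f (n / p) * f p) * (Real.log p : ℂ))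
    (f n * (properPowerLog n : ℂ))]

end Multiplicative

/-! ### Smoothing -/

/-- The exponential sum `∑ n ≤ N, g n * e (n θ)` with its cutoff at `N` smoothed to a ramp of
width `w`. -/
noncomputable def smoothSum (g : ℕ → ℂ) (N : ℕ) (w θ : ℝ) : ℂ :=
  ∑ n ∈ Icc 1 N, g n * (ramp N w n * e (n * θ))

lemma smoothSum_sub (g h : ℕ → ℂ) (N : ℕ) (w θ : ℝ) :
    smoothSum (fun n => g n - h n) N w θ = smoothSum g N w θ - smoothSum h N w θ := by
  simp only [smoothSum, sub_mul, sum_sub_distrib]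

lemma smoothSum_mul_const (g : ℕ → ℂ) (N : ℕ) (w θ : ℝ) (c : ℂ) :
    smoothSum (fun n => g n * c) N w θ = smoothSum g N w θ * c := by
  simp only [smoothSum, sum_mul, mul_right_comm]

lemma norm_smoothSum_le {g : ℕ → ℂ} {G : ℕ → ℝ} {N : ℕ} (hg : ∀ n ∈ Icc 1 N, ‖g n‖ ≤ G n)
    (w θ : ℝ) : ‖smoothSum g N w θ‖ ≤ ∑ n ∈ Icc 1 N, G n := by
  refine norm_sum_le_of_le _ fun n hn => ?_
  rw [norm_mul, norm_mul, norm_e, mul_one, Complex.norm_real, Real.norm_of_nonneg (ramp_nonneg ..)]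
  exact (mul_le_of_le_one_right (norm_nonneg _) (ramp_le_one ..)).trans (hg n hn)

lemma primeFactors_eq_filter_Ioc {n N : ℕ} (hn : n ∈ Icc 1 N) :
    n.primeFactors = {p ∈ {p ∈ Ioc 1 N | p.Prime} | p ∣ n} := by
  rw [mem_Icc] at hn
  ext p
  simp only [Nat.mem_primeFactors, mem_filter, mem_Ioc]
  constructor
  · rintro ⟨hp, hdvd, _⟩
    exact ⟨⟨⟨hp.one_lt, (Nat.le_of_dvd hn.1 hdvd).trans hn.2⟩, hp⟩, hdvd⟩
  · rintro ⟨⟨_, hp⟩, hdvd⟩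
    exact ⟨hp, hdvd, by lia⟩

lemma sum_multiples_mul_ramp_eq (g : ℕ → ℂ) (N : ℕ) {w : ℝ} (hw : 0 < w) {p : ℕ} (hp : 0 < p) :
    ∑ n ∈ Icc 1 N with p ∣ n, g (n / p) * ramp N w n = ∑ m ∈ Icc 1 N, g m * ramp N w (m * p) := by
  rw [sum_filter_dvd_Icc N hp]
  simp only [Nat.mul_div_cancel _ hp, Nat.cast_mul]
  refine sum_subset (Icc_subset_Icc_right (Nat.div_le_self N p)) fun m hm hm' => ?_
  have hlt : N / p < m := by
    rw [mem_Icc] at hm hm'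
    lia
  have hle : N ≤ m * p := ((Nat.div_lt_iff_lt_mul hp).1 hlt).le
  rw [ramp_eq_zero hw (by exact_mod_cast hle), Complex.ofReal_zero, mul_zero]

lemma smoothSum_primeFactors_eq_bilinearSum (f : ℕ → ℂ) (N : ℕ) {w : ℝ} (hw : 0 < w) (θ : ℝ) :
    smoothSum (fun n => ∑ p ∈ n.primeFactors, f (n / p) * (f p * (Real.log p : ℂ))) N w θ =
      bilinearSum f N w θ {p ∈ Ioc 1 N | p.Prime} := by
  set g : ℕ → ℕ → ℂ := fun p m => f m * (f p * (Real.log p : ℂ)) * e (m * θ * p) with hg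
  calc _ = ∑ n ∈ Icc 1 N, ∑ p ∈ Ioc 1 N with p.Prime,
        if p ∣ n then g p (n / p) * ramp N w n else 0 := by
        refine sum_congr rfl fun n hn => ?_
        beta_reduce
        rw [primeFactors_eq_filter_Ioc hn, ← sum_filter, sum_mul]
        refine sum_congr rfl fun p hp => ?_
        have hcancel : ((n / p : ℕ) : ℝ) * p = n := by
          exact_mod_cast Nat.div_mul_cancel (mem_filter.1 hp).2
        simp only [hg]
        rw [mul_right_comm _ θ, hcancel]
        ring
    _ = ∑ p ∈ Ioc 1 N with p.Prime, ∑ m ∈ Icc 1 N, g p m * ramp N w (m * p) := by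
        rw [sum_comm]
        refine sum_congr rfl fun p hp => ?_
        rw [← sum_filter, sum_multiples_mul_ramp_eq (g p) N hw (mem_filter.1 hp).2.pos]
    _ = bilinearSum f N w θ {p ∈ Ioc 1 N | p.Prime} := by
        rw [bilinearSum, sum_comm]
        refine sum_congr rfl fun m _ => ?_
        rw [mul_sum]
        exact sum_congr rfl fun p _ => by ring

lemma log_factorial_eq_sum (N : ℕ) : Real.log N.factorial = ∑ n ∈ Icc 1 N, Real.log n := by
  induction N with
  | zero => simp
  | succ N ih =>
    rw [sum_Icc_succ_top (by lia), ← ih, Nat.factorial_succ, Nat.cast_mul,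
      Real.log_mul (by positivity) (by positivity), add_comm]

lemma sum_log_sub_log_le {N : ℕ} (hN : 0 < N) :
    ∑ n ∈ Icc 1 N, (Real.log N - Real.log n) ≤ N := by
  have hexp : (N : ℝ) ^ N / N.factorial ≤ Real.exp N :=
    Real.pow_div_factorial_le_exp N N.cast_nonneg N
  have hlog := Real.log_le_log (by positivity) hexp
  rw [Real.log_exp, Real.log_div (by positivity) (by positivity), Real.log_pow,
    log_factorial_eq_sum] at hlog
  rwa [sum_sub_distrib, sum_const, nsmul_eq_mul, Nat.card_Icc, Nat.add_sub_cancel]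

lemma norm_sum_sub_smoothSum_le {f : ℕ → ℂ} {B : ℝ} (hf : ∀ n, ‖f n‖ ≤ B) (N : ℕ) {q : ℕ}
    (hq : 0 < q) (θ : ℝ) :
    ‖∑ n ∈ Icc 1 N, f n * e (n * θ) - smoothSum f N q θ‖ ≤ B * q := by
  have hB : 0 ≤ B := (norm_nonneg _).trans (hf 0)
  have hcard : #{n ∈ Icc 1 N | N - q < n} ≤ q := by
    have hsub : {n ∈ Icc 1 N | N - q < n} ⊆ Ioc (N - q) N := by
      intro n hn
      rw [mem_filter, mem_Icc] at hn
      exact mem_Ioc.2 ⟨hn.2, hn.1.2⟩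
    have := card_le_card hsub
    rw [Nat.card_Ioc] at this
    lia
  have hterm : ∀ n ∈ Icc 1 N,
      ‖f n * e (n * θ) - f n * (ramp N q n * e (n * θ))‖ ≤ if N - q < n then B else 0 := by
    intro n hn
    have hfactor : f n * e (n * θ) - f n * (ramp N q n * e (n * θ)) =
        f n * (((1 - ramp N q n : ℝ) : ℂ) * e (n * θ)) := by
      push_cast
      ring
    rw [hfactor, norm_mul, norm_mul, norm_e, mul_one, Complex.norm_real,
      Real.norm_of_nonneg (sub_nonneg.2 (ramp_le_one ..))]
    split_ifs with hlt
    · exact (mul_le_of_le_one_right (norm_nonneg _)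
        (sub_le_self 1 (ramp_nonneg ..))).trans (hf n)
    · have := (mem_Icc.1 hn).1
      have : (n : ℝ) + q ≤ N := by exact_mod_cast (by lia : n + q ≤ N)
      rw [ramp_eq_one (Nat.cast_pos.2 hq) (by linarith), sub_self, mul_zero]
  rw [smoothSum, ← sum_sub_distrib]
  calc _ ≤ ∑ n ∈ Icc 1 N, if N - q < n then B else 0 := norm_sum_le_of_le _ hterm
    _ = B * #{n ∈ Icc 1 N | N - q < n} := by rw [← sum_filter, sum_const, nsmul_eq_mul, mul_comm]
    _ ≤ B * q := by gcongr

lemma norm_smoothSum_mul_log_sub_le {f : ℕ → ℂ} {B : ℝ} (hf : ∀ n, ‖f n‖ ≤ B) {N : ℕ}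
    (hN : 0 < N) (w θ : ℝ) :
    ‖smoothSum f N w θ * (Real.log N : ℂ) - smoothSum (fun n => f n * (Real.log n : ℂ)) N w θ‖ ≤
      B * N := by
  have hB : 0 ≤ B := (norm_nonneg _).trans (hf 0)
  rw [← smoothSum_mul_const, ← smoothSum_sub]
  calc _ ≤ ∑ n ∈ Icc 1 N, B * (Real.log N - Real.log n) := by
        refine norm_smoothSum_le (fun n hn => ?_) w θ
        rw [mem_Icc] at hn
        have hlog : Real.log n ≤ Real.log N :=
          Real.log_le_log (by exact_mod_cast hn.1) (by exact_mod_cast hn.2)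
        rw [← mul_sub, ← Complex.ofReal_sub, norm_mul, Complex.norm_real,
          Real.norm_of_nonneg (sub_nonneg.2 hlog)]
        exact mul_le_mul_of_nonneg_right (hf n) (sub_nonneg.2 hlog)
    _ = B * ∑ n ∈ Icc 1 N, (Real.log N - Real.log n) := by rw [mul_sum]
    _ ≤ B * N := by
        gcongr
        exact sum_log_sub_log_le hN

section Multiplicative

variable {B : ℝ} {f : ArithmeticFunction ℂ}

lemma norm_smoothSum_mul_log_sub_bilinearSum_le (hf : BoundedMultiplicative B f) (N : ℕ) {w : ℝ}
    (hw : 0 < w) (θ : ℝ) :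
    ‖smoothSum (fun n => f n * (Real.log n : ℂ)) N w θ -
      bilinearSum f N w θ {p ∈ Ioc 1 N | p.Prime}‖ ≤ 96 * B ^ 2 * N := by
  rw [← smoothSum_primeFactors_eq_bilinearSum _ N hw, ← smoothSum_sub]
  calc _ ≤ ∑ n ∈ Icc 1 N, 3 * B ^ 2 * properPowerLog n :=
        norm_smoothSum_le (fun n hn => norm_mul_log_sub_sum_le hf (by grind)) w θ
    _ = 3 * B ^ 2 * ∑ n ∈ Icc 1 N, properPowerLog n := by rw [mul_sum]
    _ ≤ 3 * B ^ 2 * (32 * N) := by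
        gcongr
        exact sum_properPowerLog_le N
    _ = 96 * B ^ 2 * N := by ring

lemma norm_S_mul_log_le (hf : BoundedMultiplicative B f) {N q : ℕ} (hN : 0 < N) (hq : 0 < q)
    (θ : ℝ) :
    ‖S f N θ‖ * Real.log N ≤ B * q * Real.log N + 97 * B ^ 2 * N +
      ‖bilinearSum f N q θ {p ∈ Ioc 1 N | p.Prime}‖ := by
  have hB := hf.one_le
  have hsmooth : ‖S f N θ‖ ≤ B * q + ‖smoothSum f N q θ‖ := by
    have htriangle := norm_le_norm_sub_add (S f N θ) (smoothSum f N q θ)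
    have hdiff : ‖S f N θ - smoothSum f N q θ‖ ≤ B * q := norm_sum_sub_smoothSum_le hf.2 N hq θ
    linarith
  have hlog : ‖smoothSum f N q θ‖ * Real.log N ≤
      B * N + 96 * B ^ 2 * N + ‖bilinearSum f N q θ {p ∈ Ioc 1 N | p.Prime}‖ := by
    have hnorm : ‖smoothSum f N q θ * (Real.log N : ℂ)‖ = ‖smoothSum f N q θ‖ * Real.log N := by
      rw [norm_mul, Complex.norm_real, Real.norm_of_nonneg (Real.log_natCast_nonneg N)]
    have hsub := norm_smoothSum_mul_log_sub_le hf.2 hN q θ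
    have hbil := norm_smoothSum_mul_log_sub_bilinearSum_le hf N (Nat.cast_pos.2 hq) θ
    have hdrop := norm_le_norm_sub_add (smoothSum f N q θ * (Real.log N : ℂ))
      (smoothSum (fun n => f n * (Real.log n : ℂ)) N q θ)
    have hdrop' := norm_le_norm_sub_add (smoothSum (fun n => f n * (Real.log n : ℂ)) N q θ)
      (bilinearSum f N q θ {p ∈ Ioc 1 N | p.Prime})
    linarith
  calc ‖S f N θ‖ * Real.log N ≤ (B * q + ‖smoothSum f N q θ‖) * Real.log N := by gcongr
    _ = B * q * Real.log N + ‖smoothSum f N q θ‖ * Real.log N := by ring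
    _ ≤ B * q * Real.log N + (B * N + 96 * B ^ 2 * N +
          ‖bilinearSum f N q θ {p ∈ Ioc 1 N | p.Prime}‖) := by gcongr
    _ ≤ B * q * Real.log N + (B ^ 2 * N + 96 * B ^ 2 * N +
          ‖bilinearSum f N q θ {p ∈ Ioc 1 N | p.Prime}‖) := by
        gcongr
        exact le_self_pow₀ hB two_ne_zero
    _ = _ := by ring

end Multiplicative

/-! ### The constants -/

lemma one_le_eulerFactor {p : ℕ} (hp : 2 < p) : 1 ≤ eulerFactor p := by
  have hp3 : (3 : ℝ) ≤ p := by exact_mod_cast hp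
  have hfactor : (p : ℝ) ^ 3 - (p : ℝ) ^ 2 - 2 * p = p * ((p - 2) * (p + 1)) := by ring
  have : (0 : ℝ) < (p : ℝ) - 2 := by linarith
  rw [eulerFactor, hfactor]
  exact le_add_of_nonneg_right (by positivity)

lemma le_z : 11.31 ≤ z := by
  have hprod : 1 ≤ ∏' p : {p : ℕ // p.Prime ∧ 2 < p}, eulerFactor p :=
    ge_of_tendsto' multipliable_eulerFactor.hasProd fun s =>
      s.prod_const_one.symm.trans_le <|
        prod_le_prod (fun _ _ => zero_le_one) fun p _ => one_le_eulerFactor p.2.2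
  have hsqrt : 1.41375 ≤ √(2 * ∏' p : {p : ℕ // p.Prime ∧ 2 < p}, eulerFactor p) :=
    Real.le_sqrt_of_sq_le (by norm_num; linarith)
  unfold z
  linarith

lemma le_b₁ {B E : ℝ} (hB : 1 ≤ B) (hE : 4 ≤ E) : 685 * B ^ 2 ≤ b₁ B E := by
  have := le_z
  calc 685 * B ^ 2
      ≤ B ^ 2 * (9.82 + 8.12 * (1.59 + 11.31) * 4 + 18.9 * (11.31 * 0.96) + 3.46 * 1.59 +
          4.06 * 11.31) := by nlinarith
    _ ≤ B ^ 2 * (9.82 + 8.12 * (1.59 + z) * E + 18.9 * (z * 0.96) + 3.46 * 1.59 + 4.06 * z) := by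
        gcongr
    _ ≤ B + B ^ 2 *
          (9.82 + 8.12 * (1.59 + z) * E + 18.9 * (z * 0.96) + 3.46 * 1.59 + 4.06 * z) :=
        le_add_of_nonneg_left (zero_le_one.trans hB)
    _ = b₁ B E := by
        unfold b₁ a₁ a₃ a₄
        ring

lemma le_b₂ (B : ℝ) {E : ℝ} (hE : 4 ≤ E) : B ^ 2 / Real.log 2 * 50 ≤ b₂ B E := by
  have := le_z
  have hpi : 1.5 ≤ Real.pi ^ 2 / 6 := by nlinarith [Real.pi_gt_three]
  have hsqrt : 1 ≤ √2 := Real.one_le_sqrt.2 one_le_two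
  calc B ^ 2 / Real.log 2 * 50 = B ^ 2 * (50 / Real.log 2) := by ring
    _ ≤ B ^ 2 * (11.31 * 1.5 * (1 * 4 + 1) / Real.log 2) := by
        gcongr
        norm_num
    _ ≤ B ^ 2 * (z * (Real.pi ^ 2 / 6) * (√2 * E + 1) / Real.log 2) := by gcongr
    _ = b₂ B E := by
        unfold b₂ a₂
        ring

lemma log_four_gt : 1.386 < Real.log 4 := by
  rw [log_four]
  linarith [Real.log_two_gt_d9]

lemma rpow_three_halves_eq {x : ℝ} (hx : 0 ≤ x) : x ^ (3 / 2 : ℝ) = x * √x := by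
  rw [Real.sqrt_eq_rpow, ← Real.rpow_one_add' hx (by norm_num)]
  norm_num

lemma log_le_sqrt {x : ℝ} (hx : 0 < x) : Real.log x ≤ √x := by
  have hlog : Real.log (√x / 2) ≤ √x / 2 - 1 := Real.log_le_sub_one_of_pos (by positivity)
  rw [Real.log_div (by positivity) two_ne_zero, Real.log_sqrt hx.le] at hlog
  linarith [Real.log_two_lt_d9]

/-- The factor of `b₃` which does not depend on `B` or `R`; it is negative for large `E`. -/
noncomputable def signedFactor (E q : ℝ) : ℝ :=
  7.63 / √E * (1 + (Real.log (64 / E) + 1) / Real.log q)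

lemma neg_le_signedFactor {E q : ℝ} (hE : 0 < E) (hq : 4 ≤ q) : -5.6 ≤ signedFactor E q := by
  have hlog64 : Real.log (64 / E) = 6 * Real.log 2 - Real.log E := by
    rw [Real.log_div (by norm_num) hE.ne', show (64 : ℝ) = 2 ^ 6 by norm_num, Real.log_pow]
    norm_num
  have hlogq : 1.38 ≤ Real.log q := by
    linarith [log_four_gt, Real.log_le_log four_pos hq]
  have hlower : -√E ≤ Real.log (64 / E) + 1 := by
    linarith [log_le_sqrt hE, Real.log_two_gt_d9]
  have hquotient : -(√E / 1.38) ≤ (Real.log (64 / E) + 1) / Real.log q := by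
    calc -(√E / 1.38) ≤ -(√E / Real.log q) := by gcongr
      _ = -√E / Real.log q := (neg_div _ _).symm
      _ ≤ (Real.log (64 / E) + 1) / Real.log q := by gcongr
  calc -5.6 ≤ 7.63 / √E * (-(√E / 1.38)) := by
        rw [mul_neg, div_mul_div_comm, mul_comm √E, mul_div_mul_right _ _ (by positivity)]
        norm_num
    _ ≤ signedFactor E q := by
        unfold signedFactor
        gcongr
        linarith

lemma b₃_mul_rpow_eq (B q : ℝ) {E R : ℝ} (hE : 0 < E) (hR : 0 < R) (hER : 1 < E * R) :
    b₃ B E R q * Real.log (E * R) ^ (3 / 2 : ℝ) =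
      B ^ 2 * (signedFactor E q * (Real.log 4 + Real.log (E * R)) +
        1.48 * 0.96 * z * Real.log (E * R) ^ (3 / 2 : ℝ) + 1.48 * 1.32 * z * Real.log (E * R) +
        z * 0.96 / Real.log 2 * Real.log (2 * R) + 1.32 * z / Real.log 2) := by
  have hlog : Real.log (4 * E * R) = Real.log 4 + Real.log (E * R) := by
    rw [mul_assoc, Real.log_mul (by norm_num) (by positivity)]
  have hpos : 0 < Real.log (E * R) := Real.log_pos hER
  unfold b₃ a₅ a₆ signedFactor
  rw [hlog, rpow_three_halves_eq hpos.le]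
  field_simp

lemma le_b₃_mul (B : ℝ) {E R q : ℝ} (hE : 4 ≤ E) (hR : 1 ≤ R) (hq : 4 ≤ q) :
    16 * B ^ 2 * Real.log (4 * R) ^ (3 / 2 : ℝ) ≤ b₃ B E R q * Real.log (E * R) ^ (3 / 2 : ℝ) := by
  have := le_z
  have hlog4 : Real.log 4 ≤ Real.log (4 * R) := Real.log_le_log four_pos (by linarith)
  have hlogER : Real.log (4 * R) ≤ Real.log (E * R) := Real.log_le_log (by linarith) (by gcongr)
  have : 0 ≤ Real.log (2 * R) := Real.log_nonneg (by linarith)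
  have hpos := log_four_gt
  rw [b₃_mul_rpow_eq B q (by linarith) (by linarith) (by nlinarith)]
  set l := Real.log (E * R)
  have : 0 ≤ l := by linarith
  calc 16 * B ^ 2 * Real.log (4 * R) ^ (3 / 2 : ℝ) ≤ 16 * B ^ 2 * l ^ (3 / 2 : ℝ) := by
        gcongr
        linarith
    _ = B ^ 2 * (16 * l ^ (3 / 2 : ℝ)) := by ring
    _ ≤ B ^ 2 * (-5.6 * (2 * l) + 1.48 * 0.96 * 11.31 * l ^ (3 / 2 : ℝ) +
          1.48 * 1.32 * 11.31 * l) := by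
        gcongr
        linarith [Real.rpow_nonneg this (3 / 2 : ℝ)]
    _ ≤ B ^ 2 * (signedFactor E q * (Real.log 4 + l) + 1.48 * 0.96 * z * l ^ (3 / 2 : ℝ) +
          1.48 * 1.32 * z * l) := by
        gcongr B ^ 2 * (?_ + 1.48 * 0.96 * ?_ * _ + 1.48 * 1.32 * ?_ * _)
        nlinarith [neg_le_signedFactor (by linarith : 0 < E) hq]
    _ ≤ _ := by
        gcongr B ^ 2 * ?_
        exact (le_add_of_nonneg_right (by positivity)).trans
          (le_add_of_nonneg_right (by positivity))

/-! ### The main estimate -/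

lemma sqrt_le_of_log_le_ten {R : ℝ} (hR : 1 ≤ R) (hlog : Real.log R ≤ 10) :
    √R ≤ 16 * Real.log (4 * R) ^ (3 / 2 : ℝ) := by
  have hlog4 := log_four_gt
  have hlog4R : Real.log (4 * R) = Real.log 4 + Real.log R :=
    Real.log_mul four_ne_zero (by positivity)
  have hlogR : 0 ≤ Real.log R := Real.log_nonneg hR
  rw [rpow_three_halves_eq (by linarith)]
  rcases le_total R 625 with hsmall | hlarge
  · have hsqrt : √R ≤ 25 := Real.sqrt_le_iff.2 ⟨by norm_num, by linarith⟩
    have : 1.17 ≤ √(Real.log (4 * R)) := Real.le_sqrt_of_sq_le (by linarith)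
    nlinarith
  · have hsqrt : √R ≤ 150 := by
      refine Real.sqrt_le_iff.2 ⟨by norm_num, ?_⟩
      calc R ≤ Real.exp 10 := (Real.log_le_iff_le_exp (by linarith)).1 hlog
        _ = Real.exp 1 ^ 10 := by rw [← Real.exp_nat_mul]; norm_num
        _ ≤ 2.7183 ^ 10 := by
            gcongr
            linarith [Real.exp_one_lt_d9]
        _ ≤ 150 ^ 2 := by norm_num
    have hlog2R : Real.log (2 ^ 9) ≤ Real.log R := Real.log_le_log (by norm_num) (by linarith)
    rw [Real.log_pow] at hlog2R
    have : 7.6 ≤ Real.log (4 * R) := by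
      push_cast at hlog2R
      linarith [Real.log_two_gt_d9]
    have : 2 ≤ √(Real.log (4 * R)) := Real.le_sqrt_of_sq_le (by linarith)
    nlinarith

lemma one_add_sqrt_div_log_two_le {x : ℝ} (hx : 10 ≤ x) :
    1 + √(409 * ((x + 6) * (x + 1) + 6)) / Real.log 2 ≤ 16 * (Real.log 4 + x) ^ (3 / 2 : ℝ) := by
  have hlog2 := Real.log_two_gt_d9
  have hlog4 := log_four_gt
  rw [rpow_three_halves_eq (by linarith)]
  set y := Real.log 4 + x
  have hself : √y * √y = y := Real.mul_self_sqrt (by linarith)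
  have hsqrt : 3 ≤ √y := Real.le_sqrt_of_sq_le (by linarith)
  have hlarge : 34 ≤ y * √y := by nlinarith
  have hquadratic : √(409 * ((x + 6) * (x + 1) + 6)) ≤ 11 * (y * √y) := by
    refine Real.sqrt_le_iff.2 ⟨by positivity, ?_⟩
    calc 409 * ((x + 6) * (x + 1) + 6) ≤ 121 * y ^ 2 * 11.386 := by nlinarith
      _ ≤ 121 * y ^ 2 * y := by
          gcongr
          linarith
      _ = (11 * (y * √y)) ^ 2 := by linear_combination (-121 * y ^ 2) * hself
  have hdiv : √(409 * ((x + 6) * (x + 1) + 6)) / Real.log 2 ≤ 16 * (y * √y) - 1 := by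
    rw [div_le_iff₀ (by linarith)]
    nlinarith
  linarith

lemma norm_bilinearSum_Ioc_le_add (f : ℕ → ℂ) (N : ℕ) (w θ : ℝ) {x y z t : ℕ} (hxy : x ≤ y)
    (hyz : y ≤ z) (hzt : z ≤ t) :
    ‖bilinearSum f N w θ {p ∈ Ioc x t | p.Prime}‖ ≤
      ‖bilinearSum f N w θ {p ∈ Ioc x y | p.Prime}‖ +
      ‖bilinearSum f N w θ {p ∈ Ioc y z | p.Prime}‖ +
      ‖bilinearSum f N w θ {p ∈ Ioc z t | p.Prime}‖ := by
  rw [← bilinearSum_Ioc_add f N w θ (hxy.trans hyz) hzt, ← bilinearSum_Ioc_add f N w θ hxy hyz]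
  exact norm_add₃_le

lemma log_four_mul_add_le :
    2 * Real.log 4 * 130 + 20 + Real.log 4 * (1 + 51 * Real.log 2) ≤ 432 := by
  rw [log_four]
  nlinarith [Real.log_two_gt_d9, Real.log_two_lt_d9]

lemma norm_bilinearSum_prime_le {f : ℕ → ℂ} {B : ℝ} (hf : ∀ n, ‖f n‖ ≤ B) {N q : ℕ} (hq : 0 < q)
    (hqN : q ≤ N) (hN : 2 ^ 180 ≤ N) {a : ℤ} (ha : IsCoprime a (q : ℤ)) :
    ‖bilinearSum f N q ((a : ℝ) / q) {p ∈ Ioc 1 N | p.Prime}‖ ≤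
      B ^ 2 * (432 * N + Real.log N / Real.log 2 * dyadicError N q) := by
  have hlog : 180 ≤ Nat.log 2 N := Nat.le_log_of_pow_le one_lt_two hN
  obtain ⟨J, hJ⟩ : ∃ J, Nat.log 2 N = J + 50 := ⟨Nat.log 2 N - 50, by lia⟩
  have hJ130 : 130 ≤ J := by lia
  have hle : 2 ^ (J + 50) ≤ N := hJ ▸ Nat.pow_log_le_self 2 (by lia)
  have hlt : N < 2 ^ (J + 51) := by
    simpa only [hJ] using Nat.lt_pow_succ_log_self one_lt_two N
  have hpow : 2 ^ 130 ≤ 2 ^ J := Nat.pow_le_pow_right two_pos hJ130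
  have hpow' : 2 ^ J ≤ N := (Nat.pow_le_pow_right two_pos (Nat.le_add_right J 50)).trans hle
  have hlow := norm_bilinearSum_low_le hf N 130 (Nat.cast_pos.2 hq) ((a : ℝ) / q)
  have hmiddle := norm_bilinearSum_middle_le hf hq hqN hJ130 hle ha
  have hhigh := norm_bilinearSum_high_le hf hlt (Nat.cast_pos.2 hq) ((a : ℝ) / q)
  have hsum := (norm_bilinearSum_Ioc_le_add f N q ((a : ℝ) / q) Nat.one_le_two_pow hpow hpow').trans
    (add_le_add_three hlow hmiddle hhigh)
  refine hsum.trans ?_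
  calc _ = B ^ 2 * ((2 * Real.log 4 * 130 + 20 + Real.log 4 * (1 + 51 * Real.log 2)) * N +
          Real.log N / Real.log 2 * dyadicError N q) := by
        push_cast
        ring
    _ ≤ B ^ 2 * (432 * N + Real.log N / Real.log 2 * dyadicError N q) := by
        gcongr
        exact log_four_mul_add_le

lemma norm_S_le_mul {B : ℝ} {f : ArithmeticFunction ℂ} (hf : ∀ n, ‖f n‖ ≤ B) (N : ℕ) (θ : ℝ) :
    ‖S f N θ‖ ≤ B * N := by
  have hterm (n : ℕ) : ‖f n * e (n * θ)‖ ≤ B := by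
    rw [norm_mul, norm_e, mul_one]
    exact hf n
  refine (norm_sum_le_of_le _ fun n _ => hterm n).trans_eq ?_
  rw [sum_const, nsmul_eq_mul, Nat.card_Icc, Nat.add_sub_cancel, mul_comm]

section Multiplicative

variable {B : ℝ} {f : ArithmeticFunction ℂ}

lemma norm_S_le_sq_mul (hf : BoundedMultiplicative B f) (N : ℕ) (θ : ℝ) :
    ‖S f N θ‖ ≤ B ^ 2 * N := by
  refine (norm_S_le_mul hf.2 N θ).trans ?_
  gcongr
  exact le_self_pow₀ hf.one_le two_ne_zero

lemma norm_S_le_of_log_le (hf : BoundedMultiplicative B f) {N : ℕ} (hN : 1 < N)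
    (hlog : Real.log N ≤ 685) (θ : ℝ) : ‖S f N θ‖ ≤ 685 * B ^ 2 * (N / Real.log N) := by
  have : 0 < Real.log N := Real.log_pos (by exact_mod_cast hN)
  calc ‖S f N θ‖ ≤ B ^ 2 * N := norm_S_le_sq_mul hf N θ
    _ = Real.log N * B ^ 2 * (N / Real.log N) := by field_simp
    _ ≤ 685 * B ^ 2 * (N / Real.log N) := by gcongr

lemma norm_S_le_of_log_div_le (hf : BoundedMultiplicative B f) {N q : ℕ} (hq : 0 < q)
    (hqN : q ≤ N) (hlog : Real.log (N / q) ≤ 10) (θ : ℝ) :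
    ‖S f N θ‖ ≤ 16 * B ^ 2 * Real.log (4 * (N / q)) ^ (3 / 2 : ℝ) * √(N * q) := by
  have hR : (1 : ℝ) ≤ N / q := (one_le_div (by positivity)).2 (by exact_mod_cast hqN)
  have hsplit : (N : ℝ) = √(N / q) * √(N * q) := by
    rw [← Real.sqrt_mul (by positivity), show (N : ℝ) / q * (N * q) = N ^ 2 by field_simp,
      Real.sqrt_sq N.cast_nonneg]
  calc ‖S f N θ‖ ≤ B ^ 2 * N := norm_S_le_sq_mul hf N θ
    _ = B ^ 2 * (√(N / q) * √(N * q)) := by rw [← hsplit]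
    _ ≤ B ^ 2 * (16 * Real.log (4 * (N / q)) ^ (3 / 2 : ℝ) * √(N * q)) := by
        gcongr
        exact sqrt_le_of_log_le_ten hR hlog
    _ = _ := by ring

lemma norm_S_le_of_le_log (hf : BoundedMultiplicative B f) {N q : ℕ} (hq : 0 < q) (hqN : q ≤ N)
    (hN : 2 ^ 180 ≤ N) (hlog : 10 ≤ Real.log (N / q)) {a : ℤ} (ha : IsCoprime a (q : ℤ)) :
    ‖S f N ((a : ℝ) / q)‖ ≤ 529 * B ^ 2 * (N / Real.log N) +
      B ^ 2 / Real.log 2 * 50 * (N / √q.totient) +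
      16 * B ^ 2 * Real.log (4 * (N / q)) ^ (3 / 2 : ℝ) * √(N * q) := by
  have hB := hf.one_le
  have hlogN : 0 < Real.log N :=
    Real.log_pos (by exact_mod_cast (Nat.one_lt_two_pow (by norm_num)).trans_le hN)
  have hqs : (q : ℝ) ≤ √(N * q) := by
    refine Real.le_sqrt_of_sq_le ?_
    rw [sq]
    gcongr
  set W := √(409 * ((Real.log (N / q) + 6) * (Real.log (N / q) + 1) + 6)) with hW
  have herror : dyadicError N q = 50 * (N / √q.totient) + W * √(N * q) := by
    rw [dyadicError, hW, ← Real.sqrt_mul' _ (by positivity), mul_right_comm 409]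
  have hweight : 1 + W / Real.log 2 ≤ 16 * Real.log (4 * (N / q)) ^ (3 / 2 : ℝ) := by
    rw [Real.log_mul four_ne_zero (by positivity)]
    exact one_add_sqrt_div_log_two_le hlog
  have hS := norm_S_mul_log_le hf (hq.trans_le hqN) hq ((a : ℝ) / q)
  have hbil := norm_bilinearSum_prime_le hf.2 hq hqN hN ha
  calc ‖S f N ((a : ℝ) / q)‖
      ≤ (B * q * Real.log N + 97 * B ^ 2 * N +
          B ^ 2 * (432 * N + Real.log N / Real.log 2 * dyadicError N q)) / Real.log N := by
        rw [le_div_iff₀ hlogN]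
        linarith
    _ = 529 * B ^ 2 * (N / Real.log N) + B ^ 2 / Real.log 2 * 50 * (N / √q.totient) +
          (B * q + B ^ 2 * (W / Real.log 2 * √(N * q))) := by
        rw [herror]
        field_simp
        ring
    _ ≤ 529 * B ^ 2 * (N / Real.log N) + B ^ 2 / Real.log 2 * 50 * (N / √q.totient) +
          (B ^ 2 * √(N * q) + B ^ 2 * (W / Real.log 2 * √(N * q))) := by
        gcongr
        exact le_self_pow₀ hB two_ne_zero
    _ = 529 * B ^ 2 * (N / Real.log N) + B ^ 2 / Real.log 2 * 50 * (N / √q.totient) +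
          B ^ 2 * (1 + W / Real.log 2) * √(N * q) := by ring
    _ ≤ 529 * B ^ 2 * (N / Real.log N) + B ^ 2 / Real.log 2 * 50 * (N / √q.totient) +
          B ^ 2 * (16 * Real.log (4 * (N / q)) ^ (3 / 2 : ℝ)) * √(N * q) := by gcongr
    _ = _ := by ring

theorem norm_S_le (hf : BoundedMultiplicative B f) {N q : ℕ} (hN : 1 < N) (hq : 0 < q)
    (hqN : q ≤ N) {a : ℤ} (ha : IsCoprime a (q : ℤ)) :
    ‖S f N ((a : ℝ) / q)‖ ≤ 685 * B ^ 2 * (N / Real.log N) +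
      B ^ 2 / Real.log 2 * 50 * (N / √q.totient) +
      16 * B ^ 2 * Real.log (4 * (N / q)) ^ (3 / 2 : ℝ) * √(N * q) := by
  have hR : (1 : ℝ) ≤ N / q := (one_le_div (by positivity)).2 (by exact_mod_cast hqN)
  have : 0 ≤ Real.log (4 * (N / q)) := Real.log_nonneg (by linarith)
  have hlog_pos : 0 ≤ 685 * B ^ 2 * (N / Real.log N) := by positivity
  have htotient_pos : 0 ≤ B ^ 2 / Real.log 2 * 50 * (N / √q.totient) := by positivity
  have hsqrt_pos : 0 ≤ 16 * B ^ 2 * Real.log (4 * (N / q)) ^ (3 / 2 : ℝ) * √(N * q) := by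
    positivity
  rcases le_or_gt (Real.log N) 685 with hsmall | hlarge
  · linarith [norm_S_le_of_log_le hf hN hsmall ((a : ℝ) / q)]
  rcases le_total (Real.log (N / q)) 10 with hnear | hfar
  · linarith [norm_S_le_of_log_div_le hf hq hqN hnear ((a : ℝ) / q)]
  have hpow : 2 ^ 180 ≤ N := by
    have hlog : Real.log (2 ^ 180) ≤ Real.log N := by
      rw [Real.log_pow]
      push_cast
      linarith [Real.log_two_lt_d9]
    exact_mod_cast (Real.log_le_log_iff (by positivity) (by positivity)).1 hlog
  linarith [norm_S_le_of_le_log hf hq hqN hpow hfar ha]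

end Multiplicative

end MontgomeryVaughan

theorem theorem5 (B : ℝ) (hB : 1 ≤ B) (E : ℝ) (hE : 4 ≤ E) (N q : ℕ) (hq : 4 ≤ q) (hqN : q ≤ N)
    (a : ℤ) (haq : IsCoprime a (q : ℤ))
    (f : ArithmeticFunction ℂ) (hf : MontgomeryVaughan.BoundedMultiplicative B f) :
    ‖MontgomeryVaughan.S f N ((a : ℝ) / (q : ℝ))‖ ≤
      MontgomeryVaughan.b₁ B E * ((N : ℝ) / Real.log N)
      + MontgomeryVaughan.b₂ B E * ((N : ℝ) / (Nat.totient q : ℝ) ^ (1 / 2 : ℝ))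
      + MontgomeryVaughan.b₃ B E ((N : ℝ) / (q : ℝ)) q * Real.sqrt ((N : ℝ) * (q : ℝ))
          * Real.log (E * (N : ℝ) / (q : ℝ)) ^ (3 / 2 : ℝ) := by
  have hq' : (4 : ℝ) ≤ q := by exact_mod_cast hq
  have hR : (1 : ℝ) ≤ N / q := (one_le_div (by linarith)).2 (by exact_mod_cast hqN)
  have hN : 0 ≤ (N : ℝ) / Real.log N := div_nonneg N.cast_nonneg (Real.log_natCast_nonneg N)
  rw [← Real.sqrt_eq_rpow, mul_right_comm (MontgomeryVaughan.b₃ B E _ _), mul_div_assoc E]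
  refine (MontgomeryVaughan.norm_S_le hf (by lia) (by lia) hqN haq).trans ?_
  refine add_le_add_three ?_ ?_ ?_
  · exact mul_le_mul_of_nonneg_right (MontgomeryVaughan.le_b₁ hB hE) hN
  · exact mul_le_mul_of_nonneg_right (MontgomeryVaughan.le_b₂ B hE) (by positivity)
  · exact mul_le_mul_of_nonneg_right (MontgomeryVaughan.le_b₃_mul B hE hR hq') (Real.sqrt_nonneg _)
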